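/- **Conventions.** A triangulation $T$ consists of finitely many tetrahedra, with vertices numbered $0,1,2,3$, some of whose triangular faces are identified in pairs by affine maps (a face is never glued to itself); $|T|$ is the quotient space. A *normal surface* in $T$ is a surface $S\subset|T|$ that meets each tetrahedron in a disjoint union of triangles (each separating one vertex from the other three) and quadrilaterals (each separating two vertices from the other two), at most one type of quadrilateral occurring in each tetrahedron; more precisely, in each tetrahedron $S$ is the image of a finite disjoint family of such flat discs under a homeomorphism of the tetrahedron that maps each face to itself. Its normal coordinates in a tetrahedron are the numbers $(t_0,t_1,t_2,t_3,q_{01/23},q_{02/13},q_{03/12})$ of discs of each type, where $t_i$ counts the triangles cutting off vertex $i$ and $q_{ij/kl}$ the quadrilaterals separating $i,j$ from $k,l$. **The gadget.** Let $G$ be the triangulation with tetrahedra $0,1,2,3,4$ and the following gluings, where $k(ijl)$ is the face of tetrahedron $k$ with vertices $i,j,l$ and every gluing preserves the vertex numbers: $0(012)=2(012)$, $0(013)=1(013)$, $0(123)=1(123)$, $1(012)=3(012)$, $1(023)=3(023)$, $2(013)=4(013)$, $2(023)=4(023)$, $2(123)=3(123)$. The space $|G|$ is a ball with four vertices $0,1,2,3$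 and the four boundary faces $0(023)$, $3(013)$, $4(012)$, $4(123)$, which form the boundary of a tetrahedron. Define normal coordinate vectors in $G$ (blocks for the tetrahedra $0,\dots,4$ in order) as follows: $\mathbf{G_{t_i}}$ has $t_i=1$ in every tetrahedron and all other entries $0$; $\mathbf{G_{q_{01/23}}}$ has $q_{01/23}=1$ in every tetrahedron and all other entries $0$; $$\mathbf{G_{q_{02/13}}}=(0,0,0,0,0,1,0\mid 1,0,1,0,0,0,0\mid 0,0,0,0,0,1,0\mid 1,0,1,0,0,0,0\mid 0,0,0,0,0,1,0),$$ $$\mathbf{G_{q_{03/12}}}=(0,0,0,0,0,0,1\mid 0,0,0,0,0,0,1\mid 1,0,0,1,0,0,0\mid 0,0,0,0,0,0,1\mid 1,0,0,1,0,0,0).$$ The names are symmetric: $q_{ij/kl}=q_{ji/kl}=q_{kl/ij}$. **Replacement.** For a tetrahedron $\tau$ of a triangulation $T$ and a permutation $(a,b,c,d)$ of $(0,1,2,3)$, let $T'=T_\tau^{abcd(G)}$ be the triangulation obtained by removing $\tau$ and gluing $G$ in its place, the boundary faces of $G$ taking the place of the faces of $\tau$ via the vertex map $(0,1,2,3)\mapsto(a,b,c,d)$.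 An *identification* $\varphi:|T'|\to|T|$ is a homeomorphism that is the identity on every tetrahedron other than $\tau$ and is induced on $G$ by a homeomorphism $|G|\to\tau$ extending this identification of the boundaries. **Corollary 3.1.** Let $T$ be a triangulation, $\tau$ a tetrahedron of $T$, $(a,b,c,d)$ a permutation of $(0,1,2,3)$, and $T'=T_\tau^{abcd(G)}$. Then an identification $|T'|\to|T|$ exists. Moreover, let $S$ be a normal surface in $T$, and let $(t_0,t_1,t_2,t_3,q_{01/23},q_{02/13},q_{03/12})$ be its normal coordinates in $\tau$. Then there is a normal surface $S'$ in $T'$ that coincides with $S$ in every tetrahedron of $T$ other than $\tau$ (in particular it has the same normal coordinates there) and whose normal coordinates in $G$ are $$\mathbf{S'_G}=t_0\mathbf{G_{t_a}}+t_1\mathbf{G_{t_b}}+t_2\mathbf{G_{t_c}}+t_3\mathbf{G_{t_d}}+q_{01/23}\mathbf{G_{q_{ab/cd}}}+q_{02/13}\mathbf{G_{q_{ac/bd}}}+q_{03/12}\mathbf{G_{q_{ad/bc}}},$$ and $S$ is isotopic to $S'$: for every identification $\varphi:|T'|\to|T|$, the surface $\varphi(S')$ is ambient isotopic to $S$ in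 $|T|$. -/

import Mathlib

/-- The standard tetrahedron, in barycentric coordinates with respect to its vertices `0,1,2,3`. -/
abbrev Tetra : Type := stdSimplex ℝ (Fin 4)

/-- The affine automorphism of the tetrahedron sending vertex `i` to vertex `p i`. -/
def Tetra.permute (p : Equiv.Perm (Fin 4)) (x : Tetra) : Tetra :=
  ⟨fun i => x (p.symm i), fun i => x.2.1 (p.symm i),
    (Equiv.sum_comp p.symm (fun i => x i)).trans x.2.2⟩

/-- A (generalised) triangulation whose tetrahedra are indexed by `ι`. Face `f` of a tetrahedron is
the face opposite to its vertex `f`. If `glue i f = some (j, p)`, then face `f` of tetrahedron `i`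
is glued to face `p f` of tetrahedron `j`, each vertex `v ≠ f` of that face going to vertex `p v`;
if `glue i f = none`, then the face is a boundary face. -/
structure Triangulation (ι : Type*) where
  glue : ι → Fin 4 → Option (ι × Equiv.Perm (Fin 4))
  glue_symm : ∀ i f j p, glue i f = some (j, p) → glue j (p f) = some (i, p⁻¹)
  glue_ne_self : ∀ i f j p, glue i f = some (j, p) → (j, p f) ≠ (i, f)

namespace Triangulation

variable {ι : Type*}

/-- The identifications of points of glued faces. -/
inductive Identified (T : Triangulation ι) : (Σ _ : ι, Tetra) → (Σ _ : ι, Tetra) → Prop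
  | glue (i : ι) (f : Fin 4) (j : ι) (p : Equiv.Perm (Fin 4)) (h : T.glue i f = some (j, p))
      (x : Tetra) (hx : x f = 0) : Identified T ⟨i, x⟩ ⟨j, Tetra.permute p x⟩

/-- The underlying space of a triangulation: the disjoint union of the tetrahedra modulo the
equivalence relation generated by the face gluings, with the quotient topology. -/
def Space (T : Triangulation ι) : Type _ := Quot T.Identified

instance (T : Triangulation ι) : TopologicalSpace T.Space :=
  inferInstanceAs (TopologicalSpace (Quot T.Identified))

/-- The characteristic map of tetrahedron `i`. -/
def point (T : Triangulation ι) (i : ι) (x : Tetra) : T.Space := Quot.mk _ ⟨i, x⟩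

end Triangulation

/-! ### Normal surfaces -/

/-- Normal coordinates in one tetrahedron, in the order
`(t₀, t₁, t₂, t₃, q_{01/23}, q_{02/13}, q_{03/12})`. -/
abbrev TetCoords : Type := Fin 7 → ℕ

/-- The number of triangles around vertex `i`. -/
def TetCoords.tri (v : TetCoords) (i : Fin 4) : ℕ := v (Fin.castAdd 3 i)

/-- The number of quadrilaterals separating the vertices `0` and `k + 1` from the other two. -/
def TetCoords.quad (v : TetCoords) (k : Fin 3) : ℕ := v (Fin.natAdd 4 k)

/-- At most one quadrilateral type is used. -/
def TetCoords.Admissible (v : TetCoords) : Prop :=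
  ∀ k l, v.quad k ≠ 0 → v.quad l ≠ 0 → k = l

/-- The model family of disjoint flat normal discs with (admissible) coordinates `v`. The triangles
around vertex `i` are the sections `x i = c` at `t_i` levels `2/3 < c < 1`; the quadrilaterals
separating `0, k + 1` from the other two vertices are the sections `x 0 + x (k + 1) = c` at
levels `1/3 < c < 2/3`. -/
def TetCoords.model (v : TetCoords) : Set Tetra :=
  {x | (∃ i : Fin 4, ∃ n < v.tri i, x i = (2 + ((n : ℝ) + 1) / ((v.tri i : ℝ) + 1)) / 3) ∨
       (∃ k : Fin 3, ∃ n < v.quad k,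
          x 0 + x k.succ = (1 + ((n : ℝ) + 1) / ((v.quad k : ℝ) + 1)) / 3)}

/-- A self-homeomorphism of the tetrahedron that maps every face (hence every edge and vertex) to
itself. By coning, these are exactly the end maps of the isotopies preserving all faces,
that is, of normal isotopies of the tetrahedron. -/
def FacePreserving (θ : Tetra ≃ₜ Tetra) : Prop := ∀ x i, θ x i = 0 ↔ x i = 0

namespace Triangulation

variable {ι : Type*}

/-- `S` is a normal surface of `T` with normal coordinates `v`: in each tetrahedron, at most one
quadrilateral type occurs, and `S` is a disjoint union of normal discs (triangles and
quadrilaterals) with the numbers given by `v`, that is, up to a face-preserving homeomorphism of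
the tetrahedron, it is the flat model family. -/
def HasNormalCoords (T : Triangulation ι) (S : Set T.Space) (v : ι → TetCoords) : Prop :=
  ∀ i, (v i).Admissible ∧
    ∃ θ : Tetra ≃ₜ Tetra, FacePreserving θ ∧ T.point i ⁻¹' S = θ '' (v i).model

end Triangulation

/-! ### The gadget -/

/-- `gadgetNbr g f` is the tetrahedron glued to face `f` of tetrahedron `g` of the gadget, the
faces being listed in the order `123, 023, 013, 012`. -/
def gadgetNbr : Fin 5 → Fin 4 → Option (Fin 5) :=
  ![![some 1, none,   some 1, some 2],
    ![some 0, some 3, some 0, some 3],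
    ![some 3, some 4, some 4, some 0],
    ![some 2, some 1, none,   some 1],
    ![none,   some 2, some 2, none]]

/-- The five-tetrahedron gadget. All its gluings preserve the vertex labels, so its four vertices
are again labelled `0,1,2,3`. -/
def gadget : Triangulation (Fin 5) where
  glue g f := (gadgetNbr g f).map fun k => (k, 1)
  glue_symm := by
    intro i f j p h
    simp only [Option.map_eq_some_iff, Prod.mk.injEq] at h
    obtain ⟨k, hk, rfl, rfl⟩ := h
    have : ∀ i f k, gadgetNbr i f = some k → gadgetNbr k f = some i := by decide
    simp [this i f k hk]
  glue_ne_self := by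
    intro i f j p h
    simp only [Option.map_eq_some_iff, Prod.mk.injEq] at h
    obtain ⟨k, hk, rfl, rfl⟩ := h
    have : ∀ i f k, gadgetNbr i f = some k → k ≠ i := by decide
    simp [this i f k hk]

/-- The tetrahedron of the gadget containing the boundary face opposite to the vertex `m` of the
gadget; it is the face `m` of that tetrahedron. -/
def gadgetBdry : Fin 4 → Fin 5 := ![4, 0, 3, 4]

theorem gadgetNbr_eq_none_iff : ∀ g f, gadgetNbr g f = none ↔ g = gadgetBdry f := by decide

/-- The chosen triangle surfaces `G_{t_0}, G_{t_1}, G_{t_2}, G_{t_3}` of the gadget. -/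
def gadgetTri : Fin 4 → Fin 5 → TetCoords :=
  ![fun _ => ![1, 0, 0, 0, 0, 0, 0],
    fun _ => ![0, 1, 0, 0, 0, 0, 0],
    fun _ => ![0, 0, 1, 0, 0, 0, 0],
    fun _ => ![0, 0, 0, 1, 0, 0, 0]]

/-- The chosen surface `G_{q_{01/23}}` of the gadget. -/
def gadgetQuad0123 : Fin 5 → TetCoords :=
  fun _ => ![0, 0, 0, 0, 1, 0, 0]

/-- The chosen surface `G_{q_{02/13}}` of the gadget. -/
def gadgetQuad0213 : Fin 5 → TetCoords :=
  ![![0, 0, 0, 0, 0, 1, 0], ![1, 0, 1, 0, 0, 0, 0], ![0, 0, 0, 0, 0, 1, 0],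
    ![1, 0, 1, 0, 0, 0, 0], ![0, 0, 0, 0, 0, 1, 0]]

/-- The chosen surface `G_{q_{03/12}}` of the gadget. -/
def gadgetQuad0312 : Fin 5 → TetCoords :=
  ![![0, 0, 0, 0, 0, 0, 1], ![0, 0, 0, 0, 0, 0, 1], ![1, 0, 0, 1, 0, 0, 0],
    ![0, 0, 0, 0, 0, 0, 1], ![1, 0, 0, 1, 0, 0, 0]]

/-- The chosen surface `G_{q_{ab/cd}}` of the gadget, for distinct `a`, `b` and
`{c, d}` the complement of `{a, b}`. -/
def gadgetQuad (a b : Fin 4) : Fin 5 → TetCoords :=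
  if ({a, b} : Finset (Fin 4)) = {0, 1} ∨ ({a, b} : Finset (Fin 4)) = {2, 3} then gadgetQuad0123
  else if ({a, b} : Finset (Fin 4)) = {0, 2} ∨ ({a, b} : Finset (Fin 4)) = {1, 3} then
    gadgetQuad0213
  else gadgetQuad0312

/-! ### Replacing a tetrahedron by the gadget -/

namespace Triangulation

variable {ι : Type*} [DecidableEq ι]

/-- The tetrahedron that carries face `f` of tetrahedron `i` after replacing `τ` by the gadget. -/
def newTet (τ : ι) (σ : Equiv.Perm (Fin 4)) (i : ι) (f : Fin 4) : {i : ι // i ≠ τ} ⊕ Fin 5 :=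
  if h : i = τ then Sum.inr (gadgetBdry (σ f)) else Sum.inl ⟨i, h⟩

/-- The change of vertex labels of tetrahedron `i` when `τ` is replaced by the gadget. -/
def relabel (τ : ι) (σ : Equiv.Perm (Fin 4)) (i : ι) : Equiv.Perm (Fin 4) :=
  if i = τ then σ else 1

/-- The gluings after replacing `τ` by the gadget: face `f` of `τ` is replaced by the boundary face
of the gadget opposite to `σ f`, with vertex `v` of `τ` going to vertex `σ v` of the gadget. -/
def replaceGlue (T : Triangulation ι) (τ : ι) (σ : Equiv.Perm (Fin 4)) :
    {i : ι // i ≠ τ} ⊕ Fin 5 → Fin 4 →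
      Option (({i : ι // i ≠ τ} ⊕ Fin 5) × Equiv.Perm (Fin 4))
  | Sum.inl i, f => (T.glue i f).map fun jp =>
      (newTet τ σ jp.1 (jp.2 f), relabel τ σ jp.1 * jp.2)
  | Sum.inr g, f =>
      if g = gadgetBdry f then
        (T.glue τ (σ.symm f)).map fun jp =>
          (newTet τ σ jp.1 (jp.2 (σ.symm f)), relabel τ σ jp.1 * jp.2 * σ⁻¹)
      else (gadget.glue g f).map fun kp => (Sum.inr kp.1, kp.2)

theorem replaceGlue_newTet (T : Triangulation ι) (τ : ι) (σ : Equiv.Perm (Fin 4)) (i : ι)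
    (f : Fin 4) : T.replaceGlue τ σ (newTet τ σ i f) (relabel τ σ i f) =
      (T.glue i f).map fun jp =>
        (newTet τ σ jp.1 (jp.2 f), relabel τ σ jp.1 * jp.2 * (relabel τ σ i)⁻¹) := by
  by_cases h : i = τ
  · subst h
    simp [newTet, relabel, replaceGlue]
  · simp [newTet, relabel, h, replaceGlue]

theorem newTet_inj (τ : ι) (σ : Equiv.Perm (Fin 4)) {i j : ι} {f g : Fin 4}
    (h : newTet τ σ i f = newTet τ σ j g) (h' : relabel τ σ i f = relabel τ σ j g) :
    i = j ∧ f = g := by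
  unfold newTet at h
  unfold relabel at h'
  split_ifs at h h' <;> simp_all

/-- Either a face of the new triangulation comes from a face of `T`, or it is an interior face of
the gadget. -/
theorem new_face_cases (τ : ι) (σ : Equiv.Perm (Fin 4)) (a : {i : ι // i ≠ τ} ⊕ Fin 5)
    (f : Fin 4) : (∃ i m, a = newTet τ σ i m ∧ f = relabel τ σ i m) ∨
      ∃ g, a = Sum.inr g ∧ g ≠ gadgetBdry f := by
  rcases a with ⟨i, hi⟩ | g
  · exact Or.inl ⟨i, f, by simp [newTet, hi], by simp [relabel, hi]⟩
  · by_cases h : g = gadgetBdry f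
    · exact Or.inl ⟨τ, σ.symm f, by simp [newTet, h], by simp [relabel]⟩
    · exact Or.inr ⟨g, rfl, h⟩

/-- The triangulation `T_τ^{abcd(G)}`, where `(a, b, c, d) = (σ 0, σ 1, σ 2, σ 3)`: the tetrahedron
`τ` is removed and the gadget is glued in its place, the vertices `0, 1, 2, 3` of `τ` going to the
vertices `a, b, c, d` of the gadget. -/
def replace (T : Triangulation ι) (τ : ι) (σ : Equiv.Perm (Fin 4)) :
    Triangulation ({i : ι // i ≠ τ} ⊕ Fin 5) where
  glue := T.replaceGlue τ σ
  glue_symm := by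
    intro a f b p h
    rcases new_face_cases τ σ a f with ⟨i, m, rfl, rfl⟩ | ⟨g, rfl, hg⟩
    · rw [replaceGlue_newTet] at h
      simp only [Option.map_eq_some_iff, Prod.mk.injEq] at h
      obtain ⟨⟨j, q⟩, hq, rfl, rfl⟩ := h
      have := T.replaceGlue_newTet τ σ j (q m)
      rw [T.glue_symm i m j q hq] at this
      have e : (relabel τ σ i)⁻¹ (relabel τ σ i m) = m := by simp
      simp only [Equiv.Perm.coe_mul, Function.comp_apply, e]
      rw [this]
      simp [mul_assoc]
    · simp only [replaceGlue, if_neg hg, Option.map_eq_some_iff, Prod.mk.injEq] at h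
      obtain ⟨⟨k, q⟩, hq, rfl, rfl⟩ := h
      have h2 := gadget.glue_symm g f k q hq
      have h3 : k ≠ gadgetBdry (q f) := by
        intro h4
        have := (gadgetNbr_eq_none_iff k (q f)).2 h4
        simp [gadget, this] at h2
      simp [replaceGlue, if_neg h3, h2]
  glue_ne_self := by
    intro a f b p h
    rcases new_face_cases τ σ a f with ⟨i, m, rfl, rfl⟩ | ⟨g, rfl, hg⟩
    · rw [replaceGlue_newTet] at h
      simp only [Option.map_eq_some_iff, Prod.mk.injEq] at h
      obtain ⟨⟨j, q⟩, hq, rfl, rfl⟩ := h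
      intro h2
      have e : (relabel τ σ i)⁻¹ (relabel τ σ i m) = m := by simp
      simp only [Equiv.Perm.coe_mul, Function.comp_apply, e,
        Prod.mk.injEq] at h2
      obtain ⟨h3, h4⟩ := newTet_inj τ σ h2.1 h2.2
      exact T.glue_ne_self i m j q hq (by simp [h3, h4])
    · simp only [replaceGlue, if_neg hg, Option.map_eq_some_iff, Prod.mk.injEq] at h
      obtain ⟨⟨k, q⟩, hq, rfl, rfl⟩ := h
      have := gadget.glue_ne_self g f k q hq
      simpa using this

/-- `φ` identifies the underlying space of `T_τ^{abcd(G)}` with that of `T`: it is the identity on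
all tetrahedra other than `τ`, and it is given on the gadget by a homeomorphism `h` onto the
tetrahedron `τ` that restricts to the gluing identification of their boundaries. -/
def IsGadgetIdentification (T : Triangulation ι) (τ : ι) (σ : Equiv.Perm (Fin 4))
    (φ : (T.replace τ σ).Space ≃ₜ T.Space) : Prop :=
  (∀ (i : {i : ι // i ≠ τ}) (x : Tetra), φ ((T.replace τ σ).point (Sum.inl i) x) = T.point i x) ∧
  ∃ h : gadget.Space ≃ₜ Tetra,
    (∀ (f : Fin 4) (x : Tetra), x f = 0 →
      h (gadget.point (gadgetBdry (σ f)) (Tetra.permute σ x)) = x) ∧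
    ∀ (g : Fin 5) (x : Tetra),
      φ ((T.replace τ σ).point (Sum.inr g) x) = T.point τ (h (gadget.point g x))

end Triangulation

/-- Two subsets of a space are (ambient) isotopic. -/
def AmbientIsotopic {X : Type*} [TopologicalSpace X] (A B : Set X) : Prop :=
  ∃ F : unitInterval → X ≃ₜ X, Continuous (fun p : unitInterval × X => F p.1 p.2) ∧
    (∀ x, F 0 x = x) ∧ F 1 '' A = B

/-! The gadget is a tetrahedron with two pillows inserted, a pillow being a pair of tetrahedra glued
along two faces that share an edge, which then has degree two. Tetrahedra 1 and 3 form a pillow with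
degree two edge 02, attached to the base 0. The resulting complex is again a tetrahedron and serves
as base for the second pillow, formed by tetrahedra 2 and 4, with degree two edge 03. So two pillow
maps compose to a homeomorphism from the gadget to the tetrahedron (`exists_gadget_homeomorph`).

The surface `S` is never moved. Instead an identification `φ₀` is adapted to `S`, the surface `S'`
is the preimage of `S`, and the work lies in showing that this preimage is normal with the right
coordinates. Take a pillow with degree two edge 01. Every segment of direction (1,1,-1,-1) in the
tetrahedron is cut into three pieces, and both pillow tetrahedra are squeezed into a thin layer
along the faces opposite 0 and 1. If the layer is thin compared with the gaps between the discs, the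
base tetrahedron still sees the same disc types. The pillow tetrahedra see `S` only near those two
faces, where a quadrilateral 01/23 looks like one triangle at 0 and one at 1, while all other types
persist (`exists_pillowMap`). The base keeps its coordinates, so the second pillow and the first can
be treated by the same argument, after relabelling vertices (`exists_pillowMap_permute`).

Recognising disc types means finding face-preserving homeomorphisms that flatten the pulled back,
piecewise linear discs. The discs fall into disjoint regions, around a vertex or between the edges
01 and 23 (`NormallyIsotopic.of_exchanges`). In each region they form a stack that every line of a
suitable family (rays from the vertex, or segments joining the two edges) crosses once per disc, and
sliding along the lines moves the stack to prescribed levels (`IsSlide.exists_straighten`).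

Finally, any other identification differs from `φ₀` by a homeomorphism of `τ` that fixes the
boundary pointwise. The Alexander trick makes it isotopic to the identity relative to the boundary,
and the isotopy extends to the whole space (`ambientIsotopic_inducedMap`). -/

/-! ### Straightening a stack of surfaces along a family of lines -/

/-- The interpolation weight which is `0` for `p ≤ 0` and `1` for `m ≥ 0`. -/
noncomputable def stackWeight (p m : ℝ) : ℝ := max p 0 / (max p 0 + max (-m) 0)

theorem stackWeight_den_pos {p m : ℝ} (h : 0 ≤ m → 0 < p) : 0 < max p 0 + max (-m) 0 := by
  rcases le_or_gt 0 m with hm | hm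
  · have := h hm
    have h1 : 0 < max p 0 := lt_max_of_lt_left this
    have h2 : 0 ≤ max (-m) 0 := le_max_right _ _
    linarith
  · have h1 : 0 < max (-m) 0 := lt_max_of_lt_left (by linarith)
    have h2 : 0 ≤ max p 0 := le_max_right _ _
    linarith

theorem stackWeight_nonneg (p m : ℝ) : 0 ≤ stackWeight p m := by
  unfold stackWeight; positivity

theorem stackWeight_le_one (p m : ℝ) : stackWeight p m ≤ 1 :=
  div_le_one_of_le₀ (le_add_of_nonneg_right (le_max_right _ _)) (by positivity)

theorem stackWeight_of_nonpos {p : ℝ} (m : ℝ) (hp : p ≤ 0) : stackWeight p m = 0 := by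
  simp [stackWeight, max_eq_right hp]

theorem stackWeight_of_nonneg {p m : ℝ} (hp : 0 < p) (hm : 0 ≤ m) : stackWeight p m = 1 := by
  have : max (-m) 0 = 0 := max_eq_right (by linarith)
  rw [stackWeight, this, add_zero, max_eq_left hp.le, div_self hp.ne']

theorem stackWeight_pos {p : ℝ} (m : ℝ) (hp : 0 < p) : 0 < stackWeight p m := by
  have h1 : 0 < max p 0 := lt_max_of_lt_left hp
  unfold stackWeight; positivity

theorem stackWeight_lt_one {m : ℝ} (p : ℝ) (hm : m < 0) : stackWeight p m < 1 := by
  have h1 : 0 < max (-m) 0 := lt_max_of_lt_left (by linarith)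
  have h2 : 0 ≤ max p 0 := le_max_right _ _
  rw [stackWeight, div_lt_one (by linarith)]
  linarith

theorem stackWeight_mono {p p' m m' : ℝ} (h : 0 ≤ m → 0 < p) (h' : 0 ≤ m' → 0 < p')
    (hp : p ≤ p') (hm : m ≤ m') : stackWeight p m ≤ stackWeight p' m' := by
  have a := stackWeight_den_pos h
  have b := stackWeight_den_pos h'
  rw [stackWeight, stackWeight, div_le_div_iff₀ a b]
  have h1 : max p 0 ≤ max p' 0 := max_le_max_right _ hp
  have h2 : max (-m') 0 ≤ max (-m) 0 := max_le_max_right _ (by linarith)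
  have h3 : 0 ≤ max p 0 := le_max_right _ _
  have h4 : 0 ≤ max (-m') 0 := le_max_right _ _
  nlinarith [mul_le_mul h1 h2 h4 (h3.trans h1)]

/-- The weight is constant below the lower surface and above the upper one, so strict growth needs
the smaller point to lie between the two. -/
theorem stackWeight_lt {p p' m m' : ℝ} (hp0 : 0 ≤ p) (hm0 : m < 0)
    (hp : p < p') (hm : m < m') : stackWeight p m < stackWeight p' m' := by
  have a : 0 < max p 0 + max (-m) 0 := stackWeight_den_pos fun h => absurd h (by linarith)
  have b : 0 < max p' 0 + max (-m') 0 := stackWeight_den_pos fun _ => hp0.trans_lt hp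
  rw [stackWeight, stackWeight, div_lt_div_iff₀ a b, max_eq_left hp0,
    max_eq_left (hp0.trans hp.le), max_eq_left (by linarith : (0 : ℝ) ≤ -m)]
  have h2 : max (-m') 0 < -m := max_lt (by linarith) (by linarith)
  have h4 : 0 ≤ max (-m') 0 := le_max_right _ _
  nlinarith [mul_le_mul_of_nonneg_left h2.le hp0, mul_pos (sub_pos.2 hp) (neg_pos.2 hm0)]

/-- The height of a point in a stack of surfaces, `E n` being the (signed) position of the point
relative to surface number `n`. -/
noncomputable def stackHeight (N : ℕ) (E : ℕ → ℝ) : ℝ :=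
  ∑ n ∈ Finset.range (N + 1), stackWeight (E n) (E (n + 1))

/-- The signs that occur relative to a sequence of surfaces lying one above the other. -/
def StackOrdered (N : ℕ) (E : ℕ → ℝ) : Prop := ∀ n ≤ N, 0 ≤ E (n + 1) → 0 < E n

/-! ### The height function of an ordered stack. -/

namespace StackOrdered

variable {N : ℕ} {E E' : ℕ → ℝ}

theorem pos (h : StackOrdered N E) {j k : ℕ} (hk : k ≤ N + 1) (hE : 0 ≤ E k) (hj : j < k) :
    0 < E j := by
  induction k with
  | zero => omega
  | succ k ih =>
    have h1 := h k (by omega) hE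
    rcases Nat.lt_succ_iff_lt_or_eq.1 hj with h2 | rfl
    · exact ih (by omega) h1.le h2
    · exact h1

theorem height_split (N k : ℕ) (hk : k ≤ N + 1) (E : ℕ → ℝ) :
    stackHeight N E = ∑ n ∈ Finset.range k, stackWeight (E n) (E (n + 1)) +
      ∑ n ∈ Finset.Ico k (N + 1), stackWeight (E n) (E (n + 1)) :=
  (Finset.sum_range_add_sum_Ico _ hk).symm

/-- All weights below a surface already reached equal 1, and dually all weights above a surface not
yet passed vanish. So the height counts surfaces passed and adds one fractional weight. -/
theorem height_of_nonneg (h : StackOrdered N E) {k : ℕ} (hk : k ≤ N + 1) (hE : 0 ≤ E k) :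
    stackHeight N E = k + ∑ n ∈ Finset.Ico k (N + 1), stackWeight (E n) (E (n + 1)) := by
  rw [height_split N k hk]
  congr 1
  rw [Finset.sum_congr rfl (g := fun _ => (1 : ℝ))]
  · simp
  · intro n hn
    rw [Finset.mem_range] at hn
    refine stackWeight_of_nonneg (h.pos hk hE hn) ?_
    rcases Nat.lt_or_ge (n + 1) k with h1 | h1
    · exact (h.pos hk hE h1).le
    · rwa [show n + 1 = k by omega]

theorem height_of_nonpos (h : StackOrdered N E) {k : ℕ} (hk : k ≤ N + 1) (hE : E k ≤ 0) :
    stackHeight N E = ∑ n ∈ Finset.range k, stackWeight (E n) (E (n + 1)) := by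
  rw [height_split N k hk]
  convert add_zero _
  refine Finset.sum_eq_zero fun n hn => stackWeight_of_nonpos _ ?_
  rw [Finset.mem_Ico] at hn
  rcases hn.1.eq_or_lt with rfl | h1
  · exact hE
  · by_contra! h2
    exact absurd (h.pos (by omega) h2.le h1) (by linarith)

theorem le_height (h : StackOrdered N E) {k : ℕ} (hk : k ≤ N + 1) (hE : 0 ≤ E k) :
    k ≤ stackHeight N E := by
  rw [h.height_of_nonneg hk hE]
  have := Finset.sum_nonneg fun n (_ : n ∈ Finset.Ico k (N + 1)) =>
    stackWeight_nonneg (E n) (E (n + 1))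
  linarith

theorem height_le (h : StackOrdered N E) {k : ℕ} (hk : k ≤ N + 1) (hE : E k ≤ 0) :
    stackHeight N E ≤ k := by
  rw [h.height_of_nonpos hk hE]
  have := Finset.sum_le_sum fun n (_ : n ∈ Finset.range k) =>
    stackWeight_le_one (E n) (E (n + 1))
  simpa using this

theorem lt_height (h : StackOrdered N E) {k : ℕ} (hk : k ≤ N) (hE : 0 < E k) :
    k < stackHeight N E := by
  rw [h.height_of_nonneg (by omega) hE.le]
  have := Finset.sum_pos' (fun n (_ : n ∈ Finset.Ico k (N + 1)) =>
    stackWeight_nonneg (E n) (E (n + 1)))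
    ⟨k, Finset.mem_Ico.2 ⟨le_rfl, by omega⟩, stackWeight_pos _ hE⟩
  linarith

theorem height_lt (h : StackOrdered N E) {k : ℕ} (hk : k ≤ N) (hE : E (k + 1) < 0) :
    stackHeight N E < (k + 1 : ℕ) := by
  rw [h.height_of_nonpos (by omega) hE.le]
  have := Finset.sum_lt_sum (fun n (_ : n ∈ Finset.range (k + 1)) =>
    stackWeight_le_one (E n) (E (n + 1)))
    ⟨k, Finset.mem_range.2 (by omega), stackWeight_lt_one _ hE⟩
  simpa using this

/-- This turns all surfaces of the stack into level sets of one function, so that taking this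
function as the new height makes them horizontal simultaneously. -/
theorem height_eq_iff (h : StackOrdered N E) {k : ℕ} (hk : k < N) :
    stackHeight N E = (k + 1 : ℕ) ↔ E (k + 1) = 0 := by
  constructor
  · intro h1
    rcases lt_trichotomy (E (k + 1)) 0 with h2 | h2 | h2
    · exact absurd h1 (h.height_lt (by omega) h2).ne
    · exact h2
    · exact absurd h1 (h.lt_height (by omega) h2).ne'
  · intro h1
    exact le_antisymm (h.height_le (by omega) h1.le) (h.le_height (by omega) h1.ge)

/-- Each summand grows weakly, and the summand of the gap containing the lower point grows strictly.
The two end conditions guarantee that this point does lie in some gap. -/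
theorem height_lt_height (h : StackOrdered N E) (h' : StackOrdered N E')
    (hlt : ∀ n ≤ N + 1, E n < E' n) (h0 : 0 ≤ E 0) (hN : E (N + 1) < 0) :
    stackHeight N E < stackHeight N E' := by
  -- A discrete intermediate value argument: the signs start nonnegative and end negative.
  have key : ∃ n ≤ N, 0 ≤ E n ∧ E (n + 1) < 0 := by
    by_contra! hc
    have : ∀ n ≤ N + 1, 0 ≤ E n := by
      intro n
      induction n with
      | zero => intro _; exact h0
      | succ n ih => intro hn; exact hc n (by omega) (ih (by omega))
    exact absurd (this (N + 1) le_rfl) (by linarith)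
  obtain ⟨n, hn, h1, h2⟩ := key
  refine Finset.sum_lt_sum (fun i hi => ?_) ⟨n, Finset.mem_range.2 (by omega),
    stackWeight_lt h1 h2 (hlt n (by omega)) (hlt (n + 1) (by omega))⟩
  rw [Finset.mem_range] at hi
  exact stackWeight_mono (h i (by omega)) (h' i (by omega)) (hlt i (by omega)).le
    (hlt (i + 1) (by omega)).le

end StackOrdered

/-- A family of lines in the tetrahedron that cross the region `a ≤ u ≤ b`, parametrised by the
height `u`: `slide x c` is the point at height `c` on the line through `x`. -/
structure IsSlide (u : Tetra → ℝ) (a b : ℝ) (slide : Tetra → ℝ → Tetra) : Prop where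
  lt : a < b
  continuous_height : Continuous u
  continuousOn : ContinuousOn (fun p : Tetra × ℝ => slide p.1 p.2)
    {p | u p.1 ∈ Set.Icc a b ∧ p.2 ∈ Set.Icc a b}
  height : ∀ x c, u x ∈ Set.Icc a b → c ∈ Set.Icc a b → u (slide x c) = c
  self : ∀ x, u x ∈ Set.Icc a b → slide x (u x) = x
  trans : ∀ x c d, u x ∈ Set.Icc a b → c ∈ Set.Icc a b → d ∈ Set.Icc a b →
    slide (slide x c) d = slide x d
  face : ∀ x c i, u x ∈ Set.Icc a b → c ∈ Set.Icc a b → (slide x c i = 0 ↔ x i = 0)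

namespace IsSlide

variable {u : Tetra → ℝ} {a b : ℝ} {slide : Tetra → ℝ → Tetra}

/-- A strictly monotone change of height along the lines is a homeomorphism. -/
theorem exists_homeomorph (hs : IsSlide u a b slide) (G : Tetra → ℝ)
    (hG : ContinuousOn G {x | u x ∈ Set.Icc a b})
    (ha : ∀ x, u x = a → G x = a) (hb : ∀ x, u x = b → G x = b)
    (hmono : ∀ x, u x ∈ Set.Icc a b → StrictMonoOn (fun c => G (slide x c)) (Set.Icc a b)) :
    ∃ θ : Tetra ≃ₜ Tetra, FacePreserving θ ∧ (∀ x, u x ∉ Set.Ioo a b → θ x = x) ∧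
      ∀ x, u x ∈ Set.Icc a b → u (θ x) = G x := by
  classical
  have hab := hs.lt
  have hGmem : ∀ x, u x ∈ Set.Icc a b → G x ∈ Set.Icc a b := by
    intro x hx
    have e1 : G (slide x a) = a := ha _ (hs.height x a hx ⟨le_rfl, hab.le⟩)
    have e2 : G (slide x b) = b := hb _ (hs.height x b hx ⟨hab.le, le_rfl⟩)
    have e3 : G (slide x (u x)) = G x := by rw [hs.self x hx]
    have m := (hmono x hx).monotoneOn
    constructor
    · rw [← e3]; exact e1.ge.trans (m ⟨le_rfl, hab.le⟩ hx hx.1)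
    · rw [← e3]; exact (m hx ⟨hab.le, le_rfl⟩ hx.2).trans e2.le
  let g : Tetra → Tetra := fun x => if u x ∈ Set.Icc a b then slide x (G x) else x
  have g_in : ∀ x, u x ∈ Set.Icc a b → g x = slide x (G x) := fun x hx => if_pos hx
  have g_out : ∀ x, u x ∉ Set.Ioo a b → g x = x := by
    intro x hx
    by_cases h : u x ∈ Set.Icc a b
    · rw [g_in x h]
      rcases h.1.eq_or_lt with h1 | h1
      · rw [ha x h1.symm]; nth_rewrite 1 [h1]; exact hs.self x h
      · rcases h.2.eq_or_lt with h2 | h2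
        · rw [hb x h2]; nth_rewrite 1 [← h2]; exact hs.self x h
        · exact absurd ⟨h1, h2⟩ hx
    · exact if_neg h
  have u_g : ∀ x, u x ∈ Set.Icc a b → u (g x) = G x := fun x hx => by
    rw [g_in x hx, hs.height x _ hx (hGmem x hx)]
  have hu := hs.continuous_height
  have g_cont : Continuous g := by
    have c1 : ContinuousOn g {x | u x ∈ Set.Icc a b} := by
      refine ContinuousOn.congr (f := fun x => slide x (G x)) ?_ fun x hx => g_in x hx
      exact hs.continuousOn.comp (continuousOn_id.prodMk hG) fun x hx => ⟨hx, hGmem x hx⟩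
    have c2 : ContinuousOn g {x | u x ∉ Set.Ioo a b} :=
      continuousOn_id.congr fun x hx => g_out x hx
    have := c1.union_of_isClosed c2 (isClosed_Icc.preimage hu)
      ((isOpen_Ioo.preimage hu).isClosed_compl)
    rw [← continuousOn_univ]
    refine this.mono fun x _ => ?_
    by_cases h : u x ∈ Set.Ioo a b
    · exact Or.inl (Set.Ioo_subset_Icc_self h)
    · exact Or.inr h
  have u_mem : ∀ x, u (g x) ∈ Set.Icc a b ↔ u x ∈ Set.Icc a b := by
    intro x
    by_cases h : u x ∈ Set.Icc a b
    · rw [u_g x h]; exact iff_of_true (hGmem x h) h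
    · rw [g_out x fun h' => h (Set.Ioo_subset_Icc_self h')]
  -- Points with the same image lie on one line, by `trans`, and on a line the function `G`
  -- separates heights.
  have g_inj : Function.Injective g := by
    intro x y hxy
    by_cases hx : u x ∈ Set.Icc a b
    · have hy : u y ∈ Set.Icc a b := by rwa [← u_mem, ← hxy, u_mem]
      have hc : G x = G y := by rw [← u_g x hx, ← u_g y hy, hxy]
      have e : slide x (G x) = slide y (G x) := by
        rw [← g_in x hx, hxy, g_in y hy, hc]
      have e1 : slide x (u y) = y := by
        rw [← hs.trans x (G x) (u y) hx (hGmem x hx) hy, e,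
          hs.trans y (G x) (u y) hy (hGmem x hx) hy, hs.self y hy]
      have e2 : u x = u y := by
        refine (hmono x hx).injOn hx hy ?_
        simp only [e1, hs.self x hx, hc]
      rw [← e1, ← e2, hs.self x hx]
    · have hy : u y ∉ Set.Icc a b := by rwa [← u_mem, ← hxy, u_mem]
      rwa [g_out x fun h => hx (Set.Ioo_subset_Icc_self h),
        g_out y fun h => hy (Set.Ioo_subset_Icc_self h)] at hxy
  -- The intermediate value theorem for `G` along the line through `y`, whose end values are `a` and
  -- `b`.
  have g_surj : Function.Surjective g := by
    intro y
    by_cases hy : u y ∈ Set.Icc a b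
    · have hcont : ContinuousOn (fun c => G (slide y c)) (Set.Icc a b) := by
        have h1 : ContinuousOn (fun c => slide y c) (Set.Icc a b) :=
          hs.continuousOn.comp (continuousOn_const.prodMk continuousOn_id) fun c hc => ⟨hy, hc⟩
        exact hG.comp h1 fun c hc => by
          simpa only [Set.mem_ofPred_eq, hs.height y c hy hc] using hc
      have hiv := intermediate_value_Icc hab.le hcont
      simp only [ha _ (hs.height y a hy ⟨le_rfl, hab.le⟩),
        hb _ (hs.height y b hy ⟨hab.le, le_rfl⟩)] at hiv
      obtain ⟨c, hc, hc'⟩ := hiv hy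
      have hm : u (slide y c) ∈ Set.Icc a b := by rwa [hs.height y c hy hc]
      refine ⟨slide y c, ?_⟩
      simp only at hc'
      rw [g_in _ hm, hc', hs.trans y c _ hy hc hy, hs.self y hy]
    · exact ⟨y, g_out y fun h => hy (Set.Ioo_subset_Icc_self h)⟩
  let e : Tetra ≃ Tetra := Equiv.ofBijective g ⟨g_inj, g_surj⟩
  refine ⟨Continuous.homeoOfEquivCompactToT2 (f := e) g_cont, ?_, fun x hx => g_out x hx,
    fun x hx => u_g x hx⟩
  intro x i
  change g x i = 0 ↔ x i = 0
  by_cases hx : u x ∈ Set.Icc a b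
  · rw [g_in x hx]; exact hs.face x _ i hx (hGmem x hx)
  · rw [g_out x fun h => hx (Set.Ioo_subset_Icc_self h)]

/-- A stack of surfaces `F n = 0`, each crossed once by every line, can be moved to equidistant
levels. -/
theorem exists_straighten (hs : IsSlide u a b slide) (N : ℕ) (F : ℕ → Tetra → ℝ)
    (hF : ∀ n < N, Continuous (F n))
    (hmono : ∀ n < N, ∀ x, u x ∈ Set.Icc a b →
      StrictMonoOn (fun c => F n (slide x c)) (Set.Icc a b))
    (hord : ∀ n, n + 1 < N → ∀ x, u x ∈ Set.Icc a b → 0 ≤ F (n + 1) x → 0 < F n x)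
    (hbot : ∀ n < N, ∀ x, u x = a → F n x < 0)
    (htop : ∀ n < N, ∀ x, u x = b → 0 < F n x) :
    ∃ θ : Tetra ≃ₜ Tetra, FacePreserving θ ∧ (∀ x, u x ∉ Set.Ioo a b → θ x = x) ∧
      (∀ x, u x ∈ Set.Ioo a b → u (θ x) ∈ Set.Ioo a b) ∧
      ∀ x, u x ∈ Set.Ioo a b → ∀ n < N,
        (F n x = 0 ↔ u (θ x) = a + (b - a) * (((n : ℝ) + 1) / ((N : ℝ) + 1))) := by
  have hab := hs.lt
  -- The bottom and the top of the region are added to the stack as numbers 0 and `N + 1`, so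
  -- surface `F n` becomes number `n + 1`.
  let E : ℕ → Tetra → ℝ := fun n x =>
    if n = 0 then u x - a else if n = N + 1 then u x - b else F (n - 1) x
  have E0 : ∀ x, E 0 x = u x - a := fun x => if_pos rfl
  have EN : ∀ x, E (N + 1) x = u x - b := fun x => by simp [E]
  have EF : ∀ n < N, ∀ x, E (n + 1) x = F n x := fun n hn x => by
    simp [E, hn.ne]
  have cases_n : ∀ P : ℕ → Prop, P 0 → P (N + 1) → (∀ n < N, P (n + 1)) → ∀ n ≤ N + 1, P n := by
    intro P h0 h1 h2 n hn
    rcases n with _ | n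
    · exact h0
    · rcases Nat.lt_or_ge n N with h | h
      · exact h2 n h
      · rwa [show n = N by omega]
  have Econt : ∀ n ≤ N + 1, Continuous (E n) := by
    have hu := hs.continuous_height
    apply cases_n
    · simp only [funext E0]; fun_prop
    · simp only [funext EN]; fun_prop
    · intro n hn; simp only [funext (EF n hn)]; exact hF n hn
  have Emono : ∀ n ≤ N + 1, ∀ x, u x ∈ Set.Icc a b → ∀ c ∈ Set.Icc a b, ∀ d ∈ Set.Icc a b, c < d →
      E n (slide x c) < E n (slide x d) := by
    apply cases_n
    · intro x hx c hc d hd hcd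
      rw [E0, E0, hs.height x c hx hc, hs.height x d hx hd]; linarith
    · intro x hx c hc d hd hcd
      rw [EN, EN, hs.height x c hx hc, hs.height x d hx hd]; linarith
    · intro n hn x hx c hc d hd hcd
      rw [EF n hn, EF n hn]; exact hmono n hn x hx hc hd hcd
  have Ord : ∀ x, u x ∈ Set.Icc a b → StackOrdered N fun n => E n x := by
    have htop' : ∀ x, u x ∈ Set.Icc a b → ∀ n < N, 0 ≤ u x - b → 0 < F n x := by
      intro x hx n hn h
      exact htop n hn x (le_antisymm hx.2 (by linarith))
    intro x hx n hn h
    change 0 ≤ E (n + 1) x at h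
    rcases n with _ | n
    · simp only [E0, sub_pos]
      rcases Nat.eq_zero_or_pos N with rfl | hN
      · rw [EN] at h; linarith
      · rw [EF 0 hN] at h
        refine lt_of_le_of_ne hx.1 fun h1 => ?_
        exact absurd (hbot 0 hN x h1.symm) (by linarith)
    · simp only [EF n (by omega : n < N)]
      rcases Nat.lt_or_ge (n + 1) N with h1 | h1
      · rw [EF _ h1] at h; exact hord n h1 x hx h
      · obtain rfl : N = n + 1 := by omega
        rw [EN] at h
        exact htop' x hx n (by omega) h
  have hN1 : (0 : ℝ) < (N : ℝ) + 1 := by positivity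
  -- The stack height runs from 0 at the bottom to `N + 1` at the top; rescaling puts it between `a`
  -- and `b`.
  let G : Tetra → ℝ := fun x => a + (b - a) * (stackHeight N (fun n => E n x) / ((N : ℝ) + 1))
  have ex := hs.exists_homeomorph G ?_ ?_ ?_ ?_
  · obtain ⟨θ, h1, h2, h3⟩ := ex
    refine ⟨θ, h1, h2, ?_, ?_⟩
    · intro x hx
      by_contra h
      -- If `θ x` left the region, it would be fixed by `θ`, and injectivity would give `θ x = x`.
      have : θ x = x := θ.injective (h2 _ h)
      rw [this] at h
      exact h hx
    · intro x hx n hn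
      have hx' := Set.Ioo_subset_Icc_self hx
      rw [h3 x hx', ← EF n hn, ← (Ord x hx').height_eq_iff hn]
      have : b - a ≠ 0 := (sub_pos.2 hab).ne'
      simp only [G, add_right_inj, mul_right_inj' this, div_left_inj' hN1.ne']
      push_cast
      rfl
  · refine continuousOn_const.add (continuousOn_const.mul (ContinuousOn.div_const ?_ _))
    refine continuousOn_finsetSum _ fun n hn => ?_
    rw [Finset.mem_range] at hn
    have c1 := Econt n (by omega)
    have c2 := Econt (n + 1) (by omega)
    refine ContinuousOn.div (by fun_prop) (by fun_prop) fun x hx => ?_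
    exact (stackWeight_den_pos (Ord x hx n (by omega))).ne'
  · intro x hx
    have hx' : u x ∈ Set.Icc a b := ⟨hx.ge, hx.le.trans hab.le⟩
    have : stackHeight N (fun n => E n x) = 0 := le_antisymm
      (by simpa using (Ord x hx').height_le (k := 0) (by omega) (by simp [E0, hx]))
      (by simpa using (Ord x hx').le_height (k := 0) (by omega) (by simp [E0, hx]))
    simp [G, this]
  · intro x hx
    have hx' : u x ∈ Set.Icc a b := ⟨hx ▸ hab.le, hx.le⟩
    have : stackHeight N (fun n => E n x) = (N : ℝ) + 1 := le_antisymm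
      (by simpa using (Ord x hx').height_le (k := N + 1) (by omega) (by simp [EN, hx]))
      (by simpa using (Ord x hx').le_height (k := N + 1) (by omega) (by simp [EN, hx]))
    simp [G, this, hN1.ne']
  · intro x hx c hc d hd hcd
    have m : ∀ c ∈ Set.Icc a b, u (slide x c) ∈ Set.Icc a b := fun c hc => by
      rwa [hs.height x c hx hc]
    have := (Ord _ (m c hc)).height_lt_height (Ord _ (m d hd))
      (fun n hn => Emono n hn x hx c hc d hd hcd)
      (by simpa [E0, hs.height x c hx hc] using hc.1)
      (by simpa [EN, hs.height x c hx hc] using hcd.trans_le hd.2)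
    have h4 : 0 < b - a := sub_pos.2 hab
    simp only [G]
    gcongr

end IsSlide

/-! ### Coordinates of points of the tetrahedron -/

@[fun_prop]
theorem Tetra.continuous_coord (i : Fin 4) : Continuous fun x : Tetra => x i :=
  (continuous_apply i).comp continuous_subtype_val

theorem Tetra.nonneg (x : Tetra) (i : Fin 4) : 0 ≤ x i := x.2.1 i

theorem Tetra.sum_four (x : Tetra) : x 0 + x 1 + x 2 + x 3 = 1 := by
  have := x.2.2
  rwa [Fin.sum_univ_four] at this

/-- The four indices are the vertices of the tetrahedron, in some order. -/
def Labelling (i j k l : Fin 4) : Prop := ∀ m, m = i ∨ m = j ∨ m = k ∨ m = l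

instance (i j k l : Fin 4) : Decidable (Labelling i j k l) :=
  inferInstanceAs (Decidable (∀ m, m = i ∨ m = j ∨ m = k ∨ m = l))

theorem Labelling.ne {i j k l : Fin 4} (h : Labelling i j k l) :
    i ≠ j ∧ i ≠ k ∧ i ≠ l ∧ j ≠ k ∧ j ≠ l ∧ k ≠ l := by
  revert i j k l; decide

theorem Labelling.sum {i j k l : Fin 4} (h : Labelling i j k l) (x : Tetra) :
    x i + x j + x k + x l = 1 := by
  obtain ⟨h1, h2, h3, h4, h5, h6⟩ := h.ne
  have : (Finset.univ : Finset (Fin 4)) = {i, j, k, l} := by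
    ext m; simpa using h m
  have hx : ∑ m, x m = 1 := x.2.2
  rw [this, Finset.sum_insert (by simp [h1, h2, h3]), Finset.sum_insert (by simp [h4, h5]),
    Finset.sum_insert (by simp [h6]), Finset.sum_singleton] at hx
  linarith

theorem Tetra.le_one (x : Tetra) (i : Fin 4) : x i ≤ 1 := stdSimplex.le_one x i

theorem Tetra.eq_zero_of_eq_one {x : Tetra} {i m : Fin 4} (h : x i = 1) (hm : m ≠ i) :
    x m = 0 := by
  have hx : ∑ m, x m = 1 := x.2.2
  have := Finset.add_sum_erase Finset.univ (fun m => x m) (Finset.mem_univ i)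
  have h2 : ∑ m ∈ Finset.univ.erase i, x m = 0 := by linarith
  exact (Finset.sum_eq_zero_iff_of_nonneg fun m _ => x.nonneg m).1 h2 m (by simp [hm])

theorem continuousOn_tetra {X : Type*} [TopologicalSpace X] {f : X → Tetra} {s : Set X}
    (h : ∀ i, ContinuousOn (fun x => f x i) s) : ContinuousOn f s :=
  Topology.IsInducing.subtypeVal.continuousOn_iff.2 (continuousOn_pi.2 h)

theorem continuous_tetra {X : Type*} [TopologicalSpace X] {f : X → Tetra}
    (h : ∀ i, Continuous (fun x => f x i)) : Continuous f :=
  continuous_induced_rng.2 (continuous_pi h)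

/-! ### Rays from a vertex -/

open Classical in
/-- The image of `x` under the homothety with centre the vertex `i` and ratio `ρ`, if it lies in
the tetrahedron. -/
noncomputable def Tetra.ray (i : Fin 4) (x : Tetra) (ρ : ℝ) : Tetra :=
  if h : 0 ≤ ρ ∧ ρ * (1 - x i) ≤ 1 then
    ⟨fun m => if m = i then 1 - ρ * (1 - x i) else ρ * x m, by
      refine ⟨fun m => ?_, ?_⟩
      · show 0 ≤ (if m = i then 1 - ρ * (1 - x i) else ρ * x m)
        split_ifs
        · linarith [h.2]
        · exact mul_nonneg h.1 (x.nonneg m)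
      · have hx : ∑ m, x m = 1 := x.2.2
        have e1 := Finset.add_sum_erase Finset.univ (fun m => x m) (Finset.mem_univ i)
        rw [← Finset.add_sum_erase Finset.univ _ (Finset.mem_univ i), if_pos rfl,
          Finset.sum_congr rfl (g := fun m => ρ * x m)
            (fun m hm => if_neg (Finset.ne_of_mem_erase hm)), ← Finset.mul_sum]
        rw [show ∑ m ∈ Finset.univ.erase i, x m = 1 - x i by linarith]
        ring⟩
  else x

theorem Tetra.ray_self_coord {i : Fin 4} {x : Tetra} {ρ : ℝ} (h : 0 ≤ ρ) (h' : ρ * (1 - x i) ≤ 1) :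
    Tetra.ray i x ρ i = 1 - ρ * (1 - x i) := by
  rw [Tetra.ray, dif_pos ⟨h, h'⟩]
  exact if_pos rfl

theorem Tetra.ray_coord {i m : Fin 4} {x : Tetra} {ρ : ℝ} (h : 0 ≤ ρ) (h' : ρ * (1 - x i) ≤ 1)
    (hm : m ≠ i) : Tetra.ray i x ρ m = ρ * x m := by
  rw [Tetra.ray, dif_pos ⟨h, h'⟩]
  exact if_neg hm

theorem Tetra.continuousOn_ray (i : Fin 4) :
    ContinuousOn (fun p : Tetra × ℝ => Tetra.ray i p.1 p.2)
      {p | 0 ≤ p.2 ∧ p.2 * (1 - p.1 i) ≤ 1} := by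
  refine continuousOn_tetra fun m => ?_
  have c : ∀ m, Continuous fun p : Tetra × ℝ => p.1 m := fun m =>
    (Tetra.continuous_coord m).comp continuous_fst
  by_cases hm : m = i
  · subst hm
    refine ContinuousOn.congr (f := fun p : Tetra × ℝ => 1 - p.2 * (1 - p.1 m)) ?_
      fun p hp => Tetra.ray_self_coord hp.1 hp.2
    have := c m
    fun_prop
  · refine ContinuousOn.congr (f := fun p : Tetra × ℝ => p.2 * p.1 m) ?_
      fun p hp => Tetra.ray_coord hp.1 hp.2 hm
    have := c m
    fun_prop

/-- `φ` is affine along the rays from vertex `i`, with value `1` at this vertex. -/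
def IsConical (i : Fin 4) (φ : Tetra → ℝ) : Prop :=
  ∀ (x y : Tetra) (ρ : ℝ), 0 ≤ ρ → (∀ m, m ≠ i → y m = ρ * x m) → φ y = 1 - ρ * (1 - φ x)

/-- At the vertex all other coordinates vanish, so the point is its own image under every homothety.
Ratio 2 then forces the value 1. -/
theorem IsConical.lt_one {i : Fin 4} {φ : Tetra → ℝ} (h : IsConical i φ) {x : Tetra}
    (hx : φ x < 1) : x i < 1 := by
  refine lt_of_le_of_ne (x.le_one i) fun h1 => ?_
  have := h x x 2 (by norm_num) fun m hm => by rw [Tetra.eq_zero_of_eq_one h1 hm]; ring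
  linarith

theorem IsConical.apply_ray {i : Fin 4} {φ : Tetra → ℝ} (h : IsConical i φ) {x : Tetra} {ρ : ℝ}
    (h0 : 0 ≤ ρ) (h1 : ρ * (1 - x i) ≤ 1) : φ (Tetra.ray i x ρ) = 1 - ρ * (1 - φ x) :=
  h _ _ ρ h0 fun _ hm => Tetra.ray_coord h0 h1 hm

/-- The rays from a vertex, parametrised by a conical function `L`. -/
theorem IsConical.isSlide {i : Fin 4} {L : Tetra → ℝ} (hL : IsConical i L) (hc : Continuous L)
    (hle : ∀ x, L x ≤ x i) {a b : ℝ} (ha : 0 < a) (hab : a < b) (hb : b < 1) :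
    IsSlide L a b fun x c => Tetra.ray i x ((1 - c) / (1 - L x)) := by
  have den : ∀ x, L x ∈ Set.Icc a b → 0 < 1 - L x := fun x hx => by linarith [hx.2]
  have num : ∀ c, c ∈ Set.Icc a b → 0 < 1 - c := fun c hc => by linarith [hc.2]
  have pos : ∀ x c, L x ∈ Set.Icc a b → c ∈ Set.Icc a b → 0 < (1 - c) / (1 - L x) :=
    fun x c hx hc => div_pos (num c hc) (den x hx)
  -- Since `L x ≤ x i`, moving along a ray to height `c` keeps coordinate `i` at least `c`. The
  -- point therefore stays in the tetrahedron and off the face opposite `i`.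
  have bd : ∀ x c, L x ∈ Set.Icc a b → c ∈ Set.Icc a b →
      (1 - c) / (1 - L x) * (1 - x i) ≤ 1 - c := by
    intro x c hx hc
    have h1 := den x hx
    have h2 := num c hc
    rw [div_mul_eq_mul_div, div_le_iff₀ h1]
    exact mul_le_mul_of_nonneg_left (by linarith [hle x]) h2.le
  have bd' : ∀ x c, L x ∈ Set.Icc a b → c ∈ Set.Icc a b →
      (1 - c) / (1 - L x) * (1 - x i) ≤ 1 := fun x c hx hc =>
    (bd x c hx hc).trans (by linarith [hc.1])
  have height : ∀ x c, L x ∈ Set.Icc a b → c ∈ Set.Icc a b →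
      L (Tetra.ray i x ((1 - c) / (1 - L x))) = c := by
    intro x c hx hc
    rw [hL.apply_ray (pos x c hx hc).le (bd' x c hx hc), div_mul_cancel₀ _ (den x hx).ne']
    ring
  refine ⟨hab, hc, ?_, height, ?_, ?_, ?_⟩
  · refine (Tetra.continuousOn_ray i).comp (f := fun p : Tetra × ℝ =>
      (p.1, (1 - p.2) / (1 - L p.1))) ?_ fun p hp => ⟨(pos _ _ hp.1 hp.2).le, bd' _ _ hp.1 hp.2⟩
    refine continuousOn_fst.prodMk (ContinuousOn.div (by fun_prop) (by fun_prop) ?_)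
    exact fun p hp => (den p.1 hp.1).ne'
  · intro x hx
    have h1 : (1 - L x) / (1 - L x) = 1 := div_self (den x hx).ne'
    have h2 : 1 * (1 - x i) ≤ 1 := by linarith [x.nonneg i]
    rw [h1]
    ext m
    by_cases hm : m = i
    · subst hm; rw [Tetra.ray_self_coord zero_le_one h2]; ring
    · rw [Tetra.ray_coord zero_le_one h2 hm]; ring
  · intro x c d hx hc hd
    have hy : L (Tetra.ray i x ((1 - c) / (1 - L x))) ∈ Set.Icc a b := by rwa [height x c hx hc]
    have p1 := (pos x c hx hc).le
    have p2 := bd' x c hx hc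
    have p3 := (pos x d hx hd).le
    have p4 := bd' x d hx hd
    have p5 := (pos _ d hy hd).le
    have p6 := bd' _ d hy hd
    have e1 : (1 - d) / (1 - c) * ((1 - c) / (1 - L x)) = (1 - d) / (1 - L x) := by
      rw [div_mul_div_cancel₀ (num c hc).ne']
    simp only [height x c hx hc] at p5 p6 ⊢
    ext m
    by_cases hm : m = i
    · subst hm
      rw [Tetra.ray_self_coord p5 p6, Tetra.ray_self_coord p1 p2, Tetra.ray_self_coord p3 p4,
        ← e1]
      ring
    · rw [Tetra.ray_coord p5 p6 hm, Tetra.ray_coord p1 p2 hm, Tetra.ray_coord p3 p4 hm, ← e1]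
      ring
  · intro x c m hx hc
    by_cases hm : m = i
    · subst hm
      rw [Tetra.ray_self_coord (pos x c hx hc).le (bd' x c hx hc)]
      have h1 := bd x c hx hc
      have h2 := hle x
      exact iff_of_false (by linarith [hc.1]) (by linarith [hx.1])
    · rw [Tetra.ray_coord (pos x c hx hc).le (bd' x c hx hc) hm, mul_eq_zero,
        or_iff_right (pos x c hx hc).ne']

theorem exists_pos_forall_lt (N : ℕ) (f : ℕ → ℝ) (h : ∀ n < N, 0 < f n) :
    ∃ δ > 0, ∀ n < N, δ < f n := by
  induction N with
  | zero => exact ⟨1, one_pos, fun n hn => absurd hn (by omega)⟩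
  | succ N ih =>
    obtain ⟨δ, h1, h2⟩ := ih fun n hn => h n (by omega)
    refine ⟨min δ (f N / 2), lt_min h1 (half_pos (h N (by omega))), fun n hn => ?_⟩
    rcases Nat.lt_succ_iff_lt_or_eq.1 hn with h3 | rfl
    · exact (min_le_left _ _).trans_lt (h2 n h3)
    · exact (min_le_right _ _).trans_lt (half_lt_self (h n (by omega)))

/-- A stack of `N` surfaces `φ n = c n` around vertex `i`, contained in the region `κ < L`. -/
structure IsConicalStack (i : Fin 4) (L : Tetra → ℝ) (κ : ℝ) (N : ℕ) (φ : ℕ → Tetra → ℝ)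
    (c : ℕ → ℝ) : Prop where
  continuous : ∀ n < N, Continuous (φ n)
  conical : ∀ n < N, IsConical i (φ n)
  level_lt : ∀ n < N, c n < 1
  lt_one : ∀ n < N, ∀ x : Tetra, x i < 1 → φ n x < 1
  near : ∀ n < N, ∀ x, 1 - φ n x ≤ 3 * (1 - L x)
  ordered : ∀ n, n + 1 < N → ∀ x, κ ≤ L x → c (n + 1) ≤ φ (n + 1) x → c n < φ n x
  bottom : ∀ n < N, ∀ x, L x = κ → φ n x < c n

/-- The rays degenerate at the vertex, so the region is cut off at a height `b < 1`. By `near`, the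
hypothesis `htop` says that `b` lies above the whole stack; `lt_one` makes each function strictly
monotone along rays. -/
theorem IsConicalStack.exists_straighten {i : Fin 4} {L : Tetra → ℝ} {κ : ℝ} {N : ℕ}
    {φ : ℕ → Tetra → ℝ} {c : ℕ → ℝ} (h : IsConicalStack i L κ N φ c)
    (hL : IsConical i L) (hc : Continuous L) (hle : ∀ x, L x ≤ x i) (hκ : 0 < κ) {b : ℝ}
    (hκb : κ < b) (hb : b < 1) (htop : ∀ n < N, 3 * (1 - b) < 1 - c n) :
    ∃ θ : Tetra ≃ₜ Tetra, FacePreserving θ ∧ (∀ x, L x ∉ Set.Ioo κ b → θ x = x) ∧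
      (∀ x, L x ∈ Set.Ioo κ b → L (θ x) ∈ Set.Ioo κ b) ∧
      ∀ x, L x ∈ Set.Ioo κ b → ∀ n < N,
        (φ n x = c n ↔ L (θ x) = κ + (b - κ) * (((n : ℝ) + 1) / ((N : ℝ) + 1))) := by
  have hs := hL.isSlide hc hle hκ hκb hb
  have ex := hs.exists_straighten N (fun n x => φ n x - c n)
    (fun n hn => (h.continuous n hn).sub continuous_const) ?_
    (fun n hn x hx h' => sub_pos.2 (h.ordered n hn x hx.1 (sub_nonneg.1 h')))
    (fun n hn x hx => sub_neg.2 (h.bottom n hn x hx)) ?_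
  · obtain ⟨θ, h1, h2, h3, h4⟩ := ex
    exact ⟨θ, h1, h2, h3, fun x hx n hn => by rw [← h4 x hx n hn, sub_eq_zero]⟩
  · intro n hn x hx s hs' t ht hst
    have d : 0 < 1 - L x := by linarith [hx.2]
    have pos : ∀ s ∈ Set.Icc κ b, 0 ≤ (1 - s) / (1 - L x) := fun s hs =>
      div_nonneg (by linarith [hs.2]) d.le
    have bd : ∀ s ∈ Set.Icc κ b, (1 - s) / (1 - L x) * (1 - x i) ≤ 1 := by
      intro s hs
      rw [div_mul_eq_mul_div, div_le_iff₀ d]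
      nlinarith [hle x, hs.1, hs.2]
    have l1 := h.lt_one n hn x (hL.lt_one (by linarith))
    simp only [(h.conical n hn).apply_ray (pos s hs') (bd s hs'),
      (h.conical n hn).apply_ray (pos t ht) (bd t ht)]
    have : (1 - t) / (1 - L x) < (1 - s) / (1 - L x) := by gcongr
    nlinarith
  · intro n hn x hx
    have := h.near n hn x
    have := htop n hn
    rw [hx] at *
    linarith

/-- Two stacks of the same number of surfaces around a vertex are related by a homeomorphism that
is supported near this vertex. -/
theorem IsConicalStack.exists_exchange {i : Fin 4} {L : Tetra → ℝ} {κ : ℝ} {N : ℕ}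
    {φ φ' : ℕ → Tetra → ℝ} {c c' : ℕ → ℝ} (h : IsConicalStack i L κ N φ c)
    (h' : IsConicalStack i L κ N φ' c')
    (hL : IsConical i L) (hc : Continuous L) (hle : ∀ x, L x ≤ x i) (hκ : 0 < κ) (hκ1 : κ < 1) :
    ∃ θ : Tetra ≃ₜ Tetra, FacePreserving θ ∧ (∀ x, ¬ κ < L x → θ x = x) ∧
      ∀ x, κ < L x → κ < L (θ x) ∧
        ((∃ n < N, φ n x = c n) ↔ ∃ n < N, φ' n (θ x) = c' n) := by
  obtain ⟨δ₁, p1, q1⟩ := exists_pos_forall_lt N (fun n => (1 - c n) / 3) fun n hn =>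
    div_pos (sub_pos.2 (h.level_lt n hn)) (by norm_num)
  obtain ⟨δ₂, p2, q2⟩ := exists_pos_forall_lt N (fun n => (1 - c' n) / 3) fun n hn =>
    div_pos (sub_pos.2 (h'.level_lt n hn)) (by norm_num)
  -- One cut-off height serves both stacks, so that both are straightened to the same levels. The
  -- term `(1 - κ) / 2` keeps it above `κ`.
  obtain ⟨b, hb⟩ : ∃ b, b = 1 - min (min δ₁ δ₂) ((1 - κ) / 2) := ⟨_, rfl⟩
  have b1 : b < 1 := by
    have : 0 < min (min δ₁ δ₂) ((1 - κ) / 2) := lt_min (lt_min p1 p2) (by linarith)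
    linarith
  have b2 : κ < b := by
    have := min_le_right (min δ₁ δ₂) ((1 - κ) / 2)
    linarith
  have b3 : 1 - b ≤ δ₁ := by
    rw [hb, sub_sub_cancel]; exact (min_le_left _ _).trans (min_le_left _ _)
  have b4 : 1 - b ≤ δ₂ := by
    rw [hb, sub_sub_cancel]; exact (min_le_left _ _).trans (min_le_right _ _)
  have t1 : ∀ n < N, 3 * (1 - b) < 1 - c n := fun n hn => by linarith [q1 n hn]
  have t2 : ∀ n < N, 3 * (1 - b) < 1 - c' n := fun n hn => by linarith [q2 n hn]
  obtain ⟨θ, f1, o1, m1, s1⟩ := h.exists_straighten hL hc hle hκ b2 b1 t1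
  obtain ⟨θ', f2, o2, m2, s2⟩ := h'.exists_straighten hL hc hle hκ b2 b1 t2
  have o2' : ∀ x, L x ∉ Set.Ioo κ b → θ'.symm x = x := fun x hx => by
    rw [Homeomorph.symm_apply_eq]; exact (o2 x hx).symm
  refine ⟨θ.trans θ'.symm, ?_, ?_, ?_⟩
  · intro x j
    have := f2 (θ'.symm (θ x)) j
    rw [Homeomorph.apply_symm_apply, f1 x j] at this
    exact this.symm
  · intro x hx
    have hx' : L x ∉ Set.Ioo κ b := fun h => hx h.1
    simp [o1 x hx', o2' x hx']
  · intro x hx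
    by_cases hxb : L x < b
    · have hx' : L x ∈ Set.Ioo κ b := ⟨hx, hxb⟩
      obtain ⟨y, hy⟩ : ∃ y, y = θ'.symm (θ x) := ⟨_, rfl⟩
      have e : θ' y = θ x := by rw [hy]; simp
      have hy' : L y ∈ Set.Ioo κ b := by
        by_contra h3
        have h4 := m1 x hx'
        rw [← e, o2 y h3] at h4
        exact h3 h4
      rw [Homeomorph.trans_apply, ← hy]
      refine ⟨hy'.1, exists_congr fun n => and_congr_right fun hn => ?_⟩
      rw [s1 x hx' n hn, s2 y hy' n hn, e]
    -- Above the cut-off neither stack has a point, and nothing moves.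
    · have hx' : L x ∉ Set.Ioo κ b := fun h => hxb h.2
      have e : (θ.trans θ'.symm) x = x := by simp [o1 x hx', o2' x hx']
      rw [e]
      refine ⟨hx, iff_of_false ?_ ?_⟩
      · rintro ⟨n, hn, h3⟩
        have := h.near n hn x
        linarith [t1 n hn]
      · rintro ⟨n, hn, h3⟩
        have := h'.near n hn x
        linarith [t2 n hn]

/-! ### Piecewise linear conical functions -/

/-- A piecewise linear function that is conical with respect to vertex `i`. -/
noncomputable def coneFun (i j k l : Fin 4) (p r : ℝ) (x : Tetra) : ℝ :=
  x i - p * x j + r * min (x k) (x l)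

/-- A piecewise linear function that is conical with respect to vertex `i`. -/
noncomputable def coneHeight (i j k l : Fin 4) (p r : ℝ) (x : Tetra) : ℝ :=
  x i - p * x j - r * |x k - x l|

@[fun_prop]
theorem continuous_coneFun (i j k l : Fin 4) (p r : ℝ) : Continuous (coneFun i j k l p r) := by
  unfold coneFun; fun_prop

@[fun_prop]
theorem continuous_coneHeight (i j k l : Fin 4) (p r : ℝ) :
    Continuous (coneHeight i j k l p r) := by
  unfold coneHeight; fun_prop

theorem Labelling.ray_coord {i j k l : Fin 4} (h : Labelling i j k l) {x y : Tetra} {ρ : ℝ}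
    (hy : ∀ m, m ≠ i → y m = ρ * x m) : y i = 1 - ρ * (1 - x i) := by
  obtain ⟨h1, h2, h3, -⟩ := h.ne
  have a := h.sum x
  have b := h.sum y
  rw [hy j h1.symm, hy k h2.symm, hy l h3.symm] at b
  rw [show 1 - x i = x j + x k + x l by linarith]
  linarith

theorem Labelling.isConical_coneFun {i j k l : Fin 4} (h : Labelling i j k l) (p r : ℝ) :
    IsConical i (coneFun i j k l p r) := by
  intro x y ρ h0 hy
  obtain ⟨h1, h2, h3, -⟩ := h.ne
  rw [coneFun, coneFun, h.ray_coord hy, hy j h1.symm, hy k h2.symm, hy l h3.symm,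
    ← mul_min_of_nonneg _ _ h0]
  ring

theorem Labelling.isConical_coneHeight {i j k l : Fin 4} (h : Labelling i j k l) (p r : ℝ) :
    IsConical i (coneHeight i j k l p r) := by
  intro x y ρ h0 hy
  obtain ⟨h1, h2, h3, -⟩ := h.ne
  rw [coneHeight, coneHeight, h.ray_coord hy, hy j h1.symm, hy k h2.symm, hy l h3.symm,
    ← mul_sub, abs_mul, abs_of_nonneg h0]
  ring

theorem coneHeight_le (i j k l : Fin 4) {p r : ℝ} (hp : 0 ≤ p) (hr : 0 ≤ r) (x : Tetra) :
    coneHeight i j k l p r x ≤ x i := by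
  have := mul_nonneg hp (x.nonneg j)
  have := mul_nonneg hr (abs_nonneg (x k - x l))
  unfold coneHeight
  linarith

/-- One has `1 - coneFun = (1 + p) x j + (x k + x l - r min (x k) (x l))`. The bounds `-1 < p` and
`r < 2` make this positive off the vertex, while `p ≤ 1` and `0 ≤ r` bound it by `2 (1 - x i)`,
which is within what `near` allows. -/
theorem Labelling.isConicalStack {i j k l : Fin 4} (h : Labelling i j k l) {L : Tetra → ℝ}
    (hle : ∀ x, L x ≤ x i) {κ : ℝ} {N : ℕ} {p r c : ℕ → ℝ} (hp : ∀ n < N, -1 < p n ∧ p n ≤ 1)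
    (hr : ∀ n < N, 0 ≤ r n ∧ r n < 2) (hc : ∀ n < N, c n < 1)
    (hord : ∀ n, n + 1 < N → ∀ x, κ ≤ L x → c (n + 1) ≤ coneFun i j k l (p (n + 1)) (r (n + 1)) x →
      c n < coneFun i j k l (p n) (r n) x)
    (hbot : ∀ n < N, ∀ x, L x = κ → coneFun i j k l (p n) (r n) x < c n) :
    IsConicalStack i L κ N (fun n => coneFun i j k l (p n) (r n)) c where
  continuous n _ := continuous_coneFun ..
  conical n _ := h.isConical_coneFun (p n) (r n)
  level_lt := hc
  lt_one n hn x hx := by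
    obtain ⟨h1, h2⟩ := hp n hn
    obtain ⟨h3, h4⟩ := hr n hn
    have e := h.sum x
    have j0 := x.nonneg j
    have k0 := x.nonneg k
    have l0 := x.nonneg l
    have m1 : min (x k) (x l) ≤ (x k + x l) / 2 := by
      linarith [min_le_left (x k) (x l), min_le_right (x k) (x l)]
    have m2 := mul_le_mul_of_nonneg_left m1 h3
    unfold coneFun
    rcases j0.eq_or_lt with h5 | h5
    · rw [← h5] at e ⊢
      nlinarith
    · nlinarith [mul_pos (by linarith : 0 < 1 + p n) h5]
  near n hn x := by
    obtain ⟨h1, h2⟩ := hp n hn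
    obtain ⟨h3, h4⟩ := hr n hn
    have e := h.sum x
    have j0 := x.nonneg j
    have k0 := x.nonneg k
    have l0 := x.nonneg l
    have m1 : 0 ≤ r n * min (x k) (x l) := mul_nonneg h3 (le_min k0 l0)
    have := hle x
    unfold coneFun
    nlinarith
  ordered := hord
  bottom := hbot

/-! ### Normal isotopy -/

theorem FacePreserving.trans {θ θ' : Tetra ≃ₜ Tetra} (h : FacePreserving θ)
    (h' : FacePreserving θ') : FacePreserving (θ.trans θ') := fun x i =>
  (h' (θ x) i).trans (h x i)

theorem FacePreserving.symm {θ : Tetra ≃ₜ Tetra} (h : FacePreserving θ) :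
    FacePreserving θ.symm := fun x i => by
  have := h (θ.symm x) i
  rw [Homeomorph.apply_symm_apply] at this
  exact this.symm

theorem FacePreserving.refl : FacePreserving (Homeomorph.refl Tetra) := fun _ _ => Iff.rfl

/-- Two subsets of the tetrahedron differ by a face-preserving homeomorphism. -/
def NormallyIsotopic (A B : Set Tetra) : Prop :=
  ∃ θ : Tetra ≃ₜ Tetra, FacePreserving θ ∧ A = θ '' B

/-- A homeomorphism that is supported in `U` and moves `A` to `B` there. -/
def ExchangesIn (U A B : Set Tetra) : Prop :=
  ∃ θ : Tetra ≃ₜ Tetra, FacePreserving θ ∧ (∀ x ∉ U, θ x = x) ∧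
    ∀ x ∈ U, θ x ∈ U ∧ (x ∈ A ↔ θ x ∈ B)

/-- Induction on the regions: carrying out one exchange replaces `A` by a set that already agrees
with `B` in that region and is unchanged in all the others, because the supports are disjoint. -/
theorem NormallyIsotopic.of_exchanges {ι : Type*} [DecidableEq ι] (s : Finset ι)
    (U : ι → Set Tetra) (A B : Set Tetra)
    (hdisj : ∀ i ∈ s, ∀ j ∈ s, i ≠ j → ∀ x ∈ U i, x ∉ U j)
    (hex : ∀ i ∈ s, ExchangesIn (U i) A B)
    (hout : ∀ x, (∀ i ∈ s, x ∉ U i) → (x ∈ A ↔ x ∈ B)) : NormallyIsotopic A B := by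
  induction s using Finset.induction_on generalizing A with
  | empty =>
    refine ⟨Homeomorph.refl _, FacePreserving.refl, ?_⟩
    ext x
    simpa using hout x (by simp)
  | insert i s hi ih =>
    obtain ⟨θ, f, o, m⟩ := hex i (Finset.mem_insert_self i s)
    have o' : ∀ x ∉ U i, θ.symm x = x := fun x hx => by
      rw [Homeomorph.symm_apply_eq]; exact (o x hx).symm
    obtain ⟨θ', f', e'⟩ := ih (θ.symm ⁻¹' A)
      (fun j hj k hk => hdisj j (Finset.mem_insert_of_mem hj) k (Finset.mem_insert_of_mem hk))
      (fun j hj => by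
        obtain ⟨η, f1, o1, m1⟩ := hex j (Finset.mem_insert_of_mem hj)
        refine ⟨η, f1, o1, fun x hx => ⟨(m1 x hx).1, ?_⟩⟩
        have : x ∉ U i := hdisj j (Finset.mem_insert_of_mem hj) i (Finset.mem_insert_self i s)
          (fun h => hi (h ▸ hj)) x hx
        rw [Set.mem_preimage, o' x this]
        exact (m1 x hx).2)
      (fun x hx => by
        by_cases hxi : x ∈ U i
        · have hy : θ.symm x ∈ U i := by
            by_contra h
            have := o _ h
            rw [Homeomorph.apply_symm_apply] at this
            exact h (this ▸ hxi)
          have := (m _ hy).2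
          rwa [Homeomorph.apply_symm_apply] at this
        · rw [Set.mem_preimage, o' x hxi]
          refine hout x fun j hj => ?_
          rcases Finset.mem_insert.1 hj with rfl | hj
          · exact hxi
          · exact hx j hj)
    refine ⟨θ'.trans θ.symm, f'.trans f.symm, ?_⟩
    have : A = θ.symm '' (θ.symm ⁻¹' A) := (Set.image_preimage_eq _ θ.symm.surjective).symm
    rw [this, e', ← Set.image_comp]
    rfl

/-! ### Levels of the model discs -/

/-- The levels of the model triangles. -/
noncomputable def triLevel (N n : ℕ) : ℝ := (2 + ((n : ℝ) + 1) / ((N : ℝ) + 1)) / 3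

/-- The levels of the model quadrilaterals. -/
noncomputable def quadLevel (N n : ℕ) : ℝ := (1 + ((n : ℝ) + 1) / ((N : ℝ) + 1)) / 3

theorem level_ratio_bounds {N n : ℕ} (h : n < N) :
    1 / ((N : ℝ) + 1) ≤ ((n : ℝ) + 1) / ((N : ℝ) + 1) ∧ ((n : ℝ) + 1) / ((N : ℝ) + 1) < 1 := by
  have hN : (0 : ℝ) < (N : ℝ) + 1 := by positivity
  have h1 : (n : ℝ) < N := by exact_mod_cast h
  have h2 : (0 : ℝ) ≤ n := by positivity
  constructor
  · gcongr; linarith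
  · rw [div_lt_one hN]; linarith

theorem triLevel_bounds {N n : ℕ} (h : n < N) :
    2 / 3 + 1 / ((N : ℝ) + 1) / 3 ≤ triLevel N n ∧ triLevel N n < 1 := by
  have := level_ratio_bounds h
  unfold triLevel
  constructor <;> linarith

theorem quadLevel_bounds {N n : ℕ} (h : n < N) :
    1 / 3 + 1 / ((N : ℝ) + 1) / 3 ≤ quadLevel N n ∧ quadLevel N n < 2 / 3 := by
  have := level_ratio_bounds h
  unfold quadLevel
  constructor <;> linarith

theorem lt_triLevel {N n : ℕ} (h : n < N) : 2 / 3 < triLevel N n := by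
  have := (triLevel_bounds h).1
  have : 0 < 1 / ((N : ℝ) + 1) := by positivity
  linarith

theorem lt_quadLevel {N n : ℕ} (h : n < N) : 1 / 3 < quadLevel N n := by
  have := (quadLevel_bounds h).1
  have : 0 < 1 / ((N : ℝ) + 1) := by positivity
  linarith

theorem triLevel_lt_succ (N n : ℕ) : triLevel N n < triLevel N (n + 1) := by
  unfold triLevel; push_cast; gcongr; linarith

theorem quadLevel_lt_succ (N n : ℕ) : quadLevel N n < quadLevel N (n + 1) := by
  unfold quadLevel; push_cast; gcongr; linarith

namespace TetCoords

/-- The point `x` lies on one of the model triangles around vertex `i`. -/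
def OnTri (v : TetCoords) (i : Fin 4) (x : Tetra) : Prop :=
  ∃ n < v.tri i, x i = triLevel (v.tri i) n

/-- The point `x` lies on one of the model quadrilaterals of type `k`. -/
def OnQuad (v : TetCoords) (k : Fin 3) (x : Tetra) : Prop :=
  ∃ n < v.quad k, x 0 + x k.succ = quadLevel (v.quad k) n

theorem mem_model (v : TetCoords) (x : Tetra) :
    x ∈ v.model ↔ (∃ i, v.OnTri i x) ∨ ∃ k, v.OnQuad k x := Iff.rfl

theorem OnTri.bounds {v : TetCoords} {i : Fin 4} {x : Tetra} (h : v.OnTri i x) :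
    2 / 3 + 1 / ((v.tri i : ℝ) + 1) / 3 ≤ x i := by
  obtain ⟨n, hn, e⟩ := h
  rw [e]; exact (triLevel_bounds hn).1

theorem OnTri.lt {v : TetCoords} {i : Fin 4} {x : Tetra} (h : v.OnTri i x) : 2 / 3 < x i := by
  obtain ⟨n, hn, e⟩ := h
  rw [e]; exact lt_triLevel hn

theorem OnQuad.bounds {v : TetCoords} {k : Fin 3} {x : Tetra} (h : v.OnQuad k x) :
    1 / 3 + 1 / ((v.quad k : ℝ) + 1) / 3 ≤ x 0 + x k.succ ∧ x 0 + x k.succ < 2 / 3 := by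
  obtain ⟨n, hn, e⟩ := h
  rw [e]; exact quadLevel_bounds hn

theorem OnQuad.lt {v : TetCoords} {k : Fin 3} {x : Tetra} (h : v.OnQuad k x) :
    1 / 3 < x 0 + x k.succ := by
  obtain ⟨n, hn, e⟩ := h
  rw [e]; exact lt_quadLevel hn

theorem OnQuad.ne_zero {v : TetCoords} {k : Fin 3} {x : Tetra} (h : v.OnQuad k x) :
    v.quad k ≠ 0 := by
  obtain ⟨n, hn, -⟩ := h
  omega

end TetCoords

/-! ### Exchanging stacks around a vertex -/

/-- The given stack is compared with the flat one, which is the conical stack `p = r = 0` at the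
model levels. Condition `hflat` keeps the flat triangles, all at levels above 2/3, off the bottom of
the region. -/
theorem Labelling.exchangesIn {i j k l : Fin 4} (h : Labelling i j k l) {a b κ : ℝ} (ha : 0 ≤ a)
    (hb : 0 ≤ b) (hκ : 0 < κ) (hκ1 : κ < 1) {N : ℕ} {p r c : ℕ → ℝ}
    (hp : ∀ n < N, -1 < p n ∧ p n ≤ 1) (hr : ∀ n < N, 0 ≤ r n ∧ r n < 2) (hc : ∀ n < N, c n < 1)
    (hord : ∀ n, n + 1 < N → ∀ x, κ ≤ coneHeight i j k l a b x →
      c (n + 1) ≤ coneFun i j k l (p (n + 1)) (r (n + 1)) x → c n < coneFun i j k l (p n) (r n) x)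
    (hbot : ∀ n < N, ∀ x, coneHeight i j k l a b x = κ → coneFun i j k l (p n) (r n) x < c n)
    (hflat : ∀ x, coneHeight i j k l a b x = κ → x i ≤ 2 / 3) {A B : Set Tetra}
    (hA : ∀ x, κ < coneHeight i j k l a b x →
      (x ∈ A ↔ ∃ n < N, coneFun i j k l (p n) (r n) x = c n))
    (hB : ∀ x, κ < coneHeight i j k l a b x → (x ∈ B ↔ ∃ n < N, x i = triLevel N n)) :
    ExchangesIn {x | κ < coneHeight i j k l a b x} A B := by
  have hle := coneHeight_le i j k l ha hb
  have flat : ∀ x, coneFun i j k l 0 0 x = x i := fun x => by simp [coneFun]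
  have s1 := h.isConicalStack hle hp hr hc hord hbot
  have s2 := h.isConicalStack (p := fun _ => 0) (r := fun _ => 0) (κ := κ) (N := N)
    (c := triLevel N) hle (fun _ _ => by norm_num)
    (fun _ _ => by norm_num) (fun n hn => (triLevel_bounds hn).2)
    (fun n hn x _ hx => (triLevel_lt_succ N n).trans_le hx)
    (fun n hn x hx => by rw [flat]; exact (hflat x hx).trans_lt (lt_triLevel hn))
  obtain ⟨θ, h1, h2, h3⟩ := s1.exists_exchange s2 (h.isConical_coneHeight a b)
    (continuous_coneHeight ..) hle hκ hκ1
  refine ⟨θ, h1, h2, fun x hx => ⟨(h3 x hx).1, ?_⟩⟩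
  rw [hA x hx, hB _ (h3 x hx).1, (h3 x hx).2]
  simp only [flat]

/-- The case of a stack of triangles all given by the same function. -/
theorem Labelling.exchangesIn_tri {i j k l : Fin 4} (h : Labelling i j k l) {a b κ : ℝ}
    (ha : 0 ≤ a) (hb : 0 ≤ b) (hκ : 0 < κ) (hκ1 : κ < 1) {N : ℕ} {p r : ℝ}
    (hp : -1 < p ∧ p ≤ 1) (hr : 0 ≤ r ∧ r < 2)
    (hbot : ∀ n < N, ∀ x, coneHeight i j k l a b x = κ → coneFun i j k l p r x < triLevel N n)
    (hflat : ∀ x, coneHeight i j k l a b x = κ → x i ≤ 2 / 3) {A B : Set Tetra}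
    (hA : ∀ x, κ < coneHeight i j k l a b x →
      (x ∈ A ↔ ∃ n < N, coneFun i j k l p r x = triLevel N n))
    (hB : ∀ x, κ < coneHeight i j k l a b x → (x ∈ B ↔ ∃ n < N, x i = triLevel N n)) :
    ExchangesIn {x | κ < coneHeight i j k l a b x} A B :=
  h.exchangesIn ha hb hκ hκ1 (p := fun _ => p) (r := fun _ => r) (fun _ _ => hp) (fun _ _ => hr)
    (fun _ hn => (triLevel_bounds hn).2)
    (fun n _ _ _ hx => (triLevel_lt_succ N n).trans_le hx) hbot hflat hA hB

/-! ### The lines joining two opposite edges -/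

open Classical in
/-- The point at height `c` on the line through `x` from the edge `01` to the edge `23`. -/
noncomputable def Tetra.join (x : Tetra) (c : ℝ) : Tetra :=
  if h : (0 ≤ c ∧ c ≤ 1) ∧ 0 < x 0 + x 1 ∧ x 0 + x 1 < 1 then
    ⟨![x 0 * (c / (x 0 + x 1)), x 1 * (c / (x 0 + x 1)),
      x 2 * ((1 - c) / (1 - (x 0 + x 1))), x 3 * ((1 - c) / (1 - (x 0 + x 1)))], by
      have h1 : 0 ≤ c / (x 0 + x 1) := div_nonneg h.1.1 h.2.1.le
      have h2 : 0 ≤ (1 - c) / (1 - (x 0 + x 1)) :=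
        div_nonneg (by linarith [h.1.2]) (by linarith [h.2.2])
      constructor
      · intro m
        fin_cases m
        exacts [mul_nonneg (x.nonneg 0) h1, mul_nonneg (x.nonneg 1) h1,
          mul_nonneg (x.nonneg 2) h2, mul_nonneg (x.nonneg 3) h2]
      · have e := x.sum_four
        have h3 : 1 - (x 0 + x 1) ≠ 0 := by linarith [h.2.2]
        have h4 : x 0 + x 1 ≠ 0 := h.2.1.ne'
        rw [Fin.sum_univ_four]
        simp only [Matrix.cons_val]
        rw [← add_mul, add_assoc, ← add_mul, show x 2 + x 3 = 1 - (x 0 + x 1) by linarith,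
          mul_div_cancel₀ _ h4, mul_div_cancel₀ _ h3]
        ring⟩
  else x

theorem Tetra.join_coord {x : Tetra} {c : ℝ}
    (h : (0 ≤ c ∧ c ≤ 1) ∧ 0 < x 0 + x 1 ∧ x 0 + x 1 < 1) (m : Fin 4) :
    Tetra.join x c m = ![x 0 * (c / (x 0 + x 1)), x 1 * (c / (x 0 + x 1)),
      x 2 * ((1 - c) / (1 - (x 0 + x 1))), x 3 * ((1 - c) / (1 - (x 0 + x 1)))] m := by
  rw [Tetra.join, dif_pos h]; rfl

theorem Tetra.join_height {x : Tetra} {c : ℝ}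
    (h : (0 ≤ c ∧ c ≤ 1) ∧ 0 < x 0 + x 1 ∧ x 0 + x 1 < 1) :
    Tetra.join x c 0 + Tetra.join x c 1 = c := by
  rw [Tetra.join_coord h, Tetra.join_coord h]
  simp only [Matrix.cons_val]
  rw [← add_mul, mul_div_cancel₀ _ h.2.1.ne']

/-- Moving along such a line rescales `x 0, x 1` by one factor and `x 2, x 3` by another. Both
factors are positive for heights strictly between 0 and 1, so the faces containing a point do not
change. -/
theorem isSlide_join {a b : ℝ} (ha : 0 < a) (hab : a < b) (hb : b < 1) :
    IsSlide (fun x => x 0 + x 1) a b Tetra.join := by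
  have cond : ∀ (x : Tetra) (c : ℝ), x 0 + x 1 ∈ Set.Icc a b → c ∈ Set.Icc a b →
      (0 ≤ c ∧ c ≤ 1) ∧ 0 < x 0 + x 1 ∧ x 0 + x 1 < 1 := fun x c hx hc =>
    ⟨⟨by linarith [hc.1], by linarith [hc.2]⟩, by linarith [hx.1], by linarith [hx.2]⟩
  refine ⟨hab, by fun_prop, ?_, fun x c hx hc => Tetra.join_height (cond x c hx hc), ?_, ?_, ?_⟩
  · have cc : ∀ m, Continuous fun p : Tetra × ℝ => p.1 m := fun m =>
      (Tetra.continuous_coord m).comp continuous_fst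
    have c0 := cc 0
    have c1 := cc 1
    have c2 := cc 2
    have c3 := cc 3
    have d1 : ContinuousOn (fun p : Tetra × ℝ => p.2 / (p.1 0 + p.1 1))
        {p | p.1 0 + p.1 1 ∈ Set.Icc a b ∧ p.2 ∈ Set.Icc a b} :=
      ContinuousOn.div (by fun_prop) (by fun_prop) fun p hp => by
        have := (cond _ _ hp.1 hp.2).2.1; exact this.ne'
    have d2 : ContinuousOn (fun p : Tetra × ℝ => (1 - p.2) / (1 - (p.1 0 + p.1 1)))
        {p | p.1 0 + p.1 1 ∈ Set.Icc a b ∧ p.2 ∈ Set.Icc a b} :=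
      ContinuousOn.div (by fun_prop) (by fun_prop) fun p hp => by
        have := (cond _ _ hp.1 hp.2).2.2; exact (sub_pos.2 this).ne'
    refine continuousOn_tetra fun m => ?_
    refine ContinuousOn.congr ?_ fun p hp => Tetra.join_coord (cond _ _ hp.1 hp.2) m
    fin_cases m
    exacts [c0.continuousOn.mul d1, c1.continuousOn.mul d1, c2.continuousOn.mul d2,
      c3.continuousOn.mul d2]
  · intro x hx
    have h := cond x _ hx hx
    have h1 : (x 0 + x 1) / (x 0 + x 1) = 1 := div_self h.2.1.ne'
    have h2 : (1 - (x 0 + x 1)) / (1 - (x 0 + x 1)) = 1 := div_self (sub_pos.2 h.2.2).ne'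
    ext m
    rw [Tetra.join_coord h, h1, h2]
    fin_cases m <;> simp
  · intro x c d hx hc hd
    have h1 := cond x c hx hc
    have h2 := cond x d hx hd
    have hu := Tetra.join_height h1
    have h3 := cond (Tetra.join x c) d (by rwa [hu]) hd
    have e1 : c / (x 0 + x 1) * (d / c) = d / (x 0 + x 1) := by
      rw [mul_comm, div_mul_div_cancel₀ (by linarith [hc.1])]
    have e2 : (1 - c) / (1 - (x 0 + x 1)) * ((1 - d) / (1 - c)) = (1 - d) / (1 - (x 0 + x 1)) := by
      rw [mul_comm, div_mul_div_cancel₀ (by linarith [hc.2])]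
    ext m
    rw [Tetra.join_coord h3, Tetra.join_coord h2, hu]
    simp only [Tetra.join_coord h1, Matrix.cons_val, mul_assoc, e1, e2]
  · intro x c m hx hc
    have h1 := cond x c hx hc
    have p1 : c / (x 0 + x 1) ≠ 0 := (div_pos (ha.trans_le hc.1) h1.2.1).ne'
    have p2 : (1 - c) / (1 - (x 0 + x 1)) ≠ 0 :=
      (div_pos (by linarith [hc.2]) (by linarith [h1.2.2])).ne'
    rw [Tetra.join_coord h1]
    fin_cases m <;> simp [p1, p2, -div_eq_zero_iff]

/-- A stack of surfaces close to the model quadrilaterals separating `01` from `23`. -/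
theorem exchangesIn_quad {r : ℝ} (hr : 0 ≤ r) (hr1 : r < 1) {N : ℕ}
    (hrN : r / 2 < 1 / ((N : ℝ) + 1) / 3) {A B : Set Tetra}
    (hA : ∀ x : Tetra, x 0 + x 1 ∈ Set.Ioo (1 / 3 : ℝ) (2 / 3) →
      (x ∈ A ↔ ∃ n < N, x 0 + x 1 + r * min (x 2) (x 3) = quadLevel N n))
    (hB : ∀ x : Tetra, x 0 + x 1 ∈ Set.Ioo (1 / 3 : ℝ) (2 / 3) →
      (x ∈ B ↔ ∃ n < N, x 0 + x 1 = quadLevel N n)) :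
    ExchangesIn {x | x 0 + x 1 ∈ Set.Ioo (1 / 3 : ℝ) (2 / 3)} A B := by
  have hs := isSlide_join (a := 1 / 3) (b := 2 / 3) (by norm_num) (by norm_num) (by norm_num)
  have min0 : ∀ x : Tetra, 0 ≤ min (x 2) (x 3) := fun x => le_min (x.nonneg 2) (x.nonneg 3)
  have min1 : ∀ x : Tetra, min (x 2) (x 3) ≤ (1 - (x 0 + x 1)) / 2 := fun x => by
    linarith [x.sum_four, min_le_left (x 2) (x 3), min_le_right (x 2) (x 3)]
  have ex := hs.exists_straighten N
    (fun n x => x 0 + x 1 + r * min (x 2) (x 3) - quadLevel N n)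
    (fun n _ => by fun_prop) ?_
    (fun n hn x _ hx => by have := quadLevel_lt_succ N n; linarith)
    (fun n hn x hx => by
      have := (quadLevel_bounds hn).1
      have := mul_le_mul_of_nonneg_left (min1 x) hr
      rw [hx] at this ⊢
      linarith)
    (fun n hn x hx => by
      have := (quadLevel_bounds hn).2
      have := mul_nonneg hr (min0 x)
      rw [hx]
      linarith)
  · obtain ⟨θ, h1, h2, h3, h4⟩ := ex
    refine ⟨θ, h1, h2, fun x hx => ⟨h3 x hx, ?_⟩⟩
    rw [hA x hx, hB _ (h3 x hx)]
    refine exists_congr fun n => and_congr_right fun hn => ?_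
    rw [← sub_eq_zero, h4 x hx n hn]
    -- Equidistant levels between 1/3 and 2/3 are exactly the model levels, so no second
    -- straightening is needed here.
    have : (1 : ℝ) / 3 + (2 / 3 - 1 / 3) * (((n : ℝ) + 1) / ((N : ℝ) + 1)) = quadLevel N n := by
      unfold quadLevel; ring
    rw [this]
  · intro n hn x hx c hc d hd hcd
    have cond : ∀ c ∈ Set.Icc (1 / 3 : ℝ) (2 / 3),
        (0 ≤ c ∧ c ≤ 1) ∧ 0 < x 0 + x 1 ∧ x 0 + x 1 < 1 := fun c hc =>
      ⟨⟨by linarith [hc.1], by linarith [hc.2]⟩, by linarith [hx.1], by linarith [hx.2]⟩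
    -- Along a line the function is affine in the height, with slope `1 - r k` where `k ≤ 1`; this
    -- is positive because `r < 1`.
    have key : ∀ c ∈ Set.Icc (1 / 3 : ℝ) (2 / 3),
        Tetra.join x c 0 + Tetra.join x c 1 + r * min (Tetra.join x c 2) (Tetra.join x c 3) =
          c + r * (min (x 2) (x 3) / (1 - (x 0 + x 1))) * (1 - c) := by
      intro c hc
      have h := cond c hc
      rw [Tetra.join_height h, Tetra.join_coord h, Tetra.join_coord h]
      simp only [Matrix.cons_val]
      rw [← min_mul_of_nonneg _ _ (div_nonneg (by linarith [h.1.2]) (by linarith [h.2.2]))]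
      ring
    have hk : r * (min (x 2) (x 3) / (1 - (x 0 + x 1))) < 1 := by
      have h3 : min (x 2) (x 3) / (1 - (x 0 + x 1)) ≤ 1 := by
        rw [div_le_one (by linarith [hx.2])]
        linarith [min1 x, hx.2]
      have h4 : 0 ≤ min (x 2) (x 3) / (1 - (x 0 + x 1)) :=
        div_nonneg (min0 x) (by linarith [hx.2])
      nlinarith
    simp only [key c hc, key d hd]
    nlinarith

/-! ### Pillows -/

/-- The maps of a tetrahedron (number `0`) and the two tetrahedra of a pillow (numbers `1` and `2`)
onto the pieces of a subdivided tetrahedron. The faces `f, f'` of number `0` are glued to those of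
number `1`, and the faces `e, e'` of number `1` to those of number `2`; the other faces form the
boundary, where the maps are the identity. -/
structure PillowMap (f f' e e' : Fin 4) (K : Fin 3 → Tetra → Tetra) : Prop where
  continuous : ∀ g, Continuous (K g)
  glue₁ : ∀ x : Tetra, x f = 0 ∨ x f' = 0 → K 0 x = K 1 x
  glue₂ : ∀ x : Tetra, x e = 0 ∨ x e' = 0 → K 1 x = K 2 x
  bdry₀ : ∀ x : Tetra, x e = 0 ∨ x e' = 0 → K 0 x = x
  bdry₂ : ∀ x : Tetra, x f = 0 ∨ x f' = 0 → K 2 x = x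
  surjective : ∀ y, ∃ g x, K g x = y
  injective : ∀ g, Function.Injective (K g)
  eq₀₁ : ∀ x y : Tetra, K 0 x = K 1 y → x = y ∧ (x f = 0 ∨ x f' = 0)
  eq₁₂ : ∀ x y : Tetra, K 1 x = K 2 y → x = y ∧ (x e = 0 ∨ x e' = 0)
  eq₀₂ : ∀ x y : Tetra, K 0 x = K 2 y → x = y ∧ (x f = 0 ∨ x f' = 0) ∧ (x e = 0 ∨ x e' = 0)

/-- Conjugation by a homeomorphism that permutes the faces by `π`. -/
theorem PillowMap.conj {f f' e e' : Fin 4} {K : Fin 3 → Tetra → Tetra} (h : PillowMap f f' e e' K)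
    (E : Tetra ≃ₜ Tetra) (π : Fin 4 → Fin 4) (hE : ∀ x i, E x (π i) = 0 ↔ x i = 0) :
    PillowMap (π f) (π f') (π e) (π e') fun g => E ∘ K g ∘ E.symm := by
  have hE' : ∀ x i, x (π i) = 0 ↔ E.symm x i = 0 := fun x i => by
    have := hE (E.symm x) i
    rwa [Homeomorph.apply_symm_apply] at this
  have key : ∀ {x y : Tetra}, E.symm x = E.symm y → x = y := fun h => E.symm.injective h
  refine ⟨fun g => E.continuous.comp ((h.continuous g).comp E.symm.continuous), ?_, ?_, ?_, ?_, ?_,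
    fun g => E.injective.comp ((h.injective g).comp E.symm.injective), ?_, ?_, ?_⟩
  all_goals simp only [hE', Function.comp_apply]
  · exact fun x hx => by rw [h.glue₁ _ hx]
  · exact fun x hx => by rw [h.glue₂ _ hx]
  · exact fun x hx => by rw [h.bdry₀ _ hx, Homeomorph.apply_symm_apply]
  · exact fun x hx => by rw [h.bdry₂ _ hx, Homeomorph.apply_symm_apply]
  · intro y
    obtain ⟨g, x, hx⟩ := h.surjective (E.symm y)
    exact ⟨g, E x, by simp [hx]⟩
  · exact fun x y hxy => (h.eq₀₁ _ _ (E.injective hxy)).imp_left key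
  · exact fun x y hxy => (h.eq₁₂ _ _ (E.injective hxy)).imp_left key
  · exact fun x y hxy => (h.eq₀₂ _ _ (E.injective hxy)).imp_left key

/-- The translation of `x` by `t` in the direction from edge `23` to edge `01`. -/
def Tetra.push (x : Tetra) (t : ℝ) (h : -min (x 0) (x 1) ≤ t ∧ t ≤ min (x 2) (x 3)) : Tetra :=
  ⟨![x 0 + t, x 1 + t, x 2 - t, x 3 - t], by
    have h0 := min_le_left (x 0) (x 1)
    have h1 := min_le_right (x 0) (x 1)
    have h2 := min_le_left (x 2) (x 3)
    have h3 := min_le_right (x 2) (x 3)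
    constructor
    · intro m
      fin_cases m
      · show 0 ≤ x 0 + t
        linarith
      · show 0 ≤ x 1 + t
        linarith
      · show 0 ≤ x 2 - t
        linarith
      · show 0 ≤ x 3 - t
        linarith
    · rw [Fin.sum_univ_four]
      simp only [Matrix.cons_val]
      linarith [x.sum_four]⟩

theorem pillowShift_bounds (ζ ξ : unitInterval) (x : Tetra) :
    -min (x 0) (x 1) ≤ ζ * min (x 2) (x 3) - ξ * min (x 0) (x 1) ∧
      ζ * min (x 2) (x 3) - ξ * min (x 0) (x 1) ≤ min (x 2) (x 3) := by
  have h1 : 0 ≤ min (x 0) (x 1) := le_min (x.nonneg 0) (x.nonneg 1)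
  have h2 : 0 ≤ min (x 2) (x 3) := le_min (x.nonneg 2) (x.nonneg 3)
  constructor
  · nlinarith [mul_nonneg ζ.2.1 h2, mul_nonneg (sub_nonneg.2 ξ.2.2) h1]
  · nlinarith [mul_nonneg ξ.2.1 h1, mul_nonneg (sub_nonneg.2 ζ.2.2) h2]

/-- The embeddings of the tetrahedra of a standard pillow. -/
noncomputable def pillowShift (ζ ξ : unitInterval) (x : Tetra) : Tetra :=
  x.push (ζ * min (x 2) (x 3) - ξ * min (x 0) (x 1)) (pillowShift_bounds ζ ξ x)

section pillowShift

variable (ζ ξ : unitInterval) (x : Tetra)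

theorem pillowShift_zero :
    pillowShift ζ ξ x 0 = x 0 + (ζ * min (x 2) (x 3) - ξ * min (x 0) (x 1)) := rfl

theorem pillowShift_one :
    pillowShift ζ ξ x 1 = x 1 + (ζ * min (x 2) (x 3) - ξ * min (x 0) (x 1)) := rfl

theorem pillowShift_two :
    pillowShift ζ ξ x 2 = x 2 - (ζ * min (x 2) (x 3) - ξ * min (x 0) (x 1)) := rfl

theorem pillowShift_three :
    pillowShift ζ ξ x 3 = x 3 - (ζ * min (x 2) (x 3) - ξ * min (x 0) (x 1)) := rfl

theorem continuous_pillowShift : Continuous (pillowShift ζ ξ) := by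
  refine continuous_tetra fun m => ?_
  fin_cases m
  · show Continuous fun x => pillowShift ζ ξ x 0
    simp only [pillowShift_zero]; fun_prop
  · show Continuous fun x => pillowShift ζ ξ x 1
    simp only [pillowShift_one]; fun_prop
  · show Continuous fun x => pillowShift ζ ξ x 2
    simp only [pillowShift_two]; fun_prop
  · show Continuous fun x => pillowShift ζ ξ x 3
    simp only [pillowShift_three]; fun_prop

theorem pillowShift_min_left : min (pillowShift ζ ξ x 0) (pillowShift ζ ξ x 1) =
    min (x 0) (x 1) + (ζ * min (x 2) (x 3) - ξ * min (x 0) (x 1)) := by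
  rw [pillowShift_zero, pillowShift_one, min_add_add_right]

theorem pillowShift_min_right : min (pillowShift ζ ξ x 2) (pillowShift ζ ξ x 3) =
    min (x 2) (x 3) - (ζ * min (x 2) (x 3) - ξ * min (x 0) (x 1)) := by
  rw [pillowShift_two, pillowShift_three, min_sub_sub_right]

variable {ζ ξ x}

theorem pillowShift_congr {ζ' ξ' : unitInterval}
    (h : (ζ * min (x 2) (x 3) - ξ * min (x 0) (x 1) : ℝ) =
      ζ' * min (x 2) (x 3) - ξ' * min (x 0) (x 1)) : pillowShift ζ ξ x = pillowShift ζ' ξ' x := by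
  simp only [pillowShift, h]

theorem pillowShift_eq_self (h : (ζ * min (x 2) (x 3) - ξ * min (x 0) (x 1) : ℝ) = 0) :
    pillowShift ζ ξ x = x := by
  ext m
  fin_cases m
  · show pillowShift ζ ξ x 0 = x 0
    rw [pillowShift_zero, h, add_zero]
  · show pillowShift ζ ξ x 1 = x 1
    rw [pillowShift_one, h, add_zero]
  · show pillowShift ζ ξ x 2 = x 2
    rw [pillowShift_two, h, sub_zero]
  · show pillowShift ζ ξ x 3 = x 3
    rw [pillowShift_three, h, sub_zero]

/-- The shift amount is the difference between the new and the old value of `min (x 0) (x 1)`, so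
equal images and equal old minima give equal shifts. -/
theorem eq_of_pillowShift_eq {ζ' ξ' : unitInterval} {y : Tetra}
    (h : pillowShift ζ ξ x = pillowShift ζ' ξ' y) (h' : min (x 0) (x 1) = min (y 0) (y 1)) :
    x = y := by
  have hm := pillowShift_min_left ζ ξ x
  rw [h, pillowShift_min_left, h'] at hm
  have e0 := pillowShift_zero ζ ξ x
  have e1 := pillowShift_one ζ ξ x
  have e2 := pillowShift_two ζ ξ x
  have e3 := pillowShift_three ζ ξ x
  rw [h, h'] at e0 e1 e2 e3
  rw [pillowShift_zero] at e0
  rw [pillowShift_one] at e1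
  rw [pillowShift_two] at e2
  rw [pillowShift_three] at e3
  ext m
  fin_cases m
  · show x 0 = y 0
    linarith
  · show x 1 = y 1
    linarith
  · show x 2 = y 2
    linarith
  · show x 3 = y 3
    linarith

/-- The sum of the two minima is invariant under the shift, so a preimage is determined by its value
`μ` of `min (x 0) (x 1)`, which has to solve a linear equation. -/
theorem exists_pillowShift_eq (y : Tetra) (μ : ℝ) (hμ : 0 ≤ μ)
    (hm : μ ≤ min (y 0) (y 1) + min (y 2) (y 3))
    (h : min (y 0) (y 1) = μ + (ζ * (min (y 0) (y 1) + min (y 2) (y 3) - μ) - ξ * μ)) :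
    ∃ x, pillowShift ζ ξ x = y := by
  let t := μ - min (y 0) (y 1)
  have ht : -min (y 0) (y 1) ≤ t ∧ t ≤ min (y 2) (y 3) := ⟨by simp [t, hμ], by simp only [t]; linarith⟩
  let x := y.push t ht
  have x0 : x 0 = y 0 + t := rfl
  have x1 : x 1 = y 1 + t := rfl
  have x2 : x 2 = y 2 - t := rfl
  have x3 : x 3 = y 3 - t := rfl
  have m1 : min (x 0) (x 1) = μ := by
    rw [x0, x1, min_add_add_right]; simp only [t]; ring
  have m2 : min (x 2) (x 3) = min (y 0) (y 1) + min (y 2) (y 3) - μ := by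
    rw [x2, x3, min_sub_sub_right]; simp only [t]; ring
  have d : (ζ * min (x 2) (x 3) - ξ * min (x 0) (x 1) : ℝ) = -t := by
    rw [m1, m2]; simp only [t]; linarith
  refine ⟨x, ?_⟩
  ext m
  fin_cases m
  · show pillowShift ζ ξ x 0 = y 0
    rw [pillowShift_zero, d, x0]; ring
  · show pillowShift ζ ξ x 1 = y 1
    rw [pillowShift_one, d, x1]; ring
  · show pillowShift ζ ξ x 2 = y 2
    rw [pillowShift_two, d, x2]; ring
  · show pillowShift ζ ξ x 3 = y 3
    rw [pillowShift_three, d, x3]; ring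

end pillowShift

theorem Tetra.min_eq_zero_iff (x : Tetra) (i j : Fin 4) :
    min (x i) (x j) = 0 ↔ x i = 0 ∨ x j = 0 := by
  have hi := x.nonneg i
  have hj := x.nonneg j
  constructor
  · intro h
    rcases min_choice (x i) (x j) with h' | h'
    · exact Or.inl (h'.symm.trans h)
    · exact Or.inr (h'.symm.trans h)
  · rintro (h | h)
    · rw [h, min_eq_left hj]
    · rw [h, min_eq_right hi]

/-- The standard pillow. -/
noncomputable def pillow (ζ ξ : unitInterval) : Fin 3 → Tetra → Tetra :=
  ![pillowShift ζ 0, pillowShift ζ ξ, pillowShift 0 ξ]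

/-- Write `a = min (x 0) (x 1)`, `b = min (x 2) (x 3)` and `s = a + b`. The three maps preserve `s`
and the differences `x 0 - x 1`, `x 2 - x 3`, and send `a` to `2εs + (1 - 2ε)a`, `2εs - εa` and
`εa`. They thus fill the layers from `2εs` to `s`, from `εs` to `2εs` and from 0 to `εs`. Adjacent
layers meet where `a = 0` and where `b = 0`, that is, in the glued faces. -/
theorem pillowMap_pillow {ε : ℝ} (hε : 0 < ε) (hε1 : 2 * ε < 1) {ζ ξ : unitInterval}
    (hζ : (ζ : ℝ) = 2 * ε) (hξ : (ξ : ℝ) = 1 - ε) : PillowMap 0 1 2 3 (pillow ζ ξ) := by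
  have nn : ∀ x : Tetra, 0 ≤ min (x 0) (x 1) ∧ 0 ≤ min (x 2) (x 3) := fun x =>
    ⟨le_min (x.nonneg 0) (x.nonneg 1), le_min (x.nonneg 2) (x.nonneg 3)⟩
  -- Equal images have equal sums `s` and equal new values of `a`.
  have inv : ∀ (ζ₁ ξ₁ ζ₂ ξ₂ : unitInterval) (x y : Tetra),
      pillowShift ζ₁ ξ₁ x = pillowShift ζ₂ ξ₂ y →
      min (x 0) (x 1) + min (x 2) (x 3) = min (y 0) (y 1) + min (y 2) (y 3) ∧
      min (x 0) (x 1) + (ζ₁ * min (x 2) (x 3) - ξ₁ * min (x 0) (x 1)) =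
      min (y 0) (y 1) + (ζ₂ * min (y 2) (y 3) - ξ₂ * min (y 0) (y 1)) := by
    intro ζ₁ ξ₁ ζ₂ ξ₂ x y h
    have a := pillowShift_min_left ζ₁ ξ₁ x
    have b := pillowShift_min_right ζ₁ ξ₁ x
    rw [h, pillowShift_min_left] at a
    rw [h, pillowShift_min_right] at b
    constructor <;> linarith
  have z0 : ((0 : unitInterval) : ℝ) = 0 := rfl
  refine ⟨?_, ?_, ?_, ?_, ?_, ?_, ?_, ?_, ?_, ?_⟩
  · intro g
    fin_cases g
    exacts [continuous_pillowShift _ _, continuous_pillowShift _ _, continuous_pillowShift _ _]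
  · intro x hx
    refine pillowShift_congr ?_
    rw [(x.min_eq_zero_iff 0 1).2 hx]; ring
  · intro x hx
    refine pillowShift_congr ?_
    rw [(x.min_eq_zero_iff 2 3).2 hx]; ring
  · intro x hx
    refine pillowShift_eq_self ?_
    rw [(x.min_eq_zero_iff 2 3).2 hx, z0]; ring
  · intro x hx
    refine pillowShift_eq_self ?_
    rw [(x.min_eq_zero_iff 0 1).2 hx, z0]; ring
  · intro y
    obtain ⟨a0, b0⟩ := nn y
    set a := min (y 0) (y 1) with ha
    set b := min (y 2) (y 3) with hb
    -- The layer containing `y` decides which map hits it; the witness inverts the corresponding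
    -- affine function of `a`.
    rcases le_total (2 * ε * (a + b)) a with h | h
    · obtain ⟨x, hx⟩ := exists_pillowShift_eq (ζ := ζ) (ξ := 0) y
        ((a - 2 * ε * (a + b)) / (1 - 2 * ε)) (div_nonneg (by linarith) (by linarith))
        (by rw [div_le_iff₀ (by linarith)]; nlinarith)
        (by
          have : 1 - 2 * ε ≠ 0 := by linarith
          rw [← ha, ← hb, z0, hζ]
          field_simp
          ring)
      exact ⟨0, x, hx⟩
    · rcases le_total (ε * (a + b)) a with h1 | h1
      · obtain ⟨x, hx⟩ := exists_pillowShift_eq (ζ := ζ) (ξ := ξ) y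
          (2 * (a + b) - a / ε) (by rw [sub_nonneg, div_le_iff₀ hε]; linarith)
          (by
            have : a + b ≤ a / ε := by rw [le_div_iff₀ hε]; linarith
            rw [← ha, ← hb]
            linarith)
          (by
            rw [← ha, ← hb, hζ, hξ]
            field_simp
            ring)
        exact ⟨1, x, hx⟩
      · obtain ⟨x, hx⟩ := exists_pillowShift_eq (ζ := 0) (ξ := ξ) y
          (a / ε) (div_nonneg a0 hε.le)
          (by rw [div_le_iff₀ hε]; linarith)
          (by
            rw [← ha, ← hb, z0, hξ]
            field_simp
            ring)
        exact ⟨2, x, hx⟩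
  · intro g x y h
    fin_cases g
    · have := inv ζ 0 ζ 0 x y h
      rw [z0, hζ] at this
      exact eq_of_pillowShift_eq h (by nlinarith)
    · have := inv ζ ξ ζ ξ x y h
      rw [hζ, hξ] at this
      exact eq_of_pillowShift_eq h (by nlinarith)
    · have := inv 0 ξ 0 ξ x y h
      rw [z0, hξ] at this
      exact eq_of_pillowShift_eq h (by nlinarith)
  -- The first map has image values at least `2εs` and the second at most `2εs`, in both cases with
  -- equality only for `a = 0`.
  · intro x y h
    have := inv ζ 0 ζ ξ x y h
    rw [z0, hζ, hξ] at this
    obtain ⟨x0, x2⟩ := nn x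
    obtain ⟨y0, y2⟩ := nn y
    have e1 : min (x 0) (x 1) = 0 := by nlinarith
    have e2 : min (y 0) (y 1) = 0 := by nlinarith
    exact ⟨eq_of_pillowShift_eq h (e1.trans e2.symm), (x.min_eq_zero_iff 0 1).1 e1⟩
  · intro x y h
    have := inv ζ ξ 0 ξ x y h
    rw [z0, hζ, hξ] at this
    obtain ⟨x0, x2⟩ := nn x
    obtain ⟨y0, y2⟩ := nn y
    have e1 : min (x 2) (x 3) = 0 := by nlinarith
    have e2 : min (x 0) (x 1) = min (y 0) (y 1) := by nlinarith
    exact ⟨eq_of_pillowShift_eq h e2, (x.min_eq_zero_iff 2 3).1 e1⟩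
  -- The common value is at least `2εs` and at most `εs`, so `s = 0` and both minima vanish.
  · intro x y h
    have := inv ζ 0 0 ξ x y h
    rw [z0, hζ, hξ] at this
    obtain ⟨x0, x2⟩ := nn x
    obtain ⟨y0, y2⟩ := nn y
    have e0 : min (x 0) (x 1) = 0 := by nlinarith
    have e1 : min (x 2) (x 3) = 0 := by nlinarith
    have e2 : min (x 0) (x 1) = min (y 0) (y 1) := by nlinarith
    exact ⟨eq_of_pillowShift_eq h e2, (x.min_eq_zero_iff 0 1).1 e0, (x.min_eq_zero_iff 2 3).1 e1⟩

/-! ### Normal surfaces in pillows -/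

namespace TetCoords

theorem mem_model_iff_onTri {v : TetCoords} {i : Fin 4} {y : Tetra}
    (h : ∀ j, j ≠ i → ¬ v.OnTri j y) (h' : ∀ k, ¬ v.OnQuad k y) : y ∈ v.model ↔ v.OnTri i y := by
  rw [mem_model]
  constructor
  · rintro (⟨j, hj⟩ | ⟨k, hk⟩)
    · by_cases e : j = i
      · rwa [← e]
      · exact absurd hj (h j e)
    · exact absurd hk (h' k)
  · exact fun hi => Or.inl ⟨i, hi⟩

theorem mem_model_iff_onQuad {v : TetCoords} {y : Tetra} (h : ∀ j, ¬ v.OnTri j y) :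
    y ∈ v.model ↔ ∃ k, v.OnQuad k y := by
  rw [mem_model, or_iff_right]
  exact fun ⟨j, hj⟩ => h j hj

theorem not_onTri {v : TetCoords} {j : Fin 4} {y : Tetra} (h : y j ≤ 2 / 3) : ¬ v.OnTri j y :=
  fun hj => absurd hj.lt (not_lt.2 h)

theorem not_onQuad {v : TetCoords} {k : Fin 3} {y : Tetra}
    (h : y 0 + y k.succ ≤ 1 / 3 ∨ 2 / 3 ≤ y 0 + y k.succ) : ¬ v.OnQuad k y := fun hk => by
  have h1 := hk.lt
  have h2 := hk.bounds.2
  rcases h with h | h <;> linarith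

/-- Less than 1/3 remains for the other coordinates, so no other triangle is possible and `x 0 + x
k.succ` lies outside the interval of quadrilateral levels. -/
theorem mem_model_iff_of_gt (v : TetCoords) {i : Fin 4} {x : Tetra} (h : 2 / 3 < x i) :
    x ∈ v.model ↔ v.OnTri i x := by
  have e := x.sum_four
  have h0 := x.nonneg 0
  have h1 := x.nonneg 1
  have h2 := x.nonneg 2
  have h3 := x.nonneg 3
  refine mem_model_iff_onTri (fun j hj => not_onTri ?_) fun k => not_onQuad ?_
  · fin_cases i <;> fin_cases j <;> first | exact absurd rfl hj | (simp at h ⊢; linarith)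
  · fin_cases i <;> fin_cases k <;> simp at h ⊢ <;>
      first | (right; linarith) | (left; linarith)

end TetCoords

theorem ExchangesIn.empty (A B : Set Tetra) : ExchangesIn ∅ A B :=
  ⟨Homeomorph.refl _, FacePreserving.refl, fun _ _ => rfl, fun _ hx => hx.elim⟩

/-- The vertex other than `i` on the edge `01` or `23`, then the two other vertices. -/
def mate : Fin 4 → Fin 4 := ![1, 0, 3, 2]
/-- A vertex of the edge `01` or `23` that does not contain `i`. -/
def opp : Fin 4 → Fin 4 := ![2, 2, 0, 0]
/-- The other vertex of the edge `01` or `23` that does not contain `i`. -/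
def opp' : Fin 4 → Fin 4 := ![3, 3, 1, 1]

theorem labelling_mate : ∀ i, Labelling i (mate i) (opp i) (opp' i) := by decide

/-- The first tetrahedron of a pillow. -/
theorem normallyIsotopic_pillow_zero {w : TetCoords} (hw : w.Admissible) {ε : ℝ} (hε : 0 < ε)
    (hε1 : 12 * ε ≤ 1) (hεw : ∀ j, 12 * ε ≤ 1 / ((w j : ℝ) + 1)) {ζ : unitInterval}
    (hζ : (ζ : ℝ) = 2 * ε) :
    NormallyIsotopic (pillowShift ζ 0 ⁻¹' w.model) w.model := by
  have z0 : ((0 : unitInterval) : ℝ) = 0 := rfl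
  have hεt : ∀ i, 12 * ε ≤ 1 / ((w.tri i : ℝ) + 1) := fun i => hεw _
  have hεq : ∀ i, 12 * ε ≤ 1 / ((w.quad i : ℝ) + 1) := fun i => hεw _
  -- All coordinates change by `2d ≤ ε`, and `x 0 + x 1` by at most `2ε`, whereas the lowest disc of
  -- any type lies at least `4ε` above 1/3 or 2/3.
  have coords : ∀ x : Tetra, ∃ d, d = ε * min (x 2) (x 3) ∧ 0 ≤ d ∧ 12 * d ≤ min (x 2) (x 3) ∧
      d ≤ ε / 2 ∧ min (x 2) (x 3) ≤ x 2 ∧ min (x 2) (x 3) ≤ x 3 ∧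
      pillowShift ζ 0 x 0 = x 0 + 2 * d ∧ pillowShift ζ 0 x 1 = x 1 + 2 * d ∧
      pillowShift ζ 0 x 2 = x 2 - 2 * d ∧ pillowShift ζ 0 x 3 = x 3 - 2 * d := by
    intro x
    have m0 : 0 ≤ min (x 2) (x 3) := le_min (x.nonneg 2) (x.nonneg 3)
    have m1 := min_le_left (x 2) (x 3)
    have m2 := min_le_right (x 2) (x 3)
    have e := x.sum_four
    refine ⟨_, rfl, mul_nonneg hε.le m0, by nlinarith, ?_, m1, m2, ?_, ?_, ?_, ?_⟩
    · have : min (x 2) (x 3) ≤ 1 / 2 := by linarith [x.nonneg 0, x.nonneg 1]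
      nlinarith
    · rw [pillowShift_zero, hζ, z0]; ring
    · rw [pillowShift_one, hζ, z0]; ring
    · rw [pillowShift_two, hζ, z0]; ring
    · rw [pillowShift_three, hζ, z0]; ring
  -- The index `none` stands for the quadrilaterals 01/23. With both parameters zero, `coneHeight`
  -- is just `x i`.
  let U : Option (Fin 4) → Set Tetra := fun o => o.elim
    {x | w.quad 0 ≠ 0 ∧ x 0 + x 1 ∈ Set.Ioo (1 / 3 : ℝ) (2 / 3)}
    fun i => {x | 2 / 3 < coneHeight i (mate i) (opp i) (opp' i) 0 0 x}
  have memU : ∀ i x, x ∈ U (some i) ↔ 2 / 3 < x i := fun i x => by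
    simp [U, coneHeight]
  refine NormallyIsotopic.of_exchanges Finset.univ U _ _ ?_ ?_ ?_
  · intro i _ j _ hij x hi hj
    have e := x.sum_four
    have h0 := x.nonneg 0
    have h1 := x.nonneg 1
    have h2 := x.nonneg 2
    have h3 := x.nonneg 3
    rcases i with _ | i <;> rcases j with _ | j
    · exact hij rfl
    · rw [memU] at hj
      obtain ⟨-, hi1, hi2⟩ := hi
      fin_cases j <;> simp at hj <;> linarith
    · rw [memU] at hi
      obtain ⟨-, hj1, hj2⟩ := hj
      fin_cases i <;> simp at hi <;> linarith
    · rw [memU] at hi hj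
      fin_cases i <;> fin_cases j <;> first | exact absurd rfl hij | (simp at hi hj; linarith)
  · intro o _
    rcases o with _ | i
    · by_cases hq : w.quad 0 = 0
      · have : U none = ∅ := by
          ext x; simp [U, hq]
        rw [this]; exact ExchangesIn.empty _ _
      · have hU : U none = {x | x 0 + x 1 ∈ Set.Ioo (1 / 3 : ℝ) (2 / 3)} := by
          ext x; simp [U, hq]
        rw [hU]
        have hk : ∀ k, k ≠ 0 → w.quad k = 0 := fun k hk => by
          by_contra h; exact hk (hw k 0 h hq)
        have red : ∀ y : Tetra, (∀ j, ¬ w.OnTri j y) → (y ∈ w.model ↔ w.OnQuad 0 y) := by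
          intro y hy
          rw [TetCoords.mem_model_iff_onQuad hy]
          constructor
          · rintro ⟨k, h⟩
            by_cases e : k = 0
            · rwa [← e]
            · exact absurd (hk k e) h.ne_zero
          · exact fun h => ⟨0, h⟩
        refine exchangesIn_quad (r := 4 * ε) (N := w.quad 0) (by linarith) (by linarith) ?_ ?_ ?_
        · have := hεq 0
          linarith
        · intro x hx
          obtain ⟨d, hd, d0, d1, d2, m2, m3, y0, y1, y2, y3⟩ := coords x
          rw [Set.mem_preimage, red]
          · refine exists_congr fun n => and_congr_right fun _ => ?_
            rw [show (0 : Fin 3).succ = 1 from rfl, y0, y1, mul_assoc, ← hd,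
              show x 0 + 2 * d + (x 1 + 2 * d) = x 0 + x 1 + 4 * d by ring]
          · intro j hj
            have hb := hj.bounds
            have := hεt j
            have e := x.sum_four
            have h0 := x.nonneg 0
            have h1 := x.nonneg 1
            have h2 := x.nonneg 2
            have h3 := x.nonneg 3
            obtain ⟨hx1, hx2⟩ := hx
            fin_cases j <;> simp only [Fin.mk_one, Fin.zero_eta, Fin.reduceFinMk] at hb this <;>
              linarith
        · intro x hx
          refine red x fun j hj => ?_
          have hb := hj.lt
          have e := x.sum_four
          have h0 := x.nonneg 0
          have h1 := x.nonneg 1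
          have h2 := x.nonneg 2
          have h3 := x.nonneg 3
          obtain ⟨hx1, hx2⟩ := hx
          fin_cases j <;> simp at hb <;> linarith
    -- Near vertices 0 and 1 the shift stays `2ε min (x 2) (x 3)`. Near 2 or 3 that minimum is the
    -- coordinate of the mate, so the shift becomes the linear term.
    · obtain ⟨p, r, hp, hr, hpr⟩ : ∃ p r : ℝ, (-1 < p ∧ p ≤ 1) ∧ (0 ≤ r ∧ r ≤ 2 * ε) ∧
          ∀ x : Tetra, 2 / 3 ≤ x i → pillowShift ζ 0 x i =
            coneFun i (mate i) (opp i) (opp' i) p r x := by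
        by_cases hi : i = 0 ∨ i = 1
        · refine ⟨0, 2 * ε, by norm_num, ⟨by linarith, le_rfl⟩, fun x _ => ?_⟩
          obtain ⟨d, hd, -, -, -, -, -, y0, y1, -, -⟩ := coords x
          rcases hi with rfl | rfl
          · rw [y0, hd]; simp only [coneFun, opp, opp', Matrix.cons_val]; ring
          · rw [y1, hd]; simp only [coneFun, opp, opp', Matrix.cons_val]; ring
        · refine ⟨2 * ε, 0, ⟨by linarith, by linarith⟩, ⟨le_rfl, by linarith⟩, fun x hx => ?_⟩
          obtain ⟨d, hd, -, -, -, -, -, -, -, y2, y3⟩ := coords x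
          have e := x.sum_four
          have h0 := x.nonneg 0
          have h1 := x.nonneg 1
          have h2 := x.nonneg 2
          have h3 := x.nonneg 3
          have hi' := (by decide : ∀ i : Fin 4, ¬ (i = 0 ∨ i = 1) → i = 2 ∨ i = 3) i hi
          rcases hi' with rfl | rfl
          · rw [y2, hd, min_eq_right (by linarith)]; simp only [coneFun, mate, Matrix.cons_val]; ring
          · rw [y3, hd, min_eq_left (by linarith)]; simp only [coneFun, mate, Matrix.cons_val]; ring
      have hc : ∀ x : Tetra, coneHeight i (mate i) (opp i) (opp' i) 0 0 x = x i := fun x => by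
        simp [coneHeight]
      refine (labelling_mate i).exchangesIn_tri le_rfl le_rfl (by norm_num) (by norm_num)
        (N := w.tri i) hp ⟨hr.1, by linarith [hr.2]⟩ ?_ ?_ ?_ ?_
      · intro n hn x hx
        rw [hc] at hx
        rw [← hpr x hx.ge]
        have := (triLevel_bounds hn).1
        have := hεt i
        obtain ⟨d, hd, d0, d1, d2, m2, m3, y0, y1, y2, y3⟩ := coords x
        fin_cases i <;> simp only [Fin.mk_one, Fin.zero_eta, Fin.reduceFinMk] at * <;> linarith
      · intro x hx
        rw [hc] at hx
        exact hx.le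
      · intro x hx
        rw [hc] at hx
        rw [← hpr x hx.le, Set.mem_preimage]
        obtain ⟨d, hd, d0, d1, d2, m2, m3, y0, y1, y2, y3⟩ := coords x
        have e := x.sum_four
        have h0 := x.nonneg 0
        have h1 := x.nonneg 1
        have h2 := x.nonneg 2
        have h3 := x.nonneg 3
        refine TetCoords.mem_model_iff_onTri (fun j hj => TetCoords.not_onTri ?_)
          fun k => TetCoords.not_onQuad ?_
        · fin_cases i <;> fin_cases j <;> first
            | exact absurd rfl hj
            | (simp only [Fin.mk_one, Fin.zero_eta, Fin.reduceFinMk] at *; linarith)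
        · fin_cases i <;> fin_cases k <;>
            simp only [Fin.mk_one, Fin.zero_eta, Fin.reduceFinMk, Fin.succ_zero_eq_one,
              Fin.succ_one_eq_two, Fin.reduceSucc] at * <;>
            first | (right; linarith) | (left; linarith)
      · intro x hx
        rw [hc] at hx
        exact w.mem_model_iff_of_gt hx
  -- Outside the regions the small shift cannot create triangles or quadrilaterals 01/23, and it
  -- cancels in `x 0 + x 2` and `x 0 + x 3`, so the other quadrilaterals are already flat.
  · intro x hx
    have hx4 : ∀ i, x i ≤ 2 / 3 := fun i => by
      have := hx (some i) (Finset.mem_univ _)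
      rwa [memU, not_lt] at this
    have hxq : w.quad 0 ≠ 0 → ¬ x 0 + x 1 ∈ Set.Ioo (1 / 3 : ℝ) (2 / 3) := fun h h' =>
      hx none (Finset.mem_univ _) ⟨h, h'⟩
    obtain ⟨d, hd, d0, d1, d2, m2, m3, y0, y1, y2, y3⟩ := coords x
    rw [Set.mem_preimage, TetCoords.mem_model_iff_onQuad, TetCoords.mem_model_iff_onQuad]
    · refine exists_congr fun k => ?_
      fin_cases k
      · refine iff_of_false (fun h => ?_) fun h => ?_
        · refine hxq h.ne_zero ?_
          have hb := h.bounds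
          have := hεq 0
          change 1 / 3 + 1 / ((w.quad 0 : ℝ) + 1) / 3 ≤ pillowShift ζ 0 x 0 + pillowShift ζ 0 x 1 ∧
            pillowShift ζ 0 x 0 + pillowShift ζ 0 x 1 < 2 / 3 at hb
          constructor <;> linarith [hb.1, hb.2]
        · exact hxq h.ne_zero ⟨h.lt, h.bounds.2⟩
      · refine exists_congr fun n => and_congr_right fun _ => ?_
        change pillowShift ζ 0 x 0 + pillowShift ζ 0 x 2 = _ ↔ x 0 + x 2 = _
        rw [y0, y2, show x 0 + 2 * d + (x 2 - 2 * d) = x 0 + x 2 by ring]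
      · refine exists_congr fun n => and_congr_right fun _ => ?_
        change pillowShift ζ 0 x 0 + pillowShift ζ 0 x 3 = _ ↔ x 0 + x 3 = _
        rw [y0, y3, show x 0 + 2 * d + (x 3 - 2 * d) = x 0 + x 3 by ring]
    · exact fun j => TetCoords.not_onTri (hx4 j)
    · intro j hj
      have hb := hj.bounds
      have := hεt j
      have := hx4 j
      fin_cases j <;> simp only [Fin.mk_one, Fin.zero_eta, Fin.reduceFinMk] at * <;> linarith

/-! ### Regions around the vertices in the thin tetrahedra of a pillow. -/

/-- The height function of the region around vertex `i` in a pillow. -/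
noncomputable def vertexHeight (i : Fin 4) : Tetra → ℝ :=
  coneHeight i (mate i) (opp i) (opp' i) 1 1

/-- Only the differences `x 0 - x 1` and `x 2 - x 3` and the full sum enter, and the shift preserves
them. The regions are therefore the same before and after the map, even though the shift here need
not be small. -/
theorem vertexHeight_pillowShift (ζ ξ : unitInterval) (i : Fin 4) (x : Tetra) :
    vertexHeight i (pillowShift ζ ξ x) = vertexHeight i x := by
  have e1 : pillowShift ζ ξ x 0 - pillowShift ζ ξ x 1 = x 0 - x 1 := by
    rw [pillowShift_zero, pillowShift_one]; ring
  have e2 : pillowShift ζ ξ x 2 - pillowShift ζ ξ x 3 = x 2 - x 3 := by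
    rw [pillowShift_two, pillowShift_three]; ring
  fin_cases i <;>
    simp only [vertexHeight, coneHeight, mate, opp, opp', one_mul, Matrix.cons_val,
      Fin.mk_one, Fin.zero_eta, Fin.reduceFinMk, e1, e2] <;> linarith

/-- Triangles lie at `x i > 2/3`, so this places them in the region where `vertexHeight` exceeds
1/3. -/
theorem two_mul_sub_one_le_vertexHeight (i : Fin 4) (x : Tetra) :
    2 * x i - 1 ≤ vertexHeight i x := by
  have e := (labelling_mate i).sum x
  have h1 := x.nonneg (opp i)
  have h2 := x.nonneg (opp' i)
  simp only [vertexHeight, coneHeight, one_mul]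
  have : |x (opp i) - x (opp' i)| ≤ x (opp i) + x (opp' i) := abs_le.2 ⟨by linarith, by linarith⟩
  linarith

/-- The absolute values dominate the signed differences, which cancel; this makes the regions of
different vertices disjoint. -/
theorem vertexHeight_add_le {i j : Fin 4} (h : i ≠ j) (x : Tetra) :
    vertexHeight i x + vertexHeight j x ≤ 0 := by
  have a1 := le_abs_self (x 0 - x 1)
  have a2 := neg_abs_le (x 0 - x 1)
  have a3 := le_abs_self (x 2 - x 3)
  have a4 := neg_abs_le (x 2 - x 3)
  fin_cases i <;> fin_cases j <;> first
    | exact absurd rfl h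
    | (simp only [vertexHeight, coneHeight, mate, opp, opp', one_mul, Matrix.cons_val,
        Fin.mk_one, Fin.zero_eta, Fin.reduceFinMk]; linarith)

theorem TetCoords.OnQuad.vertexHeight_le {v : TetCoords} {k : Fin 3} {x : Tetra}
    (h : v.OnQuad k x) (hk : k ≠ 0) (i : Fin 4) : vertexHeight i x ≤ 1 / 3 := by
  have h1 := h.lt
  have h2 := h.bounds.2
  have e := x.sum_four
  have a1 := le_abs_self (x 0 - x 1)
  have a2 := neg_abs_le (x 0 - x 1)
  have a3 := le_abs_self (x 2 - x 3)
  have a4 := neg_abs_le (x 2 - x 3)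
  fin_cases k
  · exact absurd rfl hk
  all_goals
    simp only [Fin.mk_one, Fin.reduceFinMk, Fin.reduceSucc, Fin.succ_one_eq_two] at h1 h2
    fin_cases i <;>
      (simp only [vertexHeight, coneHeight, mate, opp, opp', one_mul, Matrix.cons_val,
        Fin.mk_one, Fin.zero_eta, Fin.reduceFinMk]; linarith)

/-- Near each vertex, the coordinates of a pillow map are conical. -/
theorem exists_pillowShift_eq_coneFun (ζ ξ : unitInterval) (i : Fin 4) :
    ∃ p r : ℝ, (0 ≤ p ∧ p ≤ 1) ∧ (0 ≤ r ∧ r ≤ 1) ∧ ∀ x : Tetra, x (mate i) ≤ x i →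
      pillowShift ζ ξ x i = coneFun i (mate i) (opp i) (opp' i) p r x := by
  have hi := (by decide : ∀ i : Fin 4, i = 0 ∨ i = 1 ∨ i = 2 ∨ i = 3) i
  rcases hi with rfl | rfl | rfl | rfl
  · refine ⟨ξ, ζ, ξ.2, ζ.2, fun x hx => ?_⟩
    have hx' : x 1 ≤ x 0 := hx
    simp only [pillowShift_zero, coneFun, mate, opp, opp', Matrix.cons_val, min_eq_right hx']
    ring
  · refine ⟨ξ, ζ, ξ.2, ζ.2, fun x hx => ?_⟩
    have hx' : x 0 ≤ x 1 := hx
    simp only [pillowShift_one, coneFun, mate, opp, opp', Matrix.cons_val, min_eq_left hx']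
    ring
  · refine ⟨ζ, ξ, ζ.2, ξ.2, fun x hx => ?_⟩
    have hx' : x 3 ≤ x 2 := hx
    simp only [pillowShift_two, coneFun, mate, opp, opp', Matrix.cons_val, min_eq_right hx']
    ring
  · refine ⟨ζ, ξ, ζ.2, ξ.2, fun x hx => ?_⟩
    have hx' : x 2 ≤ x 3 := hx
    simp only [pillowShift_three, coneFun, mate, opp, opp', Matrix.cons_val, min_eq_left hx']
    ring

theorem mate_le_of_vertexHeight {i : Fin 4} {x : Tetra} (h : 1 / 3 ≤ vertexHeight i x) :
    x (mate i) ≤ x i := by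
  simp only [vertexHeight, coneHeight, one_mul] at h
  linarith [abs_nonneg (x (opp i) - x (opp' i))]

/-- On the bottom of the region, every `coneFun` with `0 ≤ p` and `0 ≤ r ≤ 1` is thus at most 2/3,
below all triangle levels. -/
theorem add_min_le_of_vertexHeight {i : Fin 4} {x : Tetra} (h : vertexHeight i x = 1 / 3) :
    x i + min (x (opp i)) (x (opp' i)) = 2 / 3 := by
  have e := (labelling_mate i).sum x
  simp only [vertexHeight, coneHeight, one_mul] at h
  rcases le_total (x (opp i)) (x (opp' i)) with h1 | h1
  · rw [abs_of_nonpos (by linarith)] at h; rw [min_eq_left h1]; linarith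
  · rw [abs_of_nonneg (by linarith)] at h; rw [min_eq_right h1]; linarith

/-- The triangles around a vertex, in the region where no quadrilaterals interfere. -/
theorem exchangesIn_vertexHeight (ζ ξ : unitInterval) {w w' : TetCoords} {i : Fin 4}
    (hi : w'.tri i = w.tri i)
    (hq : ∀ k (x : Tetra), 1 / 3 < vertexHeight i x → ¬ w.OnQuad k (pillowShift ζ ξ x))
    (hq' : ∀ k (x : Tetra), 1 / 3 < vertexHeight i x → ¬ w'.OnQuad k x) :
    ExchangesIn {x | 1 / 3 < vertexHeight i x} (pillowShift ζ ξ ⁻¹' w.model) w'.model := by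
  obtain ⟨p, r, hp, hr, e⟩ := exists_pillowShift_eq_coneFun ζ ξ i
  have excl : ∀ x : Tetra, 1 / 3 < vertexHeight i x → ∀ j, j ≠ i → x j ≤ 2 / 3 := by
    intro x hx j hj
    have := vertexHeight_add_le hj x
    have := two_mul_sub_one_le_vertexHeight j x
    linarith
  refine (labelling_mate i).exchangesIn_tri zero_le_one zero_le_one (by norm_num) (by norm_num)
    (N := w.tri i) (p := p) (r := r) ⟨by linarith [hp.1], hp.2⟩ ⟨hr.1, by linarith [hr.2]⟩
    ?_ ?_ ?_ ?_
  · intro n hn x hx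
    have h1 := add_min_le_of_vertexHeight hx
    have h2 : 0 ≤ min (x (opp i)) (x (opp' i)) := le_min (x.nonneg _) (x.nonneg _)
    have h3 := mul_nonneg hp.1 (x.nonneg (mate i))
    have h4 := lt_triLevel hn
    unfold coneFun
    nlinarith [hr.2]
  · intro x hx
    have h1 := add_min_le_of_vertexHeight hx
    have h2 : 0 ≤ min (x (opp i)) (x (opp' i)) := le_min (x.nonneg _) (x.nonneg _)
    linarith
  · intro x hx
    rw [← e x (mate_le_of_vertexHeight hx.le), Set.mem_preimage]
    refine TetCoords.mem_model_iff_onTri (fun j hj => TetCoords.not_onTri ?_) fun k => hq k x hx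
    exact excl _ (by rw [vertexHeight_pillowShift]; exact hx) j hj
  · intro x hx
    rw [← hi]
    exact TetCoords.mem_model_iff_onTri (fun j hj => TetCoords.not_onTri (excl x hx j hj))
      fun k => hq' k x hx

/-- A pillow without quadrilaterals separating its degree two edge from the opposite edge. -/
theorem normallyIsotopic_pillow_of_quad_eq_zero (ζ ξ : unitInterval) {w : TetCoords}
    (hw : w.quad 0 = 0) : NormallyIsotopic (pillowShift ζ ξ ⁻¹' w.model) w.model := by
  have h0 : ∀ y, ¬ w.OnQuad 0 y := fun y h => h.ne_zero hw
  have hq : ∀ i k (x : Tetra), 1 / 3 < vertexHeight i x → ¬ w.OnQuad k x := by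
    intro i k x hx h
    by_cases hk : k = 0
    · subst hk; exact h0 _ h
    · exact absurd (h.vertexHeight_le hk i) (not_le.2 hx)
  refine NormallyIsotopic.of_exchanges Finset.univ (fun i => {x | 1 / 3 < vertexHeight i x}) _ _
    ?_ ?_ ?_
  · intro i _ j _ hij x hi hj
    have := vertexHeight_add_le hij x
    simp only [Set.mem_ofPred_eq] at hi hj
    linarith
  · intro i _
    exact exchangesIn_vertexHeight ζ ξ rfl
      (fun k x hx => hq i k _ (by rwa [vertexHeight_pillowShift])) (hq i)
  · intro x hx
    have hx' : ∀ i, vertexHeight i x ≤ 1 / 3 := fun i => not_lt.1 (hx i (Finset.mem_univ i))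
    have key : ∀ y : Tetra, (∀ i, vertexHeight i y ≤ 1 / 3) → ∀ j, ¬ w.OnTri j y := by
      intro y hy j
      refine TetCoords.not_onTri ?_
      linarith [two_mul_sub_one_le_vertexHeight j y, hy j]
    rw [Set.mem_preimage, TetCoords.mem_model_iff_onQuad, TetCoords.mem_model_iff_onQuad]
    · refine exists_congr fun k => ?_
      fin_cases k
      · exact iff_of_false (h0 _) (h0 _)
      -- The opposite shifts of coordinates 0 and 2 cancel, so these quadrilaterals are pulled back
      -- to themselves; likewise for 0 and 3.
      · refine exists_congr fun n => and_congr_right fun _ => ?_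
        change pillowShift ζ ξ x 0 + pillowShift ζ ξ x 2 = _ ↔ x 0 + x 2 = _
        rw [pillowShift_zero, pillowShift_two, add_add_sub_cancel]
      · refine exists_congr fun n => and_congr_right fun _ => ?_
        change pillowShift ζ ξ x 0 + pillowShift ζ ξ x 3 = _ ↔ x 0 + x 3 = _
        rw [pillowShift_zero, pillowShift_three, add_add_sub_cancel]
    · exact key x hx'
    · exact key _ fun i => by rw [vertexHeight_pillowShift]; exact hx' i

/-! ### Quadrilaterals that turn into pairs of triangles. -/

/-- The normal coordinates in the two tetrahedra of a pillow. -/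
def TetCoords.pillowed (w : TetCoords) : TetCoords :=
  ![w 0 + w 4, w 1 + w 4, w 2, w 3, 0, w 5, w 6]

theorem exists_lt_add_ite_iff {t q : ℕ} {P Q : ℕ → Prop} :
    (∃ n < t + q, if n < q then P n else Q (n - q)) ↔ (∃ n < q, P n) ∨ ∃ n < t, Q n := by
  constructor
  · rintro ⟨n, hn, h⟩
    split_ifs at h with h1
    · exact Or.inl ⟨n, h1, h⟩
    · exact Or.inr ⟨n - q, by omega, h⟩
  · rintro (⟨n, hn, h⟩ | ⟨n, hn, h⟩)
    · exact ⟨n, by omega, by rwa [if_pos hn]⟩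
    · exact ⟨n + q, by omega, by simpa using h⟩

/-- A stack of surfaces around a vertex, the outer `q` of which come from quadrilaterals. -/
theorem Labelling.exchangesIn_of_quad {i j k l : Fin 4} (h : Labelling i j k l) {ε ζ ξ : ℝ}
    (hε : 0 < ε) (hε1 : 12 * ε ≤ 1) (hζ0 : 0 ≤ ζ) (hζ : ζ ≤ 2 * ε) (hξ : ξ = 1 - ε) {q t : ℕ}
    (hq : 12 * ε ≤ 1 / ((q : ℝ) + 1)) {A B : Set Tetra}
    (hA : ∀ x, 1 / 3 < coneHeight i j k l 1 0 x → (x ∈ A ↔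
      (∃ n < q, coneFun i j k l (2 * ξ - 1) (2 * ζ) x = quadLevel q n) ∨
        ∃ n < t, coneFun i j k l ξ ζ x = triLevel t n))
    (hB : ∀ x, 1 / 3 < coneHeight i j k l 1 0 x →
      (x ∈ B ↔ ∃ n < t + q, x i = triLevel (t + q) n)) :
    ExchangesIn {x | 1 / 3 < coneHeight i j k l 1 0 x} A B := by
  -- Reaching a triangle level, above 2/3, in the smaller function forces the larger one above all
  -- quadrilateral levels; so the triangles lie nearer to the vertex.
  have le : ∀ x, coneFun i j k l ξ ζ x ≤ coneFun i j k l (2 * ξ - 1) (2 * ζ) x := by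
    intro x
    have h1 : 0 ≤ ζ * min (x k) (x l) := mul_nonneg hζ0 (le_min (x.nonneg k) (x.nonneg l))
    have h2 : 0 ≤ (1 - ξ) * x j := mul_nonneg (by linarith) (x.nonneg j)
    unfold coneFun
    linarith
  -- The excess over 1/3 is at most `2ε (x j + x k + x l)`, while the first quadrilateral level
  -- exceeds 1/3 by at least `4ε`.
  have bot : ∀ x, coneHeight i j k l 1 0 x = 1 / 3 →
      coneFun i j k l (2 * ξ - 1) (2 * ζ) x ≤ 1 / 3 + 2 * ε := by
    intro x hx
    have e := h.sum x
    have h1 : ζ * min (x k) (x l) ≤ 2 * ε * min (x k) (x l) :=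
      mul_le_mul_of_nonneg_right hζ (le_min (x.nonneg k) (x.nonneg l))
    have h2 : 2 * min (x k) (x l) ≤ x k + x l := by
      linarith [min_le_left (x k) (x l), min_le_right (x k) (x l)]
    have h3 := x.nonneg i
    simp only [coneHeight, one_mul, zero_mul, sub_zero] at hx
    unfold coneFun
    subst hξ
    nlinarith
  -- The quadrilaterals are farther from the vertex and get the numbers below `q`; triangle number
  -- `m` becomes number `q + m`.
  refine h.exchangesIn zero_le_one le_rfl (by norm_num) (by norm_num) (N := t + q)
    (p := fun n => if n < q then 2 * ξ - 1 else ξ) (r := fun n => if n < q then 2 * ζ else ζ)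
    (c := fun n => if n < q then quadLevel q n else triLevel t (n - q)) ?_ ?_ ?_ ?_ ?_ ?_ ?_ hB
  · intro n _; split_ifs <;> constructor <;> linarith
  · intro n _; split_ifs <;> constructor <;> linarith
  · intro n hn
    split_ifs with h1
    · linarith [(quadLevel_bounds h1).2]
    · exact (triLevel_bounds (by omega)).2
  · intro n hn x _ hx
    by_cases h1 : n + 1 < q
    · have h2 : n < q := by omega
      simp only [if_pos h1, if_pos h2] at hx ⊢
      exact (quadLevel_lt_succ q n).trans_le hx
    · by_cases h2 : n < q
      · simp only [if_neg h1, if_pos h2] at hx ⊢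
        have h3 := lt_triLevel (N := t) (n := n + 1 - q) (by omega)
        linarith [le x, (quadLevel_bounds h2).2]
      · simp only [if_neg h1, if_neg h2] at hx ⊢
        rw [show n + 1 - q = n - q + 1 by omega] at hx
        exact (triLevel_lt_succ _ _).trans_le hx
  · intro n hn x hx
    have b := bot x hx
    by_cases h2 : n < q
    · simp only [if_pos h2]
      linarith [(quadLevel_bounds h2).1]
    · simp only [if_neg h2]
      linarith [le x, lt_triLevel (N := t) (n := n - q) (by omega)]
  · intro x hx
    have e := h.sum x
    simp only [coneHeight, one_mul, zero_mul, sub_zero] at hx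
    linarith [x.nonneg k, x.nonneg l]
  · intro x hx
    rw [hA x hx, ← exists_lt_add_ite_iff]
    refine exists_congr fun n => and_congr_right fun _ => ?_
    split_ifs <;> rfl

/-- A pillow with quadrilaterals separating its degree two edge from the opposite edge. -/
theorem normallyIsotopic_pillow_of_quad_ne_zero {w : TetCoords} (hw : w.Admissible)
    (hw0 : w.quad 0 ≠ 0) {ε : ℝ} (hε : 0 < ε) (hε1 : 12 * ε ≤ 1)
    (hεw : 12 * ε ≤ 1 / ((w.quad 0 : ℝ) + 1)) {ζ ξ : unitInterval} (hζ : (ζ : ℝ) ≤ 2 * ε)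
    (hξ : (ξ : ℝ) = 1 - ε) :
    NormallyIsotopic (pillowShift ζ ξ ⁻¹' w.model) w.pillowed.model := by
  have hk : ∀ k, k ≠ 0 → w.quad k = 0 := fun k hk => by
    by_contra h; exact hk (hw k 0 h hw0)
  have noq : ∀ k y, ¬ w.pillowed.OnQuad k y := by
    intro k y h
    refine h.ne_zero ?_
    fin_cases k
    · rfl
    · exact hk 1 (by decide)
    · exact hk 2 (by decide)
  have noq' : ∀ k y, k ≠ 0 → ¬ w.OnQuad k y := fun k y h h' => h'.ne_zero (hk k h)
  -- Since `ξ` is close to 1, the sum of the first two shifted coordinates is `|x 0 - x 1|` up to a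
  -- small error. Its level surfaces therefore split into a sheet around vertex 0 and one around
  -- vertex 1.
  have quad_abs : ∀ x, w.OnQuad 0 (pillowShift ζ ξ x) → 1 / 3 < |x 0 - x 1| := by
    intro x hx
    have hb := hx.bounds.1
    change _ ≤ pillowShift ζ ξ x 0 + pillowShift ζ ξ x 1 at hb
    rw [pillowShift_zero, pillowShift_one, hξ] at hb
    have e := x.sum_four
    have m2 : 0 ≤ min (x 2) (x 3) := le_min (x.nonneg 2) (x.nonneg 3)
    have h1 := mul_le_mul_of_nonneg_right hζ m2
    have h2 : 2 * min (x 2) (x 3) ≤ x 2 + x 3 := by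
      linarith [min_le_left (x 2) (x 3), min_le_right (x 2) (x 3)]
    rcases le_total (x 0) (x 1) with h | h
    · rw [min_eq_left h] at hb
      rw [abs_of_nonpos (by linarith)]
      nlinarith [x.nonneg 1]
    · rw [min_eq_right h] at hb
      rw [abs_of_nonneg (by linarith)]
      nlinarith [x.nonneg 0]
  -- On the pulled back quadrilaterals only `|x 0 - x 1|` is controlled, so at vertices 0 and 1 the
  -- term `|x 2 - x 3|` is dropped to enlarge the region.
  let b : Fin 4 → ℝ := ![0, 0, 1, 1]
  let L : Fin 4 → Tetra → ℝ := fun i => coneHeight i (mate i) (opp i) (opp' i) 1 (b i)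
  have L0 : ∀ x, L 0 x = x 0 - x 1 := fun x => by simp [L, b, coneHeight, mate]
  have L1 : ∀ x, L 1 x = x 1 - x 0 := fun x => by simp [L, b, coneHeight, mate]
  have L2 : ∀ x, L 2 x = x 2 - x 3 - |x 0 - x 1| := fun x => by
    simp [L, b, coneHeight, mate, opp, opp']
  have L3 : ∀ x, L 3 x = x 3 - x 2 - |x 0 - x 1| := fun x => by
    simp [L, b, coneHeight, mate, opp, opp']
  have L_ge : ∀ i x, vertexHeight i x ≤ L i x := by
    intro i x
    have := mul_nonneg (sub_nonneg.2 (show b i ≤ 1 by fin_cases i <;> simp [b]))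
      (abs_nonneg (x (opp i) - x (opp' i)))
    simp only [vertexHeight, L, coneHeight]
    linarith
  have disj : ∀ i j x, i ≠ j → 1 / 3 < L i x → ¬ 1 / 3 < L j x := by
    intro i j x hij hi hj
    have e := x.sum_four
    have h0 := x.nonneg 0
    have h1 := x.nonneg 1
    have h2 := x.nonneg 2
    have h3 := x.nonneg 3
    have a1 := le_abs_self (x 0 - x 1)
    have a2 := neg_abs_le (x 0 - x 1)
    fin_cases i <;> fin_cases j <;> first
      | exact absurd rfl hij
      | (simp only [Fin.mk_one, Fin.zero_eta, Fin.reduceFinMk, L0, L1, L2, L3] at hi hj; linarith)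
  have tri_L : ∀ i x, w.OnTri i (pillowShift ζ ξ x) → 1 / 3 < L i x := by
    intro i x hx
    have h1 := hx.lt
    have h2 := two_mul_sub_one_le_vertexHeight i (pillowShift ζ ξ x)
    rw [vertexHeight_pillowShift] at h2
    linarith [L_ge i x]
  have tri_L' : ∀ i x, w.pillowed.OnTri i x → 1 / 3 < L i x := by
    intro i x hx
    have h1 := hx.lt
    have h2 := two_mul_sub_one_le_vertexHeight i x
    linarith [L_ge i x]
  have quad_L : ∀ x, w.OnQuad 0 (pillowShift ζ ξ x) → 1 / 3 < L 0 x ∨ 1 / 3 < L 1 x := by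
    intro x hx
    have := quad_abs x hx
    rw [L0, L1]
    rcases lt_abs.1 this with h | h
    · exact Or.inl h
    · right; linarith
  have memA : ∀ i, i = 0 ∨ i = 1 → ∀ x, 1 / 3 < L i x → (x ∈ pillowShift ζ ξ ⁻¹' w.model ↔
      w.OnQuad 0 (pillowShift ζ ξ x) ∨ w.OnTri i (pillowShift ζ ξ x)) := by
    intro i hi x hx
    rw [Set.mem_preimage, TetCoords.mem_model]
    constructor
    · rintro (⟨j, hj⟩ | ⟨k, hk⟩)
      · by_cases hij : i = j
        · rw [hij]; exact Or.inr hj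
        · exact absurd (tri_L j x hj) (disj i j x hij hx)
      · by_cases hk0 : k = 0
        · rw [← hk0]; exact Or.inl hk
        · exact absurd hk (noq' k _ hk0)
    · rintro (h | h)
      · exact Or.inr ⟨0, h⟩
      · exact Or.inl ⟨i, h⟩
  have memB : ∀ i x, 1 / 3 < L i x → (x ∈ w.pillowed.model ↔ w.pillowed.OnTri i x) := by
    intro i x hx
    exact TetCoords.mem_model_iff_onTri
      (fun j hj hj' => disj i j x (Ne.symm hj) hx (tri_L' j x hj')) fun k => noq k x
  refine NormallyIsotopic.of_exchanges Finset.univ (fun i => {x | 1 / 3 < L i x}) _ _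
    (fun i _ j _ hij x hi hj => disj i j x hij hi hj) ?_ ?_
  · intro i _
    by_cases hi : i = 0 ∨ i = 1
    · have htri : w.pillowed.tri i = w.tri i + w.quad 0 := by rcases hi with rfl | rfl <;> rfl
      have hbi : b i = 0 := by rcases hi with rfl | rfl <;> rfl
      have hL : L i = coneHeight i (mate i) (opp i) (opp' i) 1 0 := by simp only [L, hbi]
      rw [hL]
      refine (labelling_mate i).exchangesIn_of_quad hε hε1 ζ.2.1 hζ hξ hεw (t := w.tri i) ?_ ?_
      · intro x hx
        rw [← hL] at hx
        rw [memA i hi x hx]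
        refine or_congr ?_ ?_
        · refine exists_congr fun n => and_congr_right fun _ => ?_
          rw [show (0 : Fin 3).succ = 1 from rfl, pillowShift_zero, pillowShift_one]
          rcases hi with rfl | rfl
          · rw [L0] at hx
            rw [min_eq_right (by linarith : x 1 ≤ x 0)]
            simp only [coneFun, mate, opp, opp', Matrix.cons_val]
            refine Eq.congr_left ?_
            ring
          · rw [L1] at hx
            rw [min_eq_left (by linarith : x 0 ≤ x 1)]
            simp only [coneFun, mate, opp, opp', Matrix.cons_val]
            refine Eq.congr_left ?_
            ring
        · refine exists_congr fun n => and_congr_right fun _ => ?_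
          rcases hi with rfl | rfl
          · rw [L0] at hx
            rw [pillowShift_zero, min_eq_right (by linarith : x 1 ≤ x 0)]
            simp only [coneFun, mate, opp, opp', Matrix.cons_val]
            refine Eq.congr_left ?_
            ring
          · rw [L1] at hx
            rw [pillowShift_one, min_eq_left (by linarith : x 0 ≤ x 1)]
            simp only [coneFun, mate, opp, opp', Matrix.cons_val]
            refine Eq.congr_left ?_
            ring
      · intro x hx
        rw [← hL] at hx
        rw [memB i x hx, ← htri]
        rfl
    · have hi' := (by decide : ∀ i : Fin 4, ¬ (i = 0 ∨ i = 1) → i = 2 ∨ i = 3) i hi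
      have htri : w.pillowed.tri i = w.tri i := by rcases hi' with rfl | rfl <;> rfl
      have hL : L i = vertexHeight i := by
        rcases hi' with rfl | rfl <;> rfl
      rw [hL]
      refine exchangesIn_vertexHeight ζ ξ htri ?_ fun k x _ => noq k x
      intro k x hx h
      by_cases hk0 : k = 0
      · subst hk0
        rw [← hL] at hx
        rcases quad_L x h with h' | h'
        · exact disj i 0 x (fun e => hi (Or.inl e)) hx h'
        · exact disj i 1 x (fun e => hi (Or.inr e)) hx h'
      · exact noq' k _ hk0 h
  · intro x hx
    have hx' : ∀ i, ¬ 1 / 3 < L i x := fun i => hx i (Finset.mem_univ i)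
    rw [Set.mem_preimage, TetCoords.mem_model, TetCoords.mem_model]
    refine iff_of_false ?_ ?_
    · rintro (⟨j, hj⟩ | ⟨k, h⟩)
      · exact hx' j (tri_L j x hj)
      · by_cases hk0 : k = 0
        · subst hk0
          rcases quad_L x h with h' | h'
          · exact hx' 0 h'
          · exact hx' 1 h'
        · exact noq' k _ hk0 h
    · rintro (⟨j, hj⟩ | ⟨k, h⟩)
      · exact hx' j (tri_L' j x hj)
      · exact noq k x h

/-- For every normal surface there is a standard pillow which it meets in normal surfaces. -/
theorem exists_pillowMap {w : TetCoords} (hw : w.Admissible) :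
    ∃ K, PillowMap 0 1 2 3 K ∧ NormallyIsotopic (K 0 ⁻¹' w.model) w.model ∧
      NormallyIsotopic (K 1 ⁻¹' w.model) w.pillowed.model ∧
      NormallyIsotopic (K 2 ⁻¹' w.model) w.pillowed.model := by
  have hM : (0 : ℝ) ≤ (∑ j, w j : ℕ) := by positivity
  -- The total number of discs bounds every coordinate, so a single `ε` is small compared with the
  -- level spacing of every type.
  obtain ⟨ε, hε⟩ : ∃ ε : ℝ, 12 * ε = 1 / (((∑ j, w j : ℕ) : ℝ) + 1) :=
    ⟨1 / (((∑ j, w j : ℕ) : ℝ) + 1) / 12, by ring⟩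
  have hpos : 0 < 12 * ε := by rw [hε]; positivity
  have h0 : 0 < ε := by linarith
  have h1 : 12 * ε ≤ 1 := by
    rw [hε, div_le_one (by linarith)]; linarith
  have hj : ∀ j, 12 * ε ≤ 1 / ((w j : ℝ) + 1) := by
    intro j
    rw [hε]
    have : (w j : ℝ) ≤ (∑ j, w j : ℕ) := by
      exact_mod_cast Finset.single_le_sum (f := fun j => w j) (fun _ _ => Nat.zero_le _)
        (Finset.mem_univ j)
    gcongr
  let ζ : unitInterval := ⟨2 * ε, by linarith, by linarith⟩
  let ξ : unitInterval := ⟨1 - ε, by linarith, by linarith⟩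
  refine ⟨pillow ζ ξ, pillowMap_pillow h0 (by linarith) rfl rfl,
    normallyIsotopic_pillow_zero hw h0 h1 hj rfl, ?_⟩
  -- Without quadrilaterals 01/23 the pillowed coordinates are `w` itself.
  by_cases hq : w.quad 0 = 0
  · have e : w.pillowed = w := by
      have h4 : w 4 = 0 := hq
      funext j
      fin_cases j <;> simp [TetCoords.pillowed, h4]
    rw [e]
    exact ⟨normallyIsotopic_pillow_of_quad_eq_zero ζ ξ hq,
      normallyIsotopic_pillow_of_quad_eq_zero 0 ξ hq⟩
  · exact ⟨normallyIsotopic_pillow_of_quad_ne_zero hw hq h0 h1 (hj _) le_rfl rfl,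
      normallyIsotopic_pillow_of_quad_ne_zero hw hq h0 h1 (hj _)
        (show (0 : ℝ) ≤ 2 * ε by linarith) rfl⟩

/-! ### Permuting the vertices -/

theorem Tetra.permute_apply (p : Equiv.Perm (Fin 4)) (x : Tetra) (i : Fin 4) :
    Tetra.permute p x i = x (p.symm i) := rfl

@[simp]
theorem Tetra.permute_apply_apply (p : Equiv.Perm (Fin 4)) (x : Tetra) (i : Fin 4) :
    Tetra.permute p x (p i) = x i := by
  rw [Tetra.permute_apply, Equiv.symm_apply_apply]

@[simp]
theorem Tetra.permute_one (x : Tetra) : Tetra.permute 1 x = x := rfl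

theorem Tetra.permute_permute (p q : Equiv.Perm (Fin 4)) (x : Tetra) :
    Tetra.permute p (Tetra.permute q x) = Tetra.permute (p * q) x := rfl

/-- The affine automorphism of the tetrahedron induced by a permutation, as a homeomorphism. -/
def Tetra.permuteHomeo (p : Equiv.Perm (Fin 4)) : Tetra ≃ₜ Tetra where
  toFun := Tetra.permute p
  invFun := Tetra.permute p⁻¹
  left_inv x := by rw [Tetra.permute_permute, inv_mul_cancel, Tetra.permute_one]
  right_inv x := by rw [Tetra.permute_permute, mul_inv_cancel, Tetra.permute_one]
  continuous_toFun := continuous_tetra fun i => Tetra.continuous_coord (p.symm i)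
  continuous_invFun := continuous_tetra fun i => Tetra.continuous_coord (p⁻¹.symm i)

@[simp]
theorem Tetra.permuteHomeo_apply (p : Equiv.Perm (Fin 4)) (x : Tetra) :
    Tetra.permuteHomeo p x = Tetra.permute p x := rfl

@[simp]
theorem Tetra.permuteHomeo_symm_permute (p : Equiv.Perm (Fin 4)) (x : Tetra) :
    (Tetra.permuteHomeo p).symm (Tetra.permute p x) = x :=
  (Tetra.permuteHomeo p).symm_apply_apply x

/-- Conjugation of a face-preserving homeomorphism by a permutation of the vertices. -/
theorem FacePreserving.conj_permute {θ : Tetra ≃ₜ Tetra} (h : FacePreserving θ)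
    (p : Equiv.Perm (Fin 4)) :
    FacePreserving (((Tetra.permuteHomeo p).symm.trans θ).trans (Tetra.permuteHomeo p)) := by
  intro x i
  obtain ⟨y, rfl⟩ := (Tetra.permuteHomeo p).surjective x
  obtain ⟨j, rfl⟩ := p.surjective i
  simp [h y j]

/-- The type of the quadrilaterals that separate `a, b` from the other two vertices. -/
def quadIdx (a b : Fin 4) : Fin 3 :=
  ![![0, 0, 1, 2], ![0, 0, 2, 1], ![1, 2, 0, 0], ![2, 1, 0, 0]] a b

theorem quadIdx_injective : ∀ a b c : Fin 4, a ≠ b → a ≠ c → quadIdx a b = quadIdx a c → b = c := by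
  decide

theorem quadIdx_cases : ∀ a b : Fin 4, a ≠ b → (a = 0 ∧ b = (quadIdx a b).succ) ∨
    (a = (quadIdx a b).succ ∧ b = 0) ∨ Labelling a b 0 (quadIdx a b).succ := by
  decide

theorem quadIdx_bijective (p : Equiv.Perm (Fin 4)) :
    Function.Bijective fun k : Fin 3 => quadIdx (p 0) (p k.succ) := by
  refine Finite.injective_iff_bijective.1 fun k l h => ?_
  have := quadIdx_injective _ _ _ (fun e => (Fin.succ_ne_zero k) (p.injective e).symm)
    (fun e => (Fin.succ_ne_zero l) (p.injective e).symm) h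
  exact Fin.succ_injective _ (p.injective this)

/-- The normal coordinates `w` are obtained from `v` by permuting the vertices. -/
def TetCoords.Permutes (p : Equiv.Perm (Fin 4)) (v w : TetCoords) : Prop :=
  (∀ i, w.tri (p i) = v.tri i) ∧ ∀ k : Fin 3, w.quad (quadIdx (p 0) (p k.succ)) = v.quad k

/-- Model quadrilaterals are described through vertex 0. Relabelling may exchange the two vertex
pairs, replacing a level by its complement; the symmetry of the levels about 1/2 makes this
harmless. -/
theorem quadLevel_symm {N n : ℕ} (h : n < N) : 1 - quadLevel N n = quadLevel N (N - 1 - n) := by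
  have : ((N - 1 - n : ℕ) : ℝ) = N - 1 - n := by
    rw [Nat.cast_sub (by omega), Nat.cast_sub (by omega)]; simp
  have hN : (N : ℝ) + 1 ≠ 0 := by positivity
  unfold quadLevel
  rw [this]
  field_simp
  ring

theorem exists_quadLevel_symm {N : ℕ} {c : ℝ} :
    (∃ n < N, 1 - c = quadLevel N n) ↔ ∃ n < N, c = quadLevel N n := by
  constructor
  · rintro ⟨n, hn, h⟩
    exact ⟨N - 1 - n, by omega, by rw [← quadLevel_symm hn]; linarith⟩
  · rintro ⟨n, hn, h⟩
    exact ⟨N - 1 - n, by omega, by rw [← quadLevel_symm hn]; linarith⟩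

namespace TetCoords.Permutes

variable {p : Equiv.Perm (Fin 4)} {v w : TetCoords}

theorem onTri_iff (h : Permutes p v w) (i : Fin 4) (x : Tetra) :
    w.OnTri (p i) (Tetra.permute p x) ↔ v.OnTri i x := by
  rw [OnTri, OnTri, h.1, Tetra.permute_apply_apply]

theorem onQuad_iff (h : Permutes p v w) (k : Fin 3) (x : Tetra) :
    w.OnQuad (quadIdx (p 0) (p k.succ)) (Tetra.permute p x) ↔ v.OnQuad k x := by
  rw [OnQuad, OnQuad, h.2]
  have hne : p 0 ≠ p k.succ := fun e => (Fin.succ_ne_zero k) (p.injective e).symm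
  have e0 := Tetra.permute_apply_apply p x 0
  have ek := Tetra.permute_apply_apply p x k.succ
  rcases quadIdx_cases _ _ hne with ⟨h1, h2⟩ | ⟨h1, h2⟩ | hl
  · rw [← h2, ek]
    nth_rewrite 1 [← h1]
    rw [e0]
  · rw [← h1, e0]
    nth_rewrite 1 [← h2]
    rw [ek, add_comm]
  · have := hl.sum (Tetra.permute p x)
    rw [e0, ek] at this
    rw [← exists_quadLevel_symm (c := x 0 + x k.succ)]
    have e : Tetra.permute p x 0 + Tetra.permute p x (quadIdx (p 0) (p k.succ)).succ =
      1 - (x 0 + x k.succ) := by linarith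
    rw [e]

theorem permute_mem_model (h : Permutes p v w) (x : Tetra) :
    Tetra.permute p x ∈ w.model ↔ x ∈ v.model := by
  rw [mem_model, mem_model]
  refine or_congr ?_ ?_
  · rw [p.surjective.exists]
    exact exists_congr fun i => h.onTri_iff i x
  · rw [(quadIdx_bijective p).surjective.exists]
    exact exists_congr fun k => h.onQuad_iff k x

theorem image_model (h : Permutes p v w) : Tetra.permuteHomeo p '' v.model = w.model := by
  ext y
  obtain ⟨x, rfl⟩ := (Tetra.permuteHomeo p).surjective y
  rw [(Tetra.permuteHomeo p).injective.mem_set_image]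
  exact (h.permute_mem_model x).symm

theorem admissible (h : Permutes p v w) (hw : w.Admissible) : v.Admissible := fun k l hk hl => by
  rw [← h.2] at hk hl
  exact (quadIdx_bijective p).injective (hw _ _ hk hl)

theorem admissible' (h : Permutes p v w) (hv : v.Admissible) : w.Admissible := by
  intro k l hk hl
  obtain ⟨k, rfl⟩ := (quadIdx_bijective p).surjective k
  obtain ⟨l, rfl⟩ := (quadIdx_bijective p).surjective l
  simp only [h.2] at hk hl
  rw [hv k l hk hl]

end TetCoords.Permutes

/-- Pillows with an arbitrary labelling of the vertices. -/
theorem exists_pillowMap_permute (p : Equiv.Perm (Fin 4)) {v w w' : TetCoords}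
    (hv : v.Permutes p w) (hv' : v.pillowed.Permutes p w') (hw : w.Admissible)
    {θ : Tetra ≃ₜ Tetra} (hθ : FacePreserving θ) :
    ∃ K, PillowMap (p 0) (p 1) (p 2) (p 3) K ∧
      NormallyIsotopic (K 0 ⁻¹' (θ '' w.model)) w.model ∧
      NormallyIsotopic (K 1 ⁻¹' (θ '' w.model)) w'.model ∧
      NormallyIsotopic (K 2 ⁻¹' (θ '' w.model)) w'.model := by
  obtain ⟨K, hK, h0, h1, h2⟩ := exists_pillowMap (hv.admissible hw)
  let P := Tetra.permuteHomeo p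
  -- `E` carries the flat discs in standard labelling to the actual surface, so conjugating the
  -- standard pillow by `E` adapts it to that surface.
  let E : Tetra ≃ₜ Tetra := P.trans θ
  have hE : ∀ x i, E x (p i) = 0 ↔ x i = 0 := fun x i => by
    change θ (Tetra.permute p x) (p i) = 0 ↔ _
    rw [hθ, Tetra.permute_apply_apply]
  have hmodel : θ '' w.model = E '' v.model := by
    rw [← hv.image_model, ← Set.image_comp]; rfl
  have key : ∀ g {u u' : TetCoords}, u.Permutes p u' → NormallyIsotopic (K g ⁻¹' v.model) u.model →
      NormallyIsotopic ((E ∘ K g ∘ E.symm) ⁻¹' (θ '' w.model)) u'.model := by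
    rintro g u u' hu ⟨η, hη, e⟩
    refine ⟨((P.symm.trans η).trans P).trans θ, (hη.conj_permute p).trans hθ, ?_⟩
    have e1 : (E ∘ K g ∘ E.symm) ⁻¹' (θ '' w.model) = E '' (K g ⁻¹' v.model) := by
      rw [hmodel, Set.preimage_comp, Set.preimage_image_eq _ E.injective, Set.preimage_comp,
        E.image_eq_preimage_symm]
    rw [e1, e, ← hu.image_model, ← Set.image_comp, ← Set.image_comp]
    congr 1
    funext x
    simp [E, P]
  exact ⟨_, hK.conj E p hE, key 0 hv h0, key 1 hv' h1, key 2 hv' h2⟩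

/-! ### The gadget -/

theorem gadget_glue {g g' : Fin 5} {f : Fin 4} {p : Equiv.Perm (Fin 4)}
    (h : gadget.glue g f = some (g', p)) : gadgetNbr g f = some g' ∧ p = 1 := by
  simp only [gadget, Option.map_eq_some_iff, Prod.mk.injEq] at h
  obtain ⟨k, hk, rfl, rfl⟩ := h
  exact ⟨hk, rfl⟩

theorem gadget_point_eq {g g' : Fin 5} {f : Fin 4} (h : gadgetNbr g f = some g') {x : Tetra}
    (hx : x f = 0) : gadget.point g x = gadget.point g' x := by
  have h' : gadget.glue g f = some (g', 1) := by simp [gadget, h]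
  exact Quot.sound (Triangulation.Identified.glue g f g' 1 h' x hx)

instance : CompactSpace gadget.Space :=
  inferInstanceAs (CompactSpace (Quot gadget.Identified))

/-- The tetrahedra of the gadget that form the first pillow with its base tetrahedron. -/
def firstPillow : Fin 3 → Fin 5 := ![0, 1, 3]

/-- The maps of the tetrahedra of the gadget given by two successive pillows. -/
def gadgetMap (K₁ K₂ : Fin 3 → Tetra → Tetra) : Fin 5 → Tetra → Tetra :=
  ![K₂ 0 ∘ K₁ 0, K₂ 0 ∘ K₁ 1, K₂ 1, K₂ 0 ∘ K₁ 2, K₂ 2]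

section gadgetMap

variable {K₁ K₂ : Fin 3 → Tetra → Tetra} (h₁ : PillowMap 0 2 1 3 K₁) (h₂ : PillowMap 0 3 1 2 K₂)

include h₁ in
-- Injectivity of the inner pillow, expressed in the gadget: images can only coincide along faces
-- that the gadget glues.
theorem first_point_eq {a b : Fin 3} {x y : Tetra} (h : K₁ a x = K₁ b y) :
    gadget.point (firstPillow a) x = gadget.point (firstPillow b) y := by
  have f1 : ∀ x : Tetra, x 0 = 0 ∨ x 2 = 0 → gadget.point 0 x = gadget.point 1 x := by
    rintro x (hx | hx)
    · exact gadget_point_eq (f := 0) (by decide) hx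
    · exact gadget_point_eq (f := 2) (by decide) hx
  have f2 : ∀ x : Tetra, x 1 = 0 ∨ x 3 = 0 → gadget.point 1 x = gadget.point 3 x := by
    rintro x (hx | hx)
    · exact gadget_point_eq (f := 1) (by decide) hx
    · exact gadget_point_eq (f := 3) (by decide) hx
  have c01 : ∀ x y, K₁ 0 x = K₁ 1 y → gadget.point 0 x = gadget.point 1 y := fun x y h => by
    obtain ⟨rfl, hx⟩ := h₁.eq₀₁ x y h
    exact f1 x hx
  have c12 : ∀ x y, K₁ 1 x = K₁ 2 y → gadget.point 1 x = gadget.point 3 y := fun x y h => by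
    obtain ⟨rfl, hx⟩ := h₁.eq₁₂ x y h
    exact f2 x hx
  have c02 : ∀ x y, K₁ 0 x = K₁ 2 y → gadget.point 0 x = gadget.point 3 y := fun x y h => by
    obtain ⟨rfl, hx, hx'⟩ := h₁.eq₀₂ x y h
    rw [f1 x hx, f2 x hx']
  fin_cases a <;> fin_cases b
  · rw [h₁.injective 0 h]
  · exact c01 x y h
  · exact c02 x y h
  · exact (c01 y x h.symm).symm
  · rw [h₁.injective 1 h]
  · exact c12 x y h
  · exact (c02 y x h.symm).symm
  · exact (c12 y x h.symm).symm
  · rw [h₁.injective 2 h]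

include h₁ in
-- Face 0 of the inner complex belongs to tetrahedron 3 and face 3 to tetrahedron 0. There the inner
-- maps are the identity, and the gadget glues these faces to tetrahedron 2.
theorem first_point_eq_two {a : Fin 3} {x y : Tetra} (h : K₁ a x = y) (hy : y 0 = 0 ∨ y 3 = 0) :
    gadget.point (firstPillow a) x = gadget.point 2 y := by
  rcases hy with hy | hy
  · rw [first_point_eq h₁ (b := 2) (h.trans (h₁.bdry₂ y (Or.inl hy)).symm)]
    exact gadget_point_eq (f := 0) (by decide) hy
  · rw [first_point_eq h₁ (b := 0) (h.trans (h₁.bdry₀ y (Or.inr hy)).symm)]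
    exact gadget_point_eq (f := 3) (by decide) hy

theorem firstPillow_cases : ∀ g : Fin 5, (∃ a, g = firstPillow a) ∨ g = 2 ∨ g = 4 := by decide

theorem gadgetMap_firstPillow (a : Fin 3) (x : Tetra) :
    gadgetMap K₁ K₂ (firstPillow a) x = K₂ 0 (K₁ a x) := by
  fin_cases a <;> rfl

include h₁ h₂

/-- A coincidence in the outer pillow lies over a glued outer face; if the base is involved, the
inner pillow is then consulted on that face. -/
theorem gadgetMap_injective {g g' : Fin 5} {x y : Tetra}
    (h : gadgetMap K₁ K₂ g x = gadgetMap K₁ K₂ g' y) : gadget.point g x = gadget.point g' y := by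
  have f24 : ∀ x : Tetra, x 1 = 0 ∨ x 2 = 0 → gadget.point 2 x = gadget.point 4 x := by
    rintro x (hx | hx)
    · exact gadget_point_eq (f := 1) (by decide) hx
    · exact gadget_point_eq (f := 2) (by decide) hx
  have cX2 : ∀ a x y, K₂ 0 (K₁ a x) = K₂ 1 y →
      gadget.point (firstPillow a) x = gadget.point 2 y := fun a x y h => by
    obtain ⟨e, hy⟩ := h₂.eq₀₁ _ _ h
    rw [e] at hy
    exact first_point_eq_two h₁ e hy
  have cX4 : ∀ a x y, K₂ 0 (K₁ a x) = K₂ 2 y →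
      gadget.point (firstPillow a) x = gadget.point 4 y := fun a x y h => by
    obtain ⟨e, hy, hy'⟩ := h₂.eq₀₂ _ _ h
    rw [e] at hy hy'
    rw [first_point_eq_two h₁ e hy, f24 y hy']
  have c24 : ∀ x y, K₂ 1 x = K₂ 2 y → gadget.point 2 x = gadget.point 4 y := fun x y h => by
    obtain ⟨rfl, hx⟩ := h₂.eq₁₂ x y h
    exact f24 x hx
  rcases firstPillow_cases g with ⟨a, rfl⟩ | rfl | rfl <;>
    rcases firstPillow_cases g' with ⟨b, rfl⟩ | rfl | rfl <;>
    try simp only [gadgetMap_firstPillow] at h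
  · exact first_point_eq h₁ (h₂.injective 0 h)
  · exact cX2 a x y h
  · exact cX4 a x y h
  · exact (cX2 b y x h.symm).symm
  · rw [h₂.injective 1 h]
  · exact c24 x y h
  · exact (cX4 b y x h.symm).symm
  · exact (c24 y x h.symm).symm
  · rw [h₂.injective 2 h]

theorem gadgetMap_eq {g g' : Fin 5} {f : Fin 4} (h : gadgetNbr g f = some g') {x : Tetra}
    (hx : x f = 0) : gadgetMap K₁ K₂ g x = gadgetMap K₁ K₂ g' x := by
  have m0 : gadgetMap K₁ K₂ 0 x = K₂ 0 (K₁ 0 x) := rfl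
  have m1 : gadgetMap K₁ K₂ 1 x = K₂ 0 (K₁ 1 x) := rfl
  have m2 : gadgetMap K₁ K₂ 2 x = K₂ 1 x := rfl
  have m3 : gadgetMap K₁ K₂ 3 x = K₂ 0 (K₁ 2 x) := rfl
  have m4 : gadgetMap K₁ K₂ 4 x = K₂ 2 x := rfl
  have e01 : x 0 = 0 ∨ x 2 = 0 → gadgetMap K₁ K₂ 0 x = gadgetMap K₁ K₂ 1 x := fun hx => by
    rw [m0, m1, h₁.glue₁ x hx]
  have e13 : x 1 = 0 ∨ x 3 = 0 → gadgetMap K₁ K₂ 1 x = gadgetMap K₁ K₂ 3 x := fun hx => by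
    rw [m1, m3, h₁.glue₂ x hx]
  have e24 : x 1 = 0 ∨ x 2 = 0 → gadgetMap K₁ K₂ 2 x = gadgetMap K₁ K₂ 4 x := fun hx => by
    rw [m2, m4, h₂.glue₂ x hx]
  have e02 : x 3 = 0 → gadgetMap K₁ K₂ 0 x = gadgetMap K₁ K₂ 2 x := fun hx => by
    rw [m0, m2, h₁.bdry₀ x (Or.inr hx), h₂.glue₁ x (Or.inr hx)]
  have e23 : x 0 = 0 → gadgetMap K₁ K₂ 2 x = gadgetMap K₁ K₂ 3 x := fun hx => by
    rw [m3, m2, h₁.bdry₂ x (Or.inl hx), h₂.glue₁ x (Or.inl hx)]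
  -- The gluings sorted by origin: inner pillow (two kinds), the two faces inside the outer pillow,
  -- and the two faces attaching it to the base.
  have table : ∀ (g : Fin 5) (f : Fin 4) (g' : Fin 5), gadgetNbr g f = some g' →
      ((g = 0 ∧ g' = 1 ∨ g = 1 ∧ g' = 0) ∧ (f = 0 ∨ f = 2)) ∨
      ((g = 1 ∧ g' = 3 ∨ g = 3 ∧ g' = 1) ∧ (f = 1 ∨ f = 3)) ∨
      ((g = 2 ∧ g' = 4 ∨ g = 4 ∧ g' = 2) ∧ (f = 1 ∨ f = 2)) ∨
      ((g = 0 ∧ g' = 2 ∨ g = 2 ∧ g' = 0) ∧ f = 3) ∨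
      ((g = 2 ∧ g' = 3 ∨ g = 3 ∧ g' = 2) ∧ f = 0) := by decide
  have two : ∀ {a b : Fin 4}, f = a ∨ f = b → x a = 0 ∨ x b = 0 := by
    rintro a b (rfl | rfl)
    · exact Or.inl hx
    · exact Or.inr hx
  rcases table g f g' h with ⟨hg, hf⟩ | ⟨hg, hf⟩ | ⟨hg, hf⟩ | ⟨hg, rfl⟩ | ⟨hg, rfl⟩ <;>
    rcases hg with ⟨rfl, rfl⟩ | ⟨rfl, rfl⟩
  exacts [e01 (two hf), (e01 (two hf)).symm, e13 (two hf), (e13 (two hf)).symm, e24 (two hf),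
    (e24 (two hf)).symm, e02 hx, (e02 hx).symm, e23 hx, (e23 hx).symm]

theorem gadgetMap_bdry (m : Fin 4) {x : Tetra} (hx : x m = 0) :
    gadgetMap K₁ K₂ (gadgetBdry m) x = x := by
  fin_cases m
  · exact h₂.bdry₂ x (Or.inl hx)
  · change K₂ 0 (K₁ 0 x) = x
    rw [h₁.bdry₀ x (Or.inl hx), h₂.bdry₀ x (Or.inl hx)]
  · change K₂ 0 (K₁ 2 x) = x
    rw [h₁.bdry₂ x (Or.inr hx), h₂.bdry₀ x (Or.inr hx)]
  · exact h₂.bdry₂ x (Or.inr hx)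

/-- Two successive pillows identify the gadget with the tetrahedron. -/
theorem exists_gadget_homeomorph :
    ∃ h : gadget.Space ≃ₜ Tetra, ∀ g x, h (gadget.point g x) = gadgetMap K₁ K₂ g x := by
  let m : gadget.Space → Tetra := Quot.lift (fun p => gadgetMap K₁ K₂ p.1 p.2) (by
    rintro _ _ ⟨i, f, j, p, hp, x, hx⟩
    obtain ⟨h, rfl⟩ := gadget_glue hp
    exact gadgetMap_eq h₁ h₂ h hx)
  have hm : Continuous m := by
    refine continuous_quot_lift _ (continuous_sigma fun g => ?_)
    have a := h₁.continuous
    have b := h₂.continuous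
    fin_cases g
    exacts [(b 0).comp (a 0), (b 0).comp (a 1), b 1, (b 0).comp (a 2), b 2]
  have inj : Function.Injective m := by
    rintro ⟨g, x⟩ ⟨g', y⟩ h
    exact gadgetMap_injective h₁ h₂ h
  have surj : Function.Surjective m := by
    intro y
    obtain ⟨b, z, rfl⟩ := h₂.surjective y
    fin_cases b
    · obtain ⟨a, x, rfl⟩ := h₁.surjective z
      exact ⟨gadget.point (firstPillow a) x, gadgetMap_firstPillow a x⟩
    · exact ⟨gadget.point 2 z, rfl⟩
    · exact ⟨gadget.point 4 z, rfl⟩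
  let e : gadget.Space ≃ Tetra := Equiv.ofBijective m ⟨inj, surj⟩
  exact ⟨Continuous.homeoOfEquivCompactToT2 (f := e) hm, fun g x => rfl⟩

end gadgetMap

/-- The normal coordinates in the gadget of the surface that replaces the one with normal
coordinates `w`. -/
def gadgetCoords (w : TetCoords) : Fin 5 → TetCoords :=
  ∑ i, w.tri i • gadgetTri i + ∑ k, w.quad k • ![gadgetQuad0123, gadgetQuad0213, gadgetQuad0312] k

/-- Read as pillows: the base keeps `w`, tetrahedra 1 and 3 trade each quadrilateral 02/13 for
triangles at 0 and 2, and tetrahedra 2 and 4 trade each quadrilateral 03/12 for triangles at 0 and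
3. -/
theorem gadgetCoords_eq (w : TetCoords) : gadgetCoords w =
    ![w, ![w 0 + w 5, w 1, w 2 + w 5, w 3, w 4, 0, w 6],
      ![w 0 + w 6, w 1, w 2, w 3 + w 6, w 4, w 5, 0],
      ![w 0 + w 5, w 1, w 2 + w 5, w 3, w 4, 0, w 6],
      ![w 0 + w 6, w 1, w 2, w 3 + w 6, w 4, w 5, 0]] := by
  funext g j
  simp only [gadgetCoords, Pi.add_apply, Pi.smul_apply, smul_eq_mul,
    Fin.sum_univ_four, Fin.sum_univ_three]
  fin_cases g <;> fin_cases j <;>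
    simp only [gadgetTri, gadgetQuad0123, gadgetQuad0213, gadgetQuad0312, Matrix.cons_val,
      mul_one, mul_zero, add_zero, zero_add, Fin.mk_one, Fin.zero_eta, Fin.reduceFinMk] <;> rfl

theorem TetCoords.permutes_of_apply {p : Equiv.Perm (Fin 4)} {v w : TetCoords} {a b c d : Fin 4}
    (h : p 0 = a ∧ p 1 = b ∧ p 2 = c ∧ p 3 = d)
    (ht : w.tri a = v 0 ∧ w.tri b = v 1 ∧ w.tri c = v 2 ∧ w.tri d = v 3)
    (hq : w.quad (quadIdx a b) = v 4 ∧ w.quad (quadIdx a c) = v 5 ∧ w.quad (quadIdx a d) = v 6) :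
    TetCoords.Permutes p v w := by
  obtain ⟨rfl, rfl, rfl, rfl⟩ := h
  constructor
  · intro i
    fin_cases i
    exacts [ht.1, ht.2.1, ht.2.2.1, ht.2.2.2]
  · intro k
    fin_cases k
    exacts [hq.1, hq.2.1, hq.2.2]

/-- The swap brings the degree two edge 02 of the first pillow to the standard position 01. -/
theorem permutes_first (w : TetCoords) : TetCoords.Permutes (Equiv.swap 1 2)
    ![w 0, w 2, w 1, w 3, w 5, w 4, w 6] w :=
  TetCoords.permutes_of_apply (a := 0) (b := 2) (c := 1) (d := 3) (by decide) ⟨rfl, rfl, rfl, rfl⟩ ⟨rfl, rfl, rfl⟩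

theorem permutes_first' (w : TetCoords) : TetCoords.Permutes (Equiv.swap 1 2)
    (TetCoords.pillowed ![w 0, w 2, w 1, w 3, w 5, w 4, w 6])
    ![w 0 + w 5, w 1, w 2 + w 5, w 3, w 4, 0, w 6] :=
  TetCoords.permutes_of_apply (a := 0) (b := 2) (c := 1) (d := 3) (by decide) ⟨rfl, rfl, rfl, rfl⟩ ⟨rfl, rfl, rfl⟩

/-- Here the degree two edge is 03; the permutation sends 0, 1, 2, 3 to 0, 3, 1, 2. -/
theorem permutes_second (w : TetCoords) : TetCoords.Permutes (Equiv.swap 1 3 * Equiv.swap 2 3)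
    ![w 0, w 3, w 1, w 2, w 6, w 4, w 5] w :=
  TetCoords.permutes_of_apply (a := 0) (b := 3) (c := 1) (d := 2) (by decide) ⟨rfl, rfl, rfl, rfl⟩ ⟨rfl, rfl, rfl⟩

theorem permutes_second' (w : TetCoords) : TetCoords.Permutes (Equiv.swap 1 3 * Equiv.swap 2 3)
    (TetCoords.pillowed ![w 0, w 3, w 1, w 2, w 6, w 4, w 5])
    ![w 0 + w 6, w 1, w 2, w 3 + w 6, w 4, w 5, 0] :=
  TetCoords.permutes_of_apply (a := 0) (b := 3) (c := 1) (d := 2) (by decide) ⟨rfl, rfl, rfl, rfl⟩ ⟨rfl, rfl, rfl⟩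

/-- For every normal surface in the tetrahedron there is a homeomorphism from the gadget that is
the identity on the boundary and pulls it back to a normal surface. -/
theorem exists_gadget_homeomorph_normal {w : TetCoords} (hw : w.Admissible) {θ : Tetra ≃ₜ Tetra}
    (hθ : FacePreserving θ) : ∃ h : gadget.Space ≃ₜ Tetra,
      (∀ (m : Fin 4) (x : Tetra), x m = 0 → h (gadget.point (gadgetBdry m) x) = x) ∧
      ∀ g, NormallyIsotopic {x | h (gadget.point g x) ∈ θ '' w.model} (gadgetCoords w g).model := by
  -- The outer pillow is chosen first. Its base sees a normal surface with the same coordinates `w`,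
  -- now with straightening `θ'`, and the inner pillow is adapted to that one.
  obtain ⟨K₂, h₂, ⟨θ', hθ', e⟩, n21, n22⟩ :=
    exists_pillowMap_permute _ (permutes_second w) (permutes_second' w) hw hθ
  obtain ⟨K₁, h₁, n10, n11, n12⟩ :=
    exists_pillowMap_permute _ (permutes_first w) (permutes_first' w) hw hθ'
  rw [← e] at n10 n11 n12
  have h₂' : PillowMap 0 3 1 2 K₂ := h₂
  have h₁' : PillowMap 0 2 1 3 K₁ := h₁
  obtain ⟨h, hh⟩ := exists_gadget_homeomorph h₁' h₂'
  refine ⟨h, fun m x hx => (hh _ _).trans (gadgetMap_bdry h₁' h₂' m hx), fun g => ?_⟩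
  simp only [hh, gadgetCoords_eq]
  fin_cases g
  exacts [n10, n11, n21, n12, n22]

theorem gadgetCoords_quad_le (w : TetCoords) (g : Fin 5) (k : Fin 3) :
    (gadgetCoords w g).quad k ≤ w.quad k := by
  rw [gadgetCoords_eq]
  fin_cases g <;> fin_cases k <;> first | exact le_refl (w _) | exact Nat.zero_le _

theorem gadgetCoords_admissible {w : TetCoords} (hw : w.Admissible) (g : Fin 5) :
    (gadgetCoords w g).Admissible := fun k l hk hl =>
  hw k l (fun h => hk (Nat.le_zero.1 (h ▸ gadgetCoords_quad_le w g k)))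
    fun h => hl (Nat.le_zero.1 (h ▸ gadgetCoords_quad_le w g l))

/-! ### The coordinates of the replacing surface -/

theorem gadgetQuad_eq : ∀ a b : Fin 4, a ≠ b →
    gadgetQuad a b = ![gadgetQuad0123, gadgetQuad0213, gadgetQuad0312] (quadIdx a b) := by
  intro a b h
  have key : ∀ a b : Fin 4, a ≠ b →
      (quadIdx a b = 0 ∧ (({a, b} : Finset (Fin 4)) = {0, 1} ∨ ({a, b} : Finset (Fin 4)) = {2, 3})) ∨
      (quadIdx a b = 1 ∧
        ¬ (({a, b} : Finset (Fin 4)) = {0, 1} ∨ ({a, b} : Finset (Fin 4)) = {2, 3}) ∧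
        (({a, b} : Finset (Fin 4)) = {0, 2} ∨ ({a, b} : Finset (Fin 4)) = {1, 3})) ∨
      (quadIdx a b = 2 ∧
        ¬ (({a, b} : Finset (Fin 4)) = {0, 1} ∨ ({a, b} : Finset (Fin 4)) = {2, 3}) ∧
        ¬ (({a, b} : Finset (Fin 4)) = {0, 2} ∨ ({a, b} : Finset (Fin 4)) = {1, 3})) := by
    decide
  unfold gadgetQuad
  rcases key a b h with ⟨e, h1⟩ | ⟨e, h1, h2⟩ | ⟨e, h1, h2⟩
  · rw [if_pos h1, e]; rfl
  · rw [if_neg h1, if_pos h2, e]; rfl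
  · rw [if_neg h1, if_neg h2, e]; rfl

theorem TetCoords.exists_permutes (p : Equiv.Perm (Fin 4)) (v : TetCoords) :
    ∃ w, TetCoords.Permutes p v w := by
  let e := Equiv.ofBijective _ (quadIdx_bijective p)
  refine ⟨fun j => Fin.addCases (motive := fun _ : Fin (4 + 3) => ℕ) (fun i => v.tri (p.symm i))
    (fun k => v.quad (e.symm k)) j, fun i => ?_, fun k => ?_⟩
  · rw [TetCoords.tri, Fin.addCases_left, Equiv.symm_apply_apply]
  · rw [TetCoords.quad, Fin.addCases_right]
    exact congrArg v.quad (e.symm_apply_apply k)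

theorem TetCoords.Permutes.gadgetCoords_eq {p : Equiv.Perm (Fin 4)} {v w : TetCoords}
    (h : TetCoords.Permutes p v w) : gadgetCoords w =
      v 0 • gadgetTri (p 0) + v 1 • gadgetTri (p 1) + v 2 • gadgetTri (p 2) + v 3 • gadgetTri (p 3)
        + v 4 • gadgetQuad (p 0) (p 1) + v 5 • gadgetQuad (p 0) (p 2)
        + v 6 • gadgetQuad (p 0) (p 3) := by
  have e1 : ∑ i, w.tri i • gadgetTri i = ∑ i, v.tri i • gadgetTri (p i) := by
    rw [← Equiv.sum_comp p]
    simp only [h.1]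
  have e2 : ∑ k, w.quad k • ![gadgetQuad0123, gadgetQuad0213, gadgetQuad0312] k =
      ∑ k : Fin 3, v.quad k • gadgetQuad (p 0) (p k.succ) := by
    rw [← (quadIdx_bijective p).sum_comp]
    refine Finset.sum_congr rfl fun k _ => ?_
    rw [h.2, gadgetQuad_eq _ _ fun e => (Fin.succ_ne_zero k) (p.injective e).symm]
  rw [gadgetCoords, e1, e2, Fin.sum_univ_four, Fin.sum_univ_three]
  simp only [← add_assoc]
  rfl

/-- The homeomorphism from the gadget to the tetrahedron it replaces, adapted to a normal
surface. -/
theorem exists_adapted_homeomorph (σ : Equiv.Perm (Fin 4)) {v : TetCoords} (hv : v.Admissible)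
    {θ : Tetra ≃ₜ Tetra} (hθ : FacePreserving θ) : ∃ h : gadget.Space ≃ₜ Tetra,
      (∀ (f : Fin 4) (x : Tetra), x f = 0 →
        h (gadget.point (gadgetBdry (σ f)) (Tetra.permute σ x)) = x) ∧
      ∃ w, TetCoords.Permutes σ v w ∧ ∀ g, (gadgetCoords w g).Admissible ∧
        NormallyIsotopic {x | h (gadget.point g x) ∈ θ '' v.model} (gadgetCoords w g).model := by
  obtain ⟨w, hw⟩ := TetCoords.exists_permutes σ v
  have hwa := hw.admissible' hv
  -- The surface is handled in the vertex labels of the gadget, where `θ` becomes its conjugate by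
  -- `σ`; composing with `P.symm` returns to the labels of `τ`.
  obtain ⟨h, h1, h2⟩ := exists_gadget_homeomorph_normal hwa (hθ.conj_permute σ)
  let P := Tetra.permuteHomeo σ
  refine ⟨h.trans P.symm, fun f x hx => ?_, w, hw, fun g => ⟨gadgetCoords_admissible hwa g, ?_⟩⟩
  · rw [Homeomorph.trans_apply, h1 (σ f) _ (by rwa [Tetra.permute_apply_apply])]
    exact Tetra.permuteHomeo_symm_permute σ x
  · convert h2 g using 1
    ext x
    rw [Set.mem_ofPred_eq, Set.mem_ofPred_eq, Homeomorph.trans_apply, ← hw.image_model,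
      ← P.injective.mem_set_image, Homeomorph.apply_symm_apply, ← Set.image_comp, ← Set.image_comp]
    refine iff_of_eq (congrArg (fun s => h (gadget.point g x) ∈ s) ?_)
    refine congrArg (fun f => f '' v.model) (funext fun y => ?_)
    simp [P]

/-! ### The identification of the two spaces -/

namespace Triangulation

variable {ι : Type*}

theorem continuous_point (T : Triangulation ι) (i : ι) : Continuous (T.point i) :=
  continuous_quot_mk.comp continuous_sigmaMk

theorem point_eq (T : Triangulation ι) {i j : ι} {f : Fin 4} {p : Equiv.Perm (Fin 4)}
    (h : T.glue i f = some (j, p)) {x : Tetra} (hx : x f = 0) :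
    T.point i x = T.point j (Tetra.permute p x) :=
  Quot.sound (Identified.glue i f j p h x hx)

variable [DecidableEq ι] (T : Triangulation ι) (τ : ι) (σ : Equiv.Perm (Fin 4))

theorem replace_glue_newTet (i : ι) (f : Fin 4) {j : ι} {q : Equiv.Perm (Fin 4)}
    (h : T.glue i f = some (j, q)) :
    (T.replace τ σ).glue (newTet τ σ i f) (relabel τ σ i f) =
      some (newTet τ σ j (q f), relabel τ σ j * q * (relabel τ σ i)⁻¹) := by
  change T.replaceGlue τ σ _ _ = _
  rw [replaceGlue_newTet, h]
  rfl

theorem replace_glue_inr {g g' : Fin 5} {f : Fin 4} {p : Equiv.Perm (Fin 4)}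
    (h : gadget.glue g f = some (g', p)) :
    (T.replace τ σ).glue (Sum.inr g) f = some (Sum.inr g', p) := by
  have hg : g ≠ gadgetBdry f := fun e => by
    have h1 := (gadget_glue h).1
    rw [(gadgetNbr_eq_none_iff g f).2 e] at h1
    cases h1
  change T.replaceGlue τ σ (Sum.inr g) f = _
  simp only [replaceGlue, if_neg hg, h]
  rfl

/-- The map from the gadget to the new triangulation. -/
def gadgetInclusion : gadget.Space → (T.replace τ σ).Space :=
  Quot.lift (fun p => (T.replace τ σ).point (Sum.inr p.1) p.2) (by
    rintro _ _ ⟨g, f, g', p, hp, x, hx⟩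
    exact (T.replace τ σ).point_eq (T.replace_glue_inr τ σ hp) hx)

theorem continuous_gadgetInclusion : Continuous (T.gadgetInclusion τ σ) :=
  continuous_quot_lift _ (continuous_sigma fun g => (T.replace τ σ).continuous_point (Sum.inr g))

section identification

variable (h : gadget.Space ≃ₜ Tetra)

/-- The tetrahedra of the new triangulation, mapped to the old one. -/
def toOldTet : ({i : ι // i ≠ τ} ⊕ Fin 5) → Tetra → T.Space
  | Sum.inl i, x => T.point i x
  | Sum.inr g, x => T.point τ (h (gadget.point g x))

/-- The tetrahedra of the old triangulation, mapped to the new one. -/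
def toNewTet (i : ι) (x : Tetra) : (T.replace τ σ).Space :=
  if hi : i ≠ τ then (T.replace τ σ).point (Sum.inl ⟨i, hi⟩) x
  else T.gadgetInclusion τ σ (h.symm x)

variable {h} (hb : ∀ (f : Fin 4) (x : Tetra), x f = 0 →
  h (gadget.point (gadgetBdry (σ f)) (Tetra.permute σ x)) = x)

include hb

/-- On faces the old and the new description of a tetrahedron agree, for `τ` by the boundary
condition `hb`. This settles compatibility with every gluing that comes from `T`. -/
theorem toOldTet_newTet (i : ι) {m : Fin 4} {x : Tetra} (hx : x m = 0) :
    T.toOldTet τ h (newTet τ σ i m) (Tetra.permute (relabel τ σ i) x) = T.point i x := by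
  by_cases hi : i = τ
  · subst hi
    simp only [newTet, relabel, dif_pos, if_pos, toOldTet]
    rw [hb m x hx]
  · simp only [newTet, relabel, dif_neg hi, if_neg hi, toOldTet, Tetra.permute_one]

theorem toNewTet_newTet (i : ι) {m : Fin 4} {x : Tetra} (hx : x m = 0) :
    T.toNewTet τ σ h i x =
      (T.replace τ σ).point (newTet τ σ i m) (Tetra.permute (relabel τ σ i) x) := by
  by_cases hi : i = τ
  · subst hi
    have e : h.symm x = gadget.point (gadgetBdry (σ m)) (Tetra.permute σ x) := by
      rw [Homeomorph.symm_apply_eq, hb m x hx]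
    simp only [newTet, relabel, dif_pos, if_pos, toNewTet, ne_eq, not_true_eq_false,
      not_false_eq_true, dif_neg, e]
    rfl
  · rw [toNewTet, dif_pos hi]
    simp only [newTet, relabel, dif_neg hi, if_neg hi, Tetra.permute_one]

theorem toOldTet_identified {a b : Σ _ : {i : ι // i ≠ τ} ⊕ Fin 5, Tetra}
    (hab : (T.replace τ σ).Identified a b) :
    T.toOldTet τ h a.1 a.2 = T.toOldTet τ h b.1 b.2 := by
  obtain ⟨a, f, b, p, hp, x, hx⟩ := hab
  rcases new_face_cases τ σ a f with ⟨i, m, rfl, rfl⟩ | ⟨g, rfl, hg⟩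
  · have hp' := hp
    change T.replaceGlue τ σ _ _ = _ at hp'
    rw [replaceGlue_newTet] at hp'
    simp only [Option.map_eq_some_iff, Prod.mk.injEq] at hp'
    obtain ⟨⟨j, q⟩, hq, rfl, rfl⟩ := hp'
    obtain ⟨y, rfl⟩ := (Tetra.permuteHomeo (relabel τ σ i)).surjective x
    rw [Tetra.permuteHomeo_apply, Tetra.permute_apply_apply] at hx
    simp only [Tetra.permuteHomeo_apply, Tetra.permute_permute, inv_mul_cancel_right]
    rw [T.toOldTet_newTet τ σ hb i hx, ← Tetra.permute_permute,
      T.toOldTet_newTet τ σ hb j (m := q m) (by rwa [Tetra.permute_apply_apply])]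
    exact T.point_eq hq hx
  · change T.replaceGlue τ σ (Sum.inr g) f = _ at hp
    simp only [replaceGlue, if_neg hg, Option.map_eq_some_iff, Prod.mk.injEq] at hp
    obtain ⟨⟨k, q⟩, hq, rfl, rfl⟩ := hp
    simp only [toOldTet]
    rw [gadget.point_eq hq hx]

theorem toNewTet_identified {a b : Σ _ : ι, Tetra} (hab : T.Identified a b) :
    T.toNewTet τ σ h a.1 a.2 = T.toNewTet τ σ h b.1 b.2 := by
  obtain ⟨i, f, j, p, hp, x, hx⟩ := hab
  simp only
  rw [T.toNewTet_newTet τ σ hb i hx, T.toNewTet_newTet τ σ hb j (m := p f) (x := Tetra.permute p x)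
    (by rwa [Tetra.permute_apply_apply]), Tetra.permute_permute,
    (T.replace τ σ).point_eq (T.replace_glue_newTet τ σ i f hp)
      (by rwa [Tetra.permute_apply_apply]), Tetra.permute_permute, inv_mul_cancel_right]

/-- A homeomorphism of the gadget with the tetrahedron that is compatible with the gluing induces
an identification of the underlying spaces. -/
theorem exists_identification : ∃ φ : (T.replace τ σ).Space ≃ₜ T.Space,
    (∀ (i : {i : ι // i ≠ τ}) (x : Tetra),
      φ ((T.replace τ σ).point (Sum.inl i) x) = T.point i x) ∧
    ∀ (g : Fin 5) (x : Tetra),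
      φ ((T.replace τ σ).point (Sum.inr g) x) = T.point τ (h (gadget.point g x)) := by
  let F : (T.replace τ σ).Space → T.Space := Quot.lift (fun p => T.toOldTet τ h p.1 p.2)
    fun a b hab => T.toOldTet_identified τ σ hb hab
  let G : T.Space → (T.replace τ σ).Space := Quot.lift (fun p => T.toNewTet τ σ h p.1 p.2)
    fun a b hab => T.toNewTet_identified τ σ hb hab
  have new_ne : ∀ (i : {i : ι // i ≠ τ}) x,
      T.toNewTet τ σ h i x = (T.replace τ σ).point (Sum.inl i) x := fun i x => by
    simp only [toNewTet, dif_pos i.2]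
  have new_eq : ∀ x, T.toNewTet τ σ h τ x = T.gadgetInclusion τ σ (h.symm x) := fun x => by
    simp [toNewTet]
  refine ⟨⟨⟨F, G, ?_, ?_⟩, ?_, ?_⟩, fun i x => rfl, fun g x => rfl⟩
  · rintro ⟨i | g, x⟩
    · exact new_ne i x
    · change T.toNewTet τ σ h τ (h (gadget.point g x)) = _
      rw [new_eq, Homeomorph.symm_apply_apply]
      rfl
  · rintro ⟨i, x⟩
    change F (T.toNewTet τ σ h i x) = T.point i x
    by_cases hi : i = τ
    · subst hi
      rw [new_eq]
      obtain ⟨y, rfl⟩ := h.surjective x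
      rw [Homeomorph.symm_apply_apply]
      obtain ⟨g, z⟩ := y
      rfl
    · rw [new_ne ⟨i, hi⟩]
      rfl
  · refine continuous_quot_lift _ (continuous_sigma fun a => ?_)
    rcases a with i | g
    · exact T.continuous_point i
    · exact (T.continuous_point τ).comp (h.continuous.comp (gadget.continuous_point g))
  · refine continuous_quot_lift _ (continuous_sigma fun i => ?_)
    by_cases hi : i = τ
    · subst hi
      simp only [new_eq]
      exact (T.continuous_gadgetInclusion i σ).comp h.symm.continuous
    · simp only [new_ne ⟨i, hi⟩]
      exact (T.replace τ σ).continuous_point _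

end identification

end Triangulation

/-! ### The Alexander trick in the tetrahedron -/

namespace Tetra

/-- The gauge of the tetrahedron with respect to its barycentre. -/
def gauge (x : Tetra) : ℝ := 1 - 4 * min (min (x 0) (x 1)) (min (x 2) (x 3))

theorem continuous_gauge : Continuous gauge := by
  unfold gauge
  fun_prop

theorem gauge_nonneg (x : Tetra) : 0 ≤ x.gauge := by
  have h := x.sum_four
  have h0 : min (min (x 0) (x 1)) (min (x 2) (x 3)) ≤ x 0 := by simp
  have h1 : min (min (x 0) (x 1)) (min (x 2) (x 3)) ≤ x 1 := by simp
  have h2 : min (min (x 0) (x 1)) (min (x 2) (x 3)) ≤ x 2 := by simp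
  have h3 : min (min (x 0) (x 1)) (min (x 2) (x 3)) ≤ x 3 := by simp
  unfold gauge
  linarith

theorem gauge_le_one (x : Tetra) : x.gauge ≤ 1 := by
  have : 0 ≤ min (min (x 0) (x 1)) (min (x 2) (x 3)) := by simp [x.nonneg]
  unfold gauge
  linarith

theorem one_sub_gauge_le (x : Tetra) (i : Fin 4) : 1 - x.gauge ≤ 4 * x i := by
  have : min (min (x 0) (x 1)) (min (x 2) (x 3)) ≤ x i := by fin_cases i <;> simp
  unfold gauge
  linarith

theorem exists_one_sub_gauge (x : Tetra) : ∃ i, 1 - x.gauge = 4 * x i := by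
  unfold gauge
  rcases min_choice (min (x 0) (x 1)) (min (x 2) (x 3)) with h | h <;> rw [h]
  · rcases min_choice (x 0) (x 1) with h | h <;> rw [h]
    exacts [⟨0, by ring⟩, ⟨1, by ring⟩]
  · rcases min_choice (x 2) (x 3) with h | h <;> rw [h]
    exacts [⟨2, by ring⟩, ⟨3, by ring⟩]

theorem gauge_eq_one_iff (x : Tetra) : x.gauge = 1 ↔ ∃ i, x i = 0 := by
  constructor
  · intro h
    obtain ⟨i, hi⟩ := x.exists_one_sub_gauge
    exact ⟨i, by linarith⟩
  · rintro ⟨i, hi⟩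
    have := x.one_sub_gauge_le i
    linarith [x.gauge_le_one]

open Classical in
/-- Dilation from the barycentre by the factor `ρ`. -/
noncomputable def dilate (ρ : ℝ) (x : Tetra) : Tetra :=
  if h : 0 ≤ ρ ∧ ρ * x.gauge ≤ 1 then
    ⟨fun i => (1 - ρ) / 4 + ρ * x i, fun i => by
      have := mul_le_mul_of_nonneg_left (x.one_sub_gauge_le i) h.1
      linarith [h.2], by
      have := x.sum_four
      rw [Fin.sum_univ_four]
      linear_combination ρ * this⟩
  else x

theorem dilate_apply {ρ : ℝ} {x : Tetra} (h0 : 0 ≤ ρ) (h : ρ * x.gauge ≤ 1) (i : Fin 4) :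
    dilate ρ x i = (1 - ρ) / 4 + ρ * x i := by
  rw [dilate, dif_pos ⟨h0, h⟩]
  rfl

theorem gauge_dilate {ρ : ℝ} {x : Tetra} (h0 : 0 ≤ ρ) (h : ρ * x.gauge ≤ 1) :
    (dilate ρ x).gauge = ρ * x.gauge := by
  apply le_antisymm
  · obtain ⟨i, hi⟩ := (dilate ρ x).exists_one_sub_gauge
    have := mul_le_mul_of_nonneg_left (x.one_sub_gauge_le i) h0
    rw [dilate_apply h0 h] at hi
    linarith
  · obtain ⟨i, hi⟩ := x.exists_one_sub_gauge
    have h1 := (dilate ρ x).one_sub_gauge_le i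
    rw [dilate_apply h0 h] at h1
    linear_combination h1 - ρ * hi

theorem dilate_dilate {ρ ρ' : ℝ} {x : Tetra} (h0 : 0 ≤ ρ) (h0' : 0 ≤ ρ') (h : ρ * x.gauge ≤ 1)
    (h' : ρ' * (ρ * x.gauge) ≤ 1) : dilate ρ' (dilate ρ x) = dilate (ρ' * ρ) x := by
  ext i
  rw [dilate_apply h0' (by rwa [gauge_dilate h0 h]), dilate_apply h0 h,
    dilate_apply (mul_nonneg h0' h0) (by rwa [mul_assoc])]
  ring

theorem dilate_one (x : Tetra) : dilate 1 x = x := by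
  ext i
  rw [dilate_apply zero_le_one (by rw [one_mul]; exact x.gauge_le_one)]
  ring

/-- The radius at which the Alexander isotopy acts. -/
noncomputable def radius (t : unitInterval) (x : Tetra) : ℝ := max t x.gauge

theorem continuous_radius : Continuous fun p : unitInterval × Tetra => radius p.1 p.2 :=
  (continuous_subtype_val.comp continuous_fst).max (continuous_gauge.comp continuous_snd)

theorem radius_nonneg (t : unitInterval) (x : Tetra) : 0 ≤ radius t x := le_max_of_le_left t.2.1

theorem radius_le_one (t : unitInterval) (x : Tetra) : radius t x ≤ 1 :=
  max_le t.2.2 x.gauge_le_one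

theorem inv_radius_mul_gauge (t : unitInterval) (x : Tetra) : (radius t x)⁻¹ * x.gauge ≤ 1 :=
  inv_mul_le_one_of_le₀ (le_max_right _ _) (radius_nonneg t x)

theorem radius_mul_gauge (t : unitInterval) (x y : Tetra) : radius t x * y.gauge ≤ 1 :=
  mul_le_one₀ (radius_le_one t x) y.gauge_nonneg y.gauge_le_one

/-- The Alexander isotopy from the identity to `k`. -/
noncomputable def alexander (k : Tetra → Tetra) (t : unitInterval) (x : Tetra) : Tetra :=
  dilate (radius t x) (k (dilate (radius t x)⁻¹ x))

theorem alexander_apply (k : Tetra → Tetra) (t : unitInterval) (x : Tetra) (i : Fin 4) :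
    alexander k t x i = (1 - radius t x) / 4 + radius t x * k (dilate (radius t x)⁻¹ x) i :=
  dilate_apply (radius_nonneg t x) (radius_mul_gauge t x _) i

/-- Shrinking undoes expanding. At radius 0 the inverse is 0 by convention, but the point is then
the barycentre and the formula still holds. -/
theorem radius_mul_dilate (t : unitInterval) (x : Tetra) (i : Fin 4) :
    x i = (1 - radius t x) / 4 + radius t x * dilate (radius t x)⁻¹ x i := by
  rw [dilate_apply (inv_nonneg.2 (radius_nonneg t x)) (inv_radius_mul_gauge t x)]
  rcases (radius_nonneg t x).eq_or_lt with h | h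
  · rw [← h]
    have h1 : x.gauge ≤ 0 := h ▸ le_max_right _ _
    have h2 := x.one_sub_gauge_le
    have h3 := x.sum_four
    have : ∀ i, x i = 1 / 4 := fun i => by
      fin_cases i <;> simp only [Fin.zero_eta, Fin.mk_one, Fin.reduceFinMk] <;>
        linarith [h2 0, h2 1, h2 2, h2 3]
    rw [this]
    norm_num
  · field_simp
    ring

theorem alexander_id (t : unitInterval) (x : Tetra) : alexander id t x = x := by
  ext i
  rw [alexander_apply, id, ← radius_mul_dilate]

theorem alexander_one (k : Tetra → Tetra) (x : Tetra) : alexander k 1 x = k x := by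
  have : radius 1 x = 1 := max_eq_left x.gauge_le_one
  rw [alexander, this, inv_one, dilate_one, dilate_one]

theorem alexander_of_eq_zero {k : Tetra → Tetra} (hk : ∀ x : Tetra, ∀ i, x i = 0 → k x = x)
    (t : unitInterval) (x : Tetra) (i : Fin 4) (hx : x i = 0) : alexander k t x = x := by
  have h1 : x.gauge = 1 := x.gauge_eq_one_iff.2 ⟨i, hx⟩
  have h2 : radius t x = 1 := by rw [radius, h1]; exact max_eq_right t.2.2
  rw [alexander, h2, inv_one, dilate_one, dilate_one, hk x i hx]

/-- Outside the dilated tetrahedron the Alexander isotopy does nothing. -/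
theorem eq_of_lt_radius {k : Tetra → Tetra} (hk : ∀ x : Tetra, ∀ i, x i = 0 → k x = x)
    {t : unitInterval} {x : Tetra} (h : (t : ℝ) < x.gauge) :
    radius t x = x.gauge ∧ k (dilate (radius t x)⁻¹ x) = dilate (radius t x)⁻¹ x := by
  have h1 : radius t x = x.gauge := max_eq_right h.le
  have h2 : (dilate (radius t x)⁻¹ x).gauge = 1 := by
    rw [gauge_dilate (inv_nonneg.2 (radius_nonneg t x)) (inv_radius_mul_gauge t x), h1,
      inv_mul_cancel₀ (lt_of_le_of_lt t.2.1 h).ne']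
  obtain ⟨i, hi⟩ := (gauge_eq_one_iff _).1 h2
  exact ⟨h1, hk _ i hi⟩

theorem alexander_of_lt {k : Tetra → Tetra} (hk : ∀ x : Tetra, ∀ i, x i = 0 → k x = x)
    {t : unitInterval} {x : Tetra} (h : (t : ℝ) < x.gauge) : alexander k t x = x := by
  ext i
  rw [alexander_apply, (eq_of_lt_radius hk h).2, ← radius_mul_dilate]

theorem alexander_zero {k : Tetra → Tetra} (hk : ∀ x : Tetra, ∀ i, x i = 0 → k x = x)
    (x : Tetra) : alexander k 0 x = x := by
  rcases x.gauge_nonneg.eq_or_lt with h | h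
  · have h1 : radius 0 x = 0 := by rw [radius, ← h]; simp
    ext i
    rw [alexander_apply, radius_mul_dilate 0 x i, h1]
    simp
  · exact alexander_of_lt hk (by simpa using h)

/-- Outside the dilated tetrahedron all maps are the identity; inside, the radius is `t` before and
after applying the map, so the dilations in the middle cancel. Applied to a homeomorphism and its
inverse, this makes each stage of the isotopy bijective. -/
theorem alexander_comp {k k' : Tetra → Tetra} (hk : ∀ x : Tetra, ∀ i, x i = 0 → k x = x)
    (hk' : ∀ x : Tetra, ∀ i, x i = 0 → k' x = x) (t : unitInterval) (x : Tetra) :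
    alexander k' t (alexander k t x) = alexander (k' ∘ k) t x := by
  have hkk : ∀ x : Tetra, ∀ i, x i = 0 → (k' ∘ k) x = x := fun x i hx => by
    rw [Function.comp_apply, hk x i hx, hk' x i hx]
  rcases lt_or_ge (t : ℝ) x.gauge with h | h
  · rw [alexander_of_lt hk h, alexander_of_lt hk' h, alexander_of_lt hkk h]
  · have hr : radius t x = t := max_eq_left h
    rcases t.2.1.eq_or_lt with h0 | h0
    · have : t = 0 := Subtype.ext h0.symm
      rw [this, alexander_zero hk, alexander_zero hk', alexander_zero hkk]
    · have hg : (alexander k t x).gauge = t * (k (dilate (t : ℝ)⁻¹ x)).gauge := by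
        rw [alexander, gauge_dilate (radius_nonneg t x) (radius_mul_gauge t x _), hr]
      have hr' : radius t (alexander k t x) = t :=
        max_eq_left (by rw [hg]; exact mul_le_of_le_one_right t.2.1 (gauge_le_one _))
      have hd : dilate (t : ℝ)⁻¹ (alexander k t x) = k (dilate (t : ℝ)⁻¹ x) := by
        rw [alexander, hr, dilate_dilate t.2.1 (inv_nonneg.2 t.2.1)
          (by simpa only [hr] using radius_mul_gauge t x (k (dilate (t : ℝ)⁻¹ x)))
          (by rw [inv_mul_cancel_left₀ h0.ne']; exact gauge_le_one _),
          inv_mul_cancel₀ h0.ne', dilate_one]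
      rw [alexander, hr', hd, alexander, hr]
      rfl

/-- Only radius 0 is delicate, where the inverse radius blows up. There the displacement is bounded
by the radius and so tends to 0. -/
theorem continuous_alexander {k : Tetra → Tetra} (hc : Continuous k) :
    Continuous fun p : unitInterval × Tetra => alexander k p.1 p.2 := by
  refine continuous_tetra fun i => continuous_iff_continuousAt.2 fun p => ?_
  have hcr := continuous_radius
  rcases (radius_nonneg p.1 p.2).eq_or_lt with h0 | h0
  · have hi : Continuous fun q : unitInterval × Tetra => q.2 i :=
      (continuous_coord i).comp continuous_snd
    have e : alexander k p.1 p.2 i = p.2 i := by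
      rw [alexander_apply, radius_mul_dilate p.1 p.2 i, ← h0]
      simp
    have hb : ∀ q : unitInterval × Tetra,
        |alexander k q.1 q.2 i - q.2 i| ≤ radius q.1 q.2 := fun q => by
      set y := k (dilate (radius q.1 q.2)⁻¹ q.2) with hy
      have h1 : alexander k q.1 q.2 i - q.2 i =
          radius q.1 q.2 * (y i - dilate (radius q.1 q.2)⁻¹ q.2 i) := by
        rw [alexander_apply]
        linear_combination -radius_mul_dilate q.1 q.2 i
      rw [h1, abs_mul, abs_of_nonneg (radius_nonneg _ _)]
      refine mul_le_of_le_one_right (radius_nonneg _ _) (abs_le.2 ?_)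
      constructor <;> linarith [y.nonneg i, y.le_one i,
        (dilate (radius q.1 q.2)⁻¹ q.2).nonneg i, (dilate (radius q.1 q.2)⁻¹ q.2).le_one i]
    have hl : Filter.Tendsto (fun q : unitInterval × Tetra => alexander k q.1 q.2 i - q.2 i)
        (nhds p) (nhds 0) :=
      squeeze_zero_norm hb (by simpa only [← h0] using hcr.tendsto p)
    have := hl.add (hi.tendsto p)
    simp only [sub_add_cancel, zero_add] at this
    rwa [← e] at this
  · let U : Set (unitInterval × Tetra) := {q | 0 < radius q.1 q.2}
    have hU : U ∈ nhds p := (isOpen_lt continuous_const hcr).mem_nhds h0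
    have hinv : ContinuousOn (fun q : unitInterval × Tetra => (radius q.1 q.2)⁻¹) U :=
      hcr.continuousOn.inv₀ fun q hq => ne_of_gt hq
    have hd : ContinuousOn (fun q : unitInterval × Tetra => dilate (radius q.1 q.2)⁻¹ q.2) U := by
      refine continuousOn_tetra fun j => ?_
      have : ContinuousOn (fun q : unitInterval × Tetra =>
          (1 - (radius q.1 q.2)⁻¹) / 4 + (radius q.1 q.2)⁻¹ * q.2 j) U :=
        ((continuousOn_const.sub hinv).div_const 4).add
          (hinv.mul ((continuous_coord j).comp continuous_snd).continuousOn)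
      refine this.congr fun q _ => ?_
      exact dilate_apply (inv_nonneg.2 (radius_nonneg _ _)) (inv_radius_mul_gauge _ _) j
    simp only [alexander_apply]
    exact ((((continuousOn_const.sub hcr.continuousOn).div_const 4).add (hcr.continuousOn.mul
      ((continuous_coord i).comp_continuousOn (hc.comp_continuousOn hd)))).continuousAt hU)

end Tetra

/-! ### Isotopies supported in one tetrahedron -/

namespace Triangulation

variable {ι : Type*} [DecidableEq ι] (T : Triangulation ι) (τ : ι)

/-- The self-map of a triangulation induced by a map `k` of the tetrahedron `τ` that fixes the
boundary. -/
def inducedMap (k : Tetra → Tetra) (hk : ∀ x : Tetra, ∀ i, x i = 0 → k x = x) :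
    T.Space → T.Space :=
  Quot.lift (fun p => T.point p.1 (if p.1 = τ then k p.2 else p.2)) (by
    have key : ∀ (i : ι) (x : Tetra) (f : Fin 4), x f = 0 → (if i = τ then k x else x) = x :=
      fun i x f hx => by rw [hk x f hx, ite_self]
    rintro _ _ ⟨i, f, j, p, hp, x, hx⟩
    simp only
    rw [key i x f hx, key j (Tetra.permute p x) (p f) (by rwa [Tetra.permute_apply_apply])]
    exact T.point_eq hp hx)

theorem inducedMap_point {k : Tetra → Tetra} (hk : ∀ x : Tetra, ∀ i, x i = 0 → k x = x) (i : ι)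
    (x : Tetra) : T.inducedMap τ k hk (T.point i x) = T.point i (if i = τ then k x else x) := rfl

theorem inducedMap_point_self {k : Tetra → Tetra} (hk : ∀ x : Tetra, ∀ i, x i = 0 → k x = x)
    (x : Tetra) : T.inducedMap τ k hk (T.point τ x) = T.point τ (k x) := by
  rw [inducedMap_point, if_pos rfl]

theorem inducedMap_point_of_ne {k : Tetra → Tetra} (hk : ∀ x : Tetra, ∀ i, x i = 0 → k x = x)
    {i : ι} (hi : i ≠ τ) (x : Tetra) : T.inducedMap τ k hk (T.point i x) = T.point i x := by
  rw [inducedMap_point, if_neg hi]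

theorem inducedMap_leftInverse {k k' : Tetra → Tetra} (hk : ∀ x : Tetra, ∀ i, x i = 0 → k x = x)
    (hk' : ∀ x : Tetra, ∀ i, x i = 0 → k' x = x) (h : Function.LeftInverse k' k) :
    Function.LeftInverse (T.inducedMap τ k' hk') (T.inducedMap τ k hk) := by
  rintro ⟨i, x⟩
  change T.inducedMap τ k' hk' (T.inducedMap τ k hk (T.point i x)) = T.point i x
  by_cases hi : i = τ
  · subst hi
    rw [inducedMap_point_self, inducedMap_point_self, h x]
  · rw [inducedMap_point_of_ne _ _ _ hi, inducedMap_point_of_ne _ _ _ hi]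

/-- The product of a quotient map with the locally compact unit interval is again a quotient map, so
joint continuity can be checked on single tetrahedra. -/
theorem continuous_inducedMap_family {K : unitInterval → Tetra → Tetra}
    (hK : ∀ t, ∀ x : Tetra, ∀ i, x i = 0 → K t x = x)
    (hc : Continuous fun p : unitInterval × Tetra => K p.1 p.2) :
    Continuous fun p : unitInterval × T.Space => T.inducedMap τ (K p.1) (hK p.1) p.2 := by
  have hq : Topology.IsQuotientMap (Quot.mk T.Identified) := isQuotientMap_quot_mk
  refine hq.continuous_lift_prod_right (Z := T.Space)
    (g := fun p : unitInterval × T.Space => T.inducedMap τ (K p.1) (hK p.1) p.2) ?_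
  have : Continuous fun q : (Σ _ : ι, Tetra) × unitInterval =>
      T.inducedMap τ (K q.2) (hK q.2) (T.point q.1.1 q.1.2) := by
    rw [← (Homeomorph.sigmaProdDistrib (X := fun _ : ι => Tetra) (Y := unitInterval)).symm
      |>.comp_continuous_iff']
    refine continuous_sigma fun i => ?_
    change Continuous fun q : Tetra × unitInterval =>
      T.inducedMap τ (K q.2) (hK q.2) (T.point i q.1)
    by_cases hi : i = τ
    · subst hi
      simp only [inducedMap_point_self]
      exact (T.continuous_point i).comp (hc.comp continuous_swap)
    · simp only [inducedMap_point_of_ne _ _ _ hi]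
      exact (T.continuous_point i).comp continuous_fst
  exact this.comp continuous_swap

theorem continuous_inducedMap {k : Tetra → Tetra} (hk : ∀ x : Tetra, ∀ i, x i = 0 → k x = x)
    (hc : Continuous k) : Continuous (T.inducedMap τ k hk) :=
  (T.continuous_inducedMap_family τ (fun _ : unitInterval => hk) (hc.comp continuous_snd)).comp
    (Continuous.prodMk_right (0 : unitInterval))

/-- A homeomorphism of a tetrahedron that fixes the boundary moves every set by an ambient
isotopy. -/
theorem ambientIsotopic_inducedMap (k : Tetra ≃ₜ Tetra) (hk : ∀ x : Tetra, ∀ i, x i = 0 → k x = x)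
    (S : Set T.Space) : AmbientIsotopic S (T.inducedMap τ k hk '' S) := by
  have hk' : ∀ x : Tetra, ∀ i, x i = 0 → k.symm x = x := fun x i hx => by
    rw [Homeomorph.symm_apply_eq, hk x i hx]
  have a1 := Tetra.alexander_of_eq_zero hk
  have a2 := Tetra.alexander_of_eq_zero hk'
  have l1 : ∀ t, Function.LeftInverse (Tetra.alexander k.symm t) (Tetra.alexander k t) :=
    fun t x => by rw [Tetra.alexander_comp hk hk', k.symm_comp_self, Tetra.alexander_id]
  have l2 : ∀ t, Function.LeftInverse (Tetra.alexander k t) (Tetra.alexander k.symm t) :=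
    fun t x => by rw [Tetra.alexander_comp hk' hk, k.self_comp_symm, Tetra.alexander_id]
  have c1 := Tetra.continuous_alexander k.continuous
  have c2 := Tetra.continuous_alexander k.symm.continuous
  have s1 : ∀ t, Continuous (Tetra.alexander k t) := fun t => c1.comp (Continuous.prodMk_right t)
  have s2 : ∀ t, Continuous (Tetra.alexander k.symm t) :=
    fun t => c2.comp (Continuous.prodMk_right t)
  refine ⟨fun t => ⟨⟨T.inducedMap τ (Tetra.alexander k t) (a1 t),
    T.inducedMap τ (Tetra.alexander k.symm t) (a2 t), T.inducedMap_leftInverse τ _ _ (l1 t),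
    T.inducedMap_leftInverse τ _ _ (l2 t)⟩, T.continuous_inducedMap τ (a1 t) (s1 t),
    T.continuous_inducedMap τ (a2 t) (s2 t)⟩, T.continuous_inducedMap_family τ a1 c1, ?_, ?_⟩
  · rintro ⟨i, x⟩
    change T.point i (if i = τ then Tetra.alexander k 0 x else x) = T.point i x
    rw [Tetra.alexander_zero hk, ite_self]
  · have e : Tetra.alexander k 1 = k := funext (Tetra.alexander_one k)
    change T.inducedMap τ (Tetra.alexander k 1) (a1 1) '' S = _
    simp only [e]

end Triangulation

/-! ### The corollary. -/

/-- For every triangulation `T`, tetrahedron `τ` and permutation `σ = (a, b, c, d)`, the space of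
`T' = T_τ^{abcd(G)}` can be identified with that of `T`, and for every normal surface `S` of `T`
with coordinates `v` there is a normal surface `S'` of `T'` that agrees with `S` outside `τ`, has the
stated coordinates in the gadget, and is isotopic to `S` (under every identification). -/
theorem corollary3p1 {ι : Type*} [Finite ι] [DecidableEq ι] (T : Triangulation ι) (τ : ι)
    (σ : Equiv.Perm (Fin 4)) :
    (∃ φ : (T.replace τ σ).Space ≃ₜ T.Space, T.IsGadgetIdentification τ σ φ) ∧
    ∀ (S : Set T.Space) (v : ι → TetCoords), T.HasNormalCoords S v →
      ∃ S' : Set (T.replace τ σ).Space,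
        (T.replace τ σ).HasNormalCoords S'
          (Sum.elim (fun i => v i)
            (v τ 0 • gadgetTri (σ 0) + v τ 1 • gadgetTri (σ 1)
              + v τ 2 • gadgetTri (σ 2) + v τ 3 • gadgetTri (σ 3)
              + v τ 4 • gadgetQuad (σ 0) (σ 1)
              + v τ 5 • gadgetQuad (σ 0) (σ 2)
              + v τ 6 • gadgetQuad (σ 0) (σ 3))) ∧
        (∀ (i : {i : ι // i ≠ τ}) (x : Tetra),
          (T.replace τ σ).point (Sum.inl i) x ∈ S' ↔ T.point i x ∈ S) ∧
        ∀ φ : (T.replace τ σ).Space ≃ₜ T.Space, T.IsGadgetIdentification τ σ φ →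
          AmbientIsotopic S (φ '' S') := by
  refine ⟨?_, fun S v hS => ?_⟩
  -- The empty surface suffices to produce some identification.
  · have h0 : TetCoords.Admissible 0 := fun k _ hk => absurd rfl hk
    obtain ⟨h, hb, -⟩ := exists_adapted_homeomorph σ h0 FacePreserving.refl
    obtain ⟨φ, h1, h2⟩ := T.exists_identification τ σ hb
    exact ⟨φ, h1, h, hb, h2⟩
  obtain ⟨hv, θ, hθ, hSθ⟩ := hS τ
  obtain ⟨h, hb, w, hw, hn⟩ := exists_adapted_homeomorph σ hv hθ
  obtain ⟨φ₀, h1, h2⟩ := T.exists_identification τ σ hb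
  -- The new surface is the old one seen through the adapted identification.
  refine ⟨φ₀ ⁻¹' S, ?_, fun i x => by rw [Set.mem_preimage, h1], ?_⟩
  · rw [← hw.gadgetCoords_eq]
    rintro (i | g)
    · refine ⟨(hS i).1, ?_⟩
      obtain ⟨ψ, hψ, hi⟩ := (hS i).2
      refine ⟨ψ, hψ, ?_⟩
      rw [Sum.elim_inl, ← hi]
      ext x
      rw [Set.mem_preimage, Set.mem_preimage, Set.mem_preimage, h1]
    · refine ⟨(hn g).1, ?_⟩
      obtain ⟨ψ, hψ, hg⟩ := (hn g).2
      refine ⟨ψ, hψ, ?_⟩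
      rw [Sum.elim_inr, ← hg, ← hSθ]
      ext x
      rw [Set.mem_preimage, Set.mem_preimage, h2, Set.mem_ofPred_eq, Set.mem_preimage]
  · rintro φ ⟨hφ1, h', hb', hφ2⟩
    -- Both gadget homeomorphisms have the same boundary values, so their comparison map fixes the
    -- boundary of `τ`.
    have hk : ∀ x : Tetra, ∀ i, x i = 0 → h.symm.trans h' x = x := fun x i hx => by
      rw [Homeomorph.trans_apply, (Homeomorph.symm_apply_eq h).2 (hb i x hx).symm, hb' i x hx]
    have key : ∀ y, φ y = T.inducedMap τ (h.symm.trans h') hk (φ₀ y) := by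
      rintro ⟨i | g, x⟩
      · refine (hφ1 i x).trans ((T.inducedMap_point_of_ne τ hk i.2 x).symm.trans ?_)
        exact congrArg _ (h1 i x).symm
      · refine (hφ2 g x).trans (Eq.trans ?_ (congrArg _ (h2 g x).symm))
        rw [T.inducedMap_point_self, Homeomorph.trans_apply, Homeomorph.symm_apply_apply]
    -- Any identification is `φ₀` followed by this comparison map inside `τ`, so the Alexander trick
    -- applies to the image of `S`.
    have e : φ '' (φ₀ ⁻¹' S) = T.inducedMap τ (h.symm.trans h') hk '' S := by
      rw [Set.image_congr fun y _ => key y,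
        ← Set.image_image (T.inducedMap τ (h.symm.trans h') hk) φ₀,
        Set.image_preimage_eq _ φ₀.surjective]
    rw [e]
    exact T.ambientIsotopic_inducedMap τ _ hk S
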